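/- Let $n\ge 2$ and $\tfrac12\le\alpha<\tfrac32$, and let $1\le p\le \frac{2n+2}{n+1+4\alpha}$ with $(\alpha,p)\neq\bigl(\tfrac12,\tfrac{2n+2}{n+3}\bigr)$. For $f\in L^p(\mathbb R^n)$ let $\hat f$ be its Fourier transform, normalized by $\hat f(\xi)=\int_{\mathbb R^n}e^{-i\xi\cdot x}f(x)\,dx$ for Schwartz functions $f$ and extended to $L^p$ in the sense of tempered distributions, in which sense $\hat f$ is a locally integrable function because $1\le p\le 2$. We say that $\hat f$ vanishes on the unit sphere (in the $L^2$-trace sense) if there are Schwartz functions $\varphi_k$ with $\varphi_k\to f$ in $L^p(\mathbb R^n)$ and $\hat\varphi_k|_{\mathbb S^{n-1}}\to 0$ in $L^2(\mathbb S^{n-1})$ with respect to surface measure. Let $S^{-\alpha}f$ be the tempered distribution, if it is defined, given by $$(S^{-\alpha}f)^{\wedge}(\xi)=(1-|\xi|^2)_+^{-\alpha}\,\hat f(\xi),$$ where $(1-|\xi|^2)_+^{-\alpha}$ equals $(1-|\xi|^2)^{-\alpha}$ for $|\xi|<1$ and $0$ for $|\xi|\ge1$. Then there is a constant $C=C(n,\alpha,p)<\infty$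 such that for every $f\in L^p(\mathbb R^n)$ for which $\hat f$ vanishes on the unit sphere, $S^{-\alpha}f$ is defined, belongs to $L^2(\mathbb R^n)$, and satisfies $$\|S^{-\alpha}f\|_{L^2(\mathbb R^n)}\le C\,\|f\|_{L^p(\mathbb R^n)}.$$ -/

import Mathlib

open MeasureTheory Filter Topology
open scoped SchwartzMap ENNReal NNReal

namespace BochnerRiesz

noncomputable section

/-- Euclidean space `ℝⁿ`, with the Euclidean norm and Lebesgue measure. -/
abbrev E (n : ℕ) : Type := EuclideanSpace ℝ (Fin n)

/-- The Fourier integral `f̂(ξ) = ∫ e^{-i ξ·x} f(x) dx` (no factor `2π` in the exponent). It is used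
only for Schwartz functions, where the integral converges absolutely. -/
def fourierInt {n : ℕ} (f : E n → ℂ) (ξ : E n) : ℂ :=
  ∫ x : E n, Complex.exp (-Complex.I * ((inner ℝ ξ x : ℝ) : ℂ)) * f x

/-- Comparison with Mathlib's Fourier transform, whose kernel is `e^{-2πi ξ·x}`. -/
theorem fourierInt_eq_fourier {n : ℕ} (f : E n → ℂ) (ξ : E n) :
    fourierInt f ξ = FourierTransform.fourier f ((2 * Real.pi)⁻¹ • ξ) := by
  rw [Real.fourier_eq', fourierInt]
  refine integral_congr_ae (Eventually.of_forall fun x => ?_)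
  have h : (-2 * Real.pi * inner ℝ x ((2 * Real.pi)⁻¹ • ξ) : ℝ) = -inner ℝ ξ x := by
    rw [inner_smul_right, real_inner_comm]
    have := Real.pi_ne_zero
    field_simp
  simp only [h, smul_eq_mul]
  congr 2
  push_cast
  ring

/-- `IsFourierTransform f g`: the Fourier transform of `f`, as a tempered distribution, is the
function `g`. That is, `∫ g φ = ∫ f φ̂` for all Schwartz `φ`, where both integrals converge
absolutely. The function `g` is determined by `f`, and `f` by `g`, up to null sets. Every function
in `L^p` with `1 ≤ p ≤ 2` has such a Fourier transform. -/
def IsFourierTransform {n : ℕ} (f g : E n → ℂ) : Prop :=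
  ∀ φ : 𝓢(E n, ℂ),
    Integrable (fun ξ => g ξ * φ ξ) ∧ Integrable (fun x => f x * fourierInt φ x) ∧
      ∫ ξ, g ξ * φ ξ = ∫ x, f x * fourierInt φ x

/-- The multiplier `(1 - |ξ|²)_+^z`, equal to `(1 - |ξ|²)^z` for `|ξ| < 1` and to `0` elsewhere. -/
def multiplier {n : ℕ} (z : ℝ) (ξ : E n) : ℝ :=
  if ‖ξ‖ < 1 then (1 - ‖ξ‖ ^ 2) ^ z else 0

/-- `IsBochnerRiesz z f u`: the function `u` is `S^z f`, that is,
`û(ξ) = (1 - |ξ|²)_+^z f̂(ξ)`. Such a `u` is unique up to null sets. -/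
def IsBochnerRiesz {n : ℕ} (z : ℝ) (f u : E n → ℂ) : Prop :=
  ∃ g : E n → ℂ, IsFourierTransform f g ∧
    IsFourierTransform u (fun ξ => (multiplier z ξ : ℂ) * g ξ)

/-- The surface measure on the unit sphere of `ℝⁿ`. -/
abbrev surfaceMeasure (n : ℕ) : Measure (Metric.sphere (0 : E n) 1) :=
  (volume : Measure (E n)).toSphere

/-- `HasSphereTrace p f h`: the function `h` is the `L²` trace on the unit sphere of the Fourier
transform of `f ∈ L^p`: there are Schwartz functions `φ_k → f` in `L^p` whose Fourier transforms,
restricted to the sphere, tend to `h` in `L²` of surface measure. For `1 ≤ p ≤ (2n+2)/(n+3)`,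
`n ≥ 2`, restriction is bounded from `L^p` to `L²` of the sphere, so that `h` exists, is unique, and
is the limit along every such sequence. -/
def HasSphereTrace {n : ℕ} (p : ℝ≥0∞) (f : E n → ℂ) (h : Metric.sphere (0 : E n) 1 → ℂ) : Prop :=
  ∃ φ : ℕ → 𝓢(E n, ℂ),
    Tendsto (fun k => eLpNorm (fun x => φ k x - f x) p volume) atTop (𝓝 0) ∧
    Tendsto (fun k => eLpNorm (fun ω : Metric.sphere (0 : E n) 1 =>
      fourierInt (φ k) (ω : E n) - h ω) 2 (surfaceMeasure n)) atTop (𝓝 0)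

/-- The Fourier transform of `f ∈ L^p` vanishes on the unit sphere, in the `L²` trace sense. -/
def FourierVanishesOnSphere {n : ℕ} (p : ℝ≥0∞) (f : E n → ℂ) : Prop :=
  HasSphereTrace p f (fun _ => 0)

end

end BochnerRiesz

/-! By Plancherel the claim is a weighted bound `∫ |1 - |ξ|²|^(-2α) |f̂|² ≤ C ‖f‖_p²` over the unit
ball. A Gaussian factor `e^{-|ξ|²}` may be inserted, since it is bounded below there; it makes all
symbols integrable and all kernels explicit. Put `γ = 2α - 1`, which lies in `(0, 2)` when `1/2 < α
< 3/2`. In one variable the Fourier transform of `|t|^γ` is a negative multiple of `|s|^(-γ-1) =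
|s|^(-2α)`, regularized by subtraction of the value at `s = 0`. With `s = 1 - |ξ|²` the subtracted
term lives on the sphere, where `f̂` vanishes. Hence the weighted norm is controlled by the
quadratic form with symbol `∫ h(t) e^{its} dt`, for `h` of size `t^γ` on the half-line, and it
remains to bound that form on `L^p`.

The form bound (`exists_fourierForm_le`) depends on `h` only through symbol estimates. Split `h` at
a scale `T`. The part beyond `T` has a convolution kernel of size `T^(2α - (n+1)/2)`: the kernel of
`e^{it(1-|ξ|²)} e^{-|ξ|²}` decays like `t^(-n/2)` and oscillates with phase about `t + r²/(4t)`, so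
van der Corput's lemma applies (`exists_norm_integral_gaussKernel_le`). This controls the form
through `L¹` norms. The part below `T`, corrected to have mean zero, has a multiplier bounded by
`T^(2α) min(T|s|, 1/(T|s|))`, which is used in `L²` (`exists_fourierForm_pair_bound`).

To reach the endpoint exponent without loss, decompose `f` into pieces `f_k` of height about `2^k`,
and use for the pair `(k, l)` the scale `T = 2^(-δ(k+l))`. The `L¹` contributions then factor into a
square. In the `L²` contributions the profile `min(x, 1/x)` is summable over `k + l`, uniformly in
`ξ`, so Schur's test at each fixed `ξ` leaves only the diagonal
(`exists_fourierForm_sum_levelPart_le`). The value of `δ` and the critical exponent are exactly what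
makes both sums comparable to powers of `∫ |f|^p`; homogeneity turns the result into a quadratic
bound.

Concretely `h` is `gaussDiff`, a finite combination of Gaussians satisfying the symbol estimates
uniformly in its two parameters `I ≤ m`. The real part of its multiplier is a peak of width `2^(-m)`
at `s = 0` minus a weight that grows to a multiple of `|s|^(-2α)` as `I → ∞`. Three limits follow:
`m → ∞` turns the peak into the sphere norm of `φ̂` for a Schwartz function; the approximating
Schwartz functions remove that term; finally `I → ∞`. The last two use Fatou's lemma. The case `α =
1/2` follows from a slightly larger order, as the endpoint exponent is excluded there. -/

namespace BochnerRiesz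

/-! ### Van der Corput estimates in one variable -/

section Oscillatory

theorem norm_cexp_I_mul_ofReal (x : ℝ) : ‖Complex.exp (Complex.I * (x : ℂ))‖ = 1 := by
  rw [mul_comm, Complex.norm_exp_ofReal_mul_I]

theorem hasDerivAt_cexp_I_mul {φ : ℝ → ℝ} {d x : ℝ} (h : HasDerivAt φ d x) :
    HasDerivAt (fun t : ℝ => Complex.exp (Complex.I * (φ t : ℂ)))
      (Complex.exp (Complex.I * (φ x : ℂ)) * (Complex.I * (d : ℂ))) x :=
  ((h.ofReal_comp).const_mul Complex.I).cexp

/-- First derivative test for oscillatory integrals. -/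
theorem norm_integral_cexp_le_of_deriv {φ φ' φ'' : ℝ → ℝ} {a b l : ℝ} (hab : a ≤ b) (hl : 0 < l)
    (h1 : ∀ x ∈ Set.Icc a b, HasDerivAt φ (φ' x) x)
    (h2 : ∀ x ∈ Set.Icc a b, HasDerivAt φ' (φ'' x) x)
    (hc : ContinuousOn φ'' (Set.Icc a b))
    (h0 : ∀ x ∈ Set.Icc a b, 0 ≤ φ'' x) (hφ : ∀ x ∈ Set.Icc a b, l ≤ |φ' x|) :
    ‖∫ x in a..b, Complex.exp (Complex.I * (φ x : ℂ))‖ ≤ 4 / l := by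
  have hne : ∀ x ∈ Set.Icc a b, φ' x ≠ 0 := fun x hx h => by
    have := hφ x hx
    rw [h, abs_zero] at this
    linarith
  have hu : Set.uIcc a b = Set.Icc a b := Set.uIcc_of_le hab
  have c1 : ContinuousOn φ (Set.Icc a b) := fun x hx => (h1 x hx).continuousAt.continuousWithinAt
  have c2 : ContinuousOn φ' (Set.Icc a b) := fun x hx => (h2 x hx).continuousAt.continuousWithinAt
  have cr : ContinuousOn (fun x => φ'' x / φ' x ^ 2) (Set.Icc a b) :=
    hc.div (c2.pow 2) fun x hx => pow_ne_zero 2 (hne x hx)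
  have ce : ContinuousOn (fun x => Complex.exp (Complex.I * (φ x : ℂ))) (Set.Icc a b) :=
    (continuousOn_const.mul (Complex.continuous_ofReal.comp_continuousOn c1)).cexp
  have hinv : ∀ x ∈ Set.Icc a b, HasDerivAt (fun t => -(φ' t)⁻¹) (φ'' x / φ' x ^ 2) x := by
    intro x hx
    have := ((h2 x hx).inv (hne x hx)).neg
    rw [neg_div, neg_neg] at this
    exact this
  have hint : IntervalIntegrable (fun x => φ'' x / φ' x ^ 2) volume a b :=
    (hu ▸ cr).intervalIntegrable
  have hI : ∫ x in a..b, φ'' x / φ' x ^ 2 = -(φ' b)⁻¹ - -(φ' a)⁻¹ :=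
    intervalIntegral.integral_eq_sub_of_hasDerivAt (fun x hx => hinv x (hu ▸ hx)) hint
  have hparts := intervalIntegral.integral_mul_deriv_eq_deriv_mul (a := a) (b := b)
    (u := fun x => Complex.I * ((-(φ' x)⁻¹ : ℝ) : ℂ))
    (u' := fun x => Complex.I * ((φ'' x / φ' x ^ 2 : ℝ) : ℂ))
    (v := fun x => Complex.exp (Complex.I * (φ x : ℂ)))
    (v' := fun x => Complex.exp (Complex.I * (φ x : ℂ)) * (Complex.I * (φ' x : ℂ)))
    (fun x hx => ((hinv x (hu ▸ hx)).ofReal_comp).const_mul _)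
    (fun x hx => hasDerivAt_cexp_I_mul (h1 x (hu ▸ hx)))
    ((hu ▸ continuousOn_const.mul (Complex.continuous_ofReal.comp_continuousOn cr) :
      ContinuousOn _ (Set.uIcc a b)).intervalIntegrable)
    ((hu ▸ ce.mul (continuousOn_const.mul (Complex.continuous_ofReal.comp_continuousOn c2)) :
      ContinuousOn _ (Set.uIcc a b)).intervalIntegrable)
  have hleft : ∫ x in a..b, Complex.exp (Complex.I * (φ x : ℂ)) =
      ∫ x in a..b, (Complex.I * ((-(φ' x)⁻¹ : ℝ) : ℂ)) *
        (Complex.exp (Complex.I * (φ x : ℂ)) * (Complex.I * (φ' x : ℂ))) := by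
    refine intervalIntegral.integral_congr fun x hx => ?_
    have : (φ' x : ℂ) ≠ 0 := by exact_mod_cast hne x (hu ▸ hx)
    calc Complex.exp (Complex.I * (φ x : ℂ)) =
        -(Complex.I * Complex.I) * ((φ' x : ℂ)⁻¹ * φ' x) * Complex.exp (Complex.I * (φ x : ℂ)) := by
          rw [inv_mul_cancel₀ this, Complex.I_mul_I]
          ring
      _ = _ := by
          push_cast
          ring
  have hi : ∀ x ∈ Set.Icc a b, |(φ' x)⁻¹| ≤ 1 / l := fun x hx => by
    rw [abs_inv, one_div]
    exact inv_anti₀ hl (hφ x hx)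
  have hbd : ∀ x ∈ Set.Icc a b, ‖Complex.I * ((-(φ' x)⁻¹ : ℝ) : ℂ) *
      Complex.exp (Complex.I * (φ x : ℂ))‖ ≤ 1 / l := fun x hx => by
    rw [norm_mul, norm_mul, norm_cexp_I_mul_ofReal, Complex.norm_I, Complex.norm_real,
      Real.norm_eq_abs, abs_neg, one_mul, mul_one]
    exact hi x hx
  -- Monotonicity of `φ'` makes `φ'' / φ'²` nonnegative, so its integral is the total variation of
  -- `1/φ'` and telescopes to endpoint values.
  have hlast : ‖∫ x in a..b, (Complex.I * ((φ'' x / φ' x ^ 2 : ℝ) : ℂ)) *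
      Complex.exp (Complex.I * (φ x : ℂ))‖ ≤ 2 / l := by
    have : ‖∫ x in a..b, (Complex.I * ((φ'' x / φ' x ^ 2 : ℝ) : ℂ)) *
        Complex.exp (Complex.I * (φ x : ℂ))‖ ≤ ∫ x in a..b, φ'' x / φ' x ^ 2 := by
      refine intervalIntegral.norm_integral_le_of_norm_le hab ?_ hint
      refine Eventually.of_forall fun x hx => ?_
      rw [norm_mul, norm_mul, norm_cexp_I_mul_ofReal, Complex.norm_I, Complex.norm_real,
        Real.norm_eq_abs, one_mul, mul_one, abs_of_nonneg]
      exact div_nonneg (h0 x ⟨hx.1.le, hx.2⟩) (sq_nonneg _)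
    refine this.trans ?_
    rw [hI]
    have e1 := abs_le.1 (hi a ⟨le_rfl, hab⟩)
    have e2 := abs_le.1 (hi b ⟨hab, le_rfl⟩)
    have : (2 : ℝ) / l = 1 / l + 1 / l := by ring
    linarith [e1.1, e1.2, e2.1, e2.2]
  rw [hleft, hparts]
  have hb := hbd b ⟨hab, le_rfl⟩
  have ha := hbd a ⟨le_rfl, hab⟩
  have : (4 : ℝ) / l = 1 / l + 1 / l + 2 / l := by ring
  rw [this]
  exact (norm_sub_le _ _).trans (add_le_add ((norm_sub_le _ _).trans (add_le_add hb ha)) hlast)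

/-- Second derivative test (van der Corput) for oscillatory integrals. -/
theorem norm_integral_cexp_le_of_deriv2 {φ φ' φ'' : ℝ → ℝ} {a b l : ℝ} (hab : a ≤ b) (hl : 0 < l)
    (h1 : ∀ x ∈ Set.Icc a b, HasDerivAt φ (φ' x) x)
    (h2 : ∀ x ∈ Set.Icc a b, HasDerivAt φ' (φ'' x) x)
    (hc : ContinuousOn φ'' (Set.Icc a b)) (hφ : ∀ x ∈ Set.Icc a b, l ≤ φ'' x) :
    ‖∫ x in a..b, Complex.exp (Complex.I * (φ x : ℂ))‖ ≤ 10 / √l := by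
  have hgrow : ∀ x ∈ Set.Icc a b, ∀ y ∈ Set.Icc a b, x ≤ y → l * (y - x) ≤ φ' y - φ' x := by
    refine (convex_Icc a b).mul_sub_le_image_sub_of_le_deriv
      (fun x hx => (h2 x hx).continuousAt.continuousWithinAt)
      (fun x hx => (h2 x (interior_subset hx)).differentiableAt.differentiableWithinAt) ?_
    intro x hx
    rw [(h2 x (interior_subset hx)).deriv]
    exact hφ x (interior_subset hx)
  have c2 : ContinuousOn φ' (Set.Icc a b) := fun x hx => (h2 x hx).continuousAt.continuousWithinAt
  have ha : a ∈ Set.Icc a b := ⟨le_rfl, hab⟩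
  have hb : b ∈ Set.Icc a b := ⟨hab, le_rfl⟩
  -- The point `c` is the zero of the increasing function `φ'`, or the endpoint nearest to where it
  -- would vanish.
  obtain ⟨c, hcm, hcb⟩ : ∃ c ∈ Set.Icc a b, ∀ x ∈ Set.Icc a b, l * |x - c| ≤ |φ' x| := by
    rcases le_total 0 (φ' a) with h | h
    · refine ⟨a, ha, fun x hx => ?_⟩
      have := hgrow a ha x hx hx.1
      rw [abs_of_nonneg (sub_nonneg.2 hx.1)]
      exact le_trans (by linarith) (le_abs_self _)
    rcases le_total (φ' b) 0 with h' | h'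
    · refine ⟨b, hb, fun x hx => ?_⟩
      have := hgrow x hx b hb hx.2
      rw [abs_of_nonpos (sub_nonpos.2 hx.2)]
      exact le_trans (by linarith) (neg_le_abs _)
    · obtain ⟨c, hcm, hc0⟩ := intermediate_value_Icc hab c2 ⟨h, h'⟩
      refine ⟨c, hcm, fun x hx => ?_⟩
      rcases le_total c x with hh | hh
      · have := hgrow c hcm x hx hh
        rw [abs_of_nonneg (sub_nonneg.2 hh)]
        exact le_trans (by linarith) (le_abs_self _)
      · have := hgrow x hx c hcm hh
        rw [abs_of_nonpos (sub_nonpos.2 hh)]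
        exact le_trans (by linarith) (neg_le_abs _)
  have hs : 0 < √l := Real.sqrt_pos.2 hl
  have hss : √l * √l = l := Real.mul_self_sqrt hl.le
  -- This radius balances the trivial bound `2δ` near `c` against the first derivative bound
  -- `4/(lδ)` on each side.
  set δ : ℝ := 1 / √l with hδ
  have hδ0 : 0 < δ := by positivity
  have hlδ : l * δ = √l := by
    rw [hδ, mul_one_div, div_eq_iff hs.ne', hss]
  set u : ℝ := max a (c - δ) with hu
  set v : ℝ := min b (c + δ) with hv
  have hau : a ≤ u := le_max_left _ _
  have huc : u ≤ c := max_le hcm.1 (by linarith)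
  have hcv : c ≤ v := le_min hcm.2 (by linarith)
  have hvb : v ≤ b := min_le_left _ _
  have ce : ContinuousOn (fun x => Complex.exp (Complex.I * (φ x : ℂ))) (Set.Icc a b) :=
    (continuousOn_const.mul (Complex.continuous_ofReal.comp_continuousOn
      fun x hx => (h1 x hx).continuousAt.continuousWithinAt)).cexp
  have hii : ∀ x y, a ≤ x → x ≤ y → y ≤ b →
      IntervalIntegrable (fun x => Complex.exp (Complex.I * (φ x : ℂ))) volume x y :=
    fun x y hx hxy hy => ContinuousOn.intervalIntegrable (by
      rw [Set.uIcc_of_le hxy]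
      exact ce.mono (Set.Icc_subset_Icc hx hy))
  have houter : ∀ x y, a ≤ x → x ≤ y → y ≤ b → (∀ z ∈ Set.Icc x y, δ ≤ |z - c|) →
      ‖∫ x in x..y, Complex.exp (Complex.I * (φ x : ℂ))‖ ≤ 4 * δ := by
    intro x y hx hxy hy hz
    have hsub : Set.Icc x y ⊆ Set.Icc a b := Set.Icc_subset_Icc hx hy
    refine (norm_integral_cexp_le_of_deriv hxy hs (fun z hz => h1 z (hsub hz))
      (fun z hz => h2 z (hsub hz)) (hc.mono hsub) (fun z hz => hl.le.trans (hφ z (hsub hz)))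
      fun z hz' => ?_).trans (le_of_eq (by rw [hδ]; ring))
    rw [← hlδ]
    exact (mul_le_mul_of_nonneg_left (hz z hz') hl.le).trans (hcb z (hsub hz'))
  have e1 : ‖∫ x in a..u, Complex.exp (Complex.I * (φ x : ℂ))‖ ≤ 4 * δ := by
    rcases le_total (c - δ) a with h | h
    · rw [hu, max_eq_left h, intervalIntegral.integral_same, norm_zero]
      positivity
    · refine houter a u le_rfl hau (huc.trans hcm.2) fun z hz => ?_
      have : z ≤ c - δ := hz.2.trans (by rw [hu, max_eq_right h])
      rw [abs_sub_comm]
      exact le_trans (by linarith) (le_abs_self _)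
  have e3 : ‖∫ x in v..b, Complex.exp (Complex.I * (φ x : ℂ))‖ ≤ 4 * δ := by
    rcases le_total b (c + δ) with h | h
    · rw [hv, min_eq_left h, intervalIntegral.integral_same, norm_zero]
      positivity
    · refine houter v b (hcm.1.trans hcv) hvb le_rfl fun z hz => ?_
      have : c + δ ≤ z := le_trans (by rw [hv, min_eq_right h]) hz.1
      exact le_trans (by linarith) (le_abs_self _)
  have e2 : ‖∫ x in u..v, Complex.exp (Complex.I * (φ x : ℂ))‖ ≤ 2 * δ := by
    refine (intervalIntegral.norm_integral_le_of_norm_le_const (C := 1) fun x _ =>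
      (norm_cexp_I_mul_ofReal _).le).trans ?_
    have : v ≤ c + δ := min_le_right _ _
    have : c - δ ≤ u := le_max_right _ _
    rw [abs_of_nonneg (by linarith)]
    linarith
  have hsplit : ∫ x in a..b, Complex.exp (Complex.I * (φ x : ℂ)) =
      (∫ x in a..u, Complex.exp (Complex.I * (φ x : ℂ))) +
      (∫ x in u..v, Complex.exp (Complex.I * (φ x : ℂ))) +
      ∫ x in v..b, Complex.exp (Complex.I * (φ x : ℂ)) := by
    rw [intervalIntegral.integral_add_adjacent_intervals, intervalIntegral.integral_add_adjacent_intervals]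
    · exact hii _ _ le_rfl (hau.trans (huc.trans hcv)) hvb
    · exact hii _ _ (hcm.1.trans hcv) hvb le_rfl
    · exact hii _ _ le_rfl hau (huc.trans hcm.2)
    · exact hii _ _ hau (huc.trans hcv) hvb
  rw [hsplit]
  have : (10 : ℝ) / √l = 4 * δ + 2 * δ + 4 * δ := by rw [hδ]; ring
  rw [this]
  exact (norm_add_le _ _).trans (add_le_add ((norm_add_le _ _).trans (add_le_add e1 e2)) e3)

/-- Insertion of an amplitude of bounded variation. -/
theorem norm_integral_mul_le_of_primitive_le {A A' e : ℝ → ℂ} {a b M K : ℝ} (hab : a ≤ b)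
    (hM : 0 ≤ M)
    (hA : ∀ x ∈ Set.Icc a b, HasDerivAt A (A' x) x) (hA' : ContinuousOn A' (Set.Icc a b))
    (he : Continuous e) (hint : ∀ x ∈ Set.Icc a b, ‖∫ t in a..x, e t‖ ≤ M)
    (hK : ‖A b‖ + ∫ x in a..b, ‖A' x‖ ≤ K) :
    ‖∫ x in a..b, A x * e x‖ ≤ M * K := by
  have hu : Set.uIcc a b = Set.Icc a b := Set.uIcc_of_le hab
  have hv : ∀ x, HasDerivAt (fun x => ∫ t in a..x, e t) (e x) x := fun x =>
    intervalIntegral.integral_hasDerivAt_right (he.intervalIntegrable _ _)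
      (he.stronglyMeasurableAtFilter _ _) he.continuousAt
  have hparts := intervalIntegral.integral_mul_deriv_eq_deriv_mul (a := a) (b := b)
    (u := A) (u' := A') (v := fun x => ∫ t in a..x, e t) (v' := e)
    (fun x hx => hA x (hu ▸ hx)) (fun x _ => hv x) ((hu ▸ hA').intervalIntegrable)
    (he.intervalIntegrable _ _)
  rw [hparts]
  simp only [intervalIntegral.integral_same, mul_zero, sub_zero]
  have e1 : ‖A b * ∫ t in a..b, e t‖ ≤ M * ‖A b‖ := by
    rw [norm_mul, mul_comm]
    exact mul_le_mul_of_nonneg_right (hint b ⟨hab, le_rfl⟩) (norm_nonneg _)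
  have e2 : ‖∫ x in a..b, A' x * ∫ t in a..x, e t‖ ≤ M * ∫ x in a..b, ‖A' x‖ := by
    rw [← intervalIntegral.integral_const_mul]
    refine intervalIntegral.norm_integral_le_of_norm_le hab (Eventually.of_forall fun x hx => ?_)
      (((hu ▸ hA'.norm : ContinuousOn _ (Set.uIcc a b)).intervalIntegrable).const_mul M)
    rw [norm_mul, mul_comm]
    exact mul_le_mul_of_nonneg_right (hint x ⟨hx.1.le, hx.2⟩) (norm_nonneg _)
  calc _ ≤ M * ‖A b‖ + M * ∫ x in a..b, ‖A' x‖ := (norm_sub_le _ _).trans (add_le_add e1 e2)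
    _ = M * (‖A b‖ + ∫ x in a..b, ‖A' x‖) := by ring
    _ ≤ M * K := mul_le_mul_of_nonneg_left hK hM

end Oscillatory

end BochnerRiesz

namespace BochnerRiesz

/-! ### The explicit Gaussian kernel: amplitude, phase and their derivatives -/

noncomputable section Kernel

/-- The radial profile, at distance `r`, of the convolution kernel whose Fourier transform is
`e^{it(1-|ξ|²)} e^{-|ξ|²}`, up to a power of `2π`. -/
def gaussKernel (n : ℕ) (t r : ℝ) : ℂ :=
  Complex.exp (Complex.I * t) * ((Real.pi : ℂ) / (1 + Complex.I * t)) ^ ((n : ℂ) / 2) *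
    Complex.exp (-(r : ℂ) ^ 2 / (4 * (1 + Complex.I * t)))

/-- The imaginary part of the exponent. For large `t` it is close to `t + r²/(4t)`, which is
stationary near `t = r/2`. -/
def kernelPhase (r t : ℝ) : ℝ := t + r ^ 2 / 4 * (t / (1 + t ^ 2))

def kernelDecay (n : ℕ) (t : ℝ) : ℂ := ((Real.pi : ℂ) / (1 + Complex.I * t)) ^ ((n : ℂ) / 2)

def kernelGauss (r t : ℝ) : ℝ := Real.exp (-(r ^ 2 / (4 * (1 + t ^ 2))))

theorem one_add_I_mul_ne_zero (t : ℝ) : (1 + Complex.I * t : ℂ) ≠ 0 := fun h => by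
  have := congrArg Complex.re h
  simp at this

theorem norm_one_add_I_mul (t : ℝ) : ‖(1 + Complex.I * t : ℂ)‖ = √(1 + t ^ 2) := by
  rw [Complex.norm_def, Complex.normSq_apply]
  congr 1
  simp
  ring

theorem gaussKernel_eq (n : ℕ) (t r : ℝ) :
    gaussKernel n t r = kernelDecay n t * (kernelGauss r t : ℂ) *
      Complex.exp (Complex.I * (kernelPhase r t : ℂ)) := by
  have h1 := one_add_I_mul_ne_zero t
  have h2 : (1 + (t : ℂ) ^ 2) ≠ 0 := by
    have : (1 + t ^ 2 : ℝ) ≠ 0 := by positivity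
    exact_mod_cast this
  have h3 : (1 + Complex.I * t : ℂ) * (1 - Complex.I * t) = 1 + (t : ℂ) ^ 2 := by
    linear_combination (-(t : ℂ) ^ 2) * Complex.I_sq
  have key : Complex.I * t + -(r : ℂ) ^ 2 / (4 * (1 + Complex.I * t)) =
      ((-(r ^ 2 / (4 * (1 + t ^ 2))) : ℝ) : ℂ) + Complex.I * (kernelPhase r t : ℂ) := by
    have : -(r : ℂ) ^ 2 / (4 * (1 + Complex.I * t)) =
        -(r : ℂ) ^ 2 * (1 - Complex.I * t) / (4 * (1 + (t : ℂ) ^ 2)) := by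
      rw [← h3]
      have h4 : (1 - Complex.I * t : ℂ) ≠ 0 := fun h => h2 (by rw [← h3, h, mul_zero])
      field_simp
    rw [this, kernelPhase]
    push_cast
    field_simp
    ring
  rw [gaussKernel, kernelDecay, kernelGauss, Complex.ofReal_exp, mul_right_comm, ← Complex.exp_add,
    key, Complex.exp_add]
  ring

theorem norm_kernelDecay (n : ℕ) (t : ℝ) :
    ‖kernelDecay n t‖ = (Real.pi / √(1 + t ^ 2)) ^ ((n : ℝ) / 2) := by
  have : ((n : ℂ) / 2) = (((n : ℝ) / 2 : ℝ) : ℂ) := by push_cast; rfl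
  rw [kernelDecay, this, Complex.norm_cpow_real, norm_div, norm_one_add_I_mul, Complex.norm_real,
    Real.norm_eq_abs, abs_of_pos Real.pi_pos]

theorem kernelGauss_le_one (r t : ℝ) : kernelGauss r t ≤ 1 :=
  Real.exp_le_one_iff.2 (neg_nonpos.2 (by positivity))

theorem kernelGauss_pos (r t : ℝ) : 0 < kernelGauss r t := Real.exp_pos _

theorem norm_gaussKernel_le (n : ℕ) (t r : ℝ) : ‖gaussKernel n t r‖ ≤ Real.pi ^ ((n : ℝ) / 2) := by
  rw [gaussKernel_eq, norm_mul, norm_mul, norm_cexp_I_mul_ofReal, mul_one, Complex.norm_real,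
    Real.norm_eq_abs, abs_of_pos (kernelGauss_pos r t), norm_kernelDecay]
  calc _ ≤ (Real.pi / √(1 + t ^ 2)) ^ ((n : ℝ) / 2) * 1 :=
        mul_le_mul_of_nonneg_left (kernelGauss_le_one r t) (by positivity)
    _ ≤ _ := by
      rw [mul_one]
      refine Real.rpow_le_rpow (by positivity) (div_le_self Real.pi_pos.le ?_) (by positivity)
      rw [Real.one_le_sqrt]
      nlinarith [sq_nonneg t]

/-- The base has positive real part and so avoids the branch cut; the power in `kernelDecay` is
therefore smooth in `t`. -/
theorem pi_div_mem_slitPlane (t : ℝ) : (Real.pi : ℂ) / (1 + Complex.I * t) ∈ Complex.slitPlane := by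
  refine Complex.mem_slitPlane_iff.2 (Or.inl ?_)
  have : (0 : ℝ) < Complex.normSq (1 + Complex.I * t) := Complex.normSq_pos.2 (one_add_I_mul_ne_zero t)
  rw [Complex.div_re]
  simp only [Complex.ofReal_re, Complex.ofReal_im, zero_mul, zero_div, add_zero]
  have h : (1 + Complex.I * (t : ℂ)).re = 1 := by simp
  rw [h]
  have := Real.pi_pos
  positivity

def kernelDecayDeriv (n : ℕ) (t : ℝ) : ℂ :=
  ((n : ℂ) / 2) * ((Real.pi : ℂ) / (1 + Complex.I * t)) ^ ((n : ℂ) / 2 - 1) *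
    (-(Real.pi * Complex.I) / (1 + Complex.I * t) ^ 2)

theorem hasDerivAt_kernelDecay (n : ℕ) (t : ℝ) :
    HasDerivAt (kernelDecay n) (kernelDecayDeriv n t) t := by
  have h1 : HasDerivAt (fun t : ℝ => (1 + Complex.I * t : ℂ)) Complex.I t := by
    simpa using ((hasDerivAt_id t).ofReal_comp.const_mul Complex.I).const_add 1
  have h2 : HasDerivAt (fun t : ℝ => (Real.pi : ℂ) / (1 + Complex.I * t))
      (-(Real.pi * Complex.I) / (1 + Complex.I * t) ^ 2) t := by
    have := (hasDerivAt_const t (Real.pi : ℂ)).fun_div h1 (one_add_I_mul_ne_zero t)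
    simpa using this
  have h3 := (Complex.hasStrictDerivAt_cpow_const (c := (n : ℂ) / 2)
    (pi_div_mem_slitPlane t)).hasDerivAt
  exact h3.comp t h2

theorem continuous_kernelDecay (n : ℕ) : Continuous (kernelDecay n) :=
  continuous_iff_continuousAt.2 fun t => (hasDerivAt_kernelDecay n t).continuousAt

theorem continuous_kernelDecayDeriv (n : ℕ) : Continuous (kernelDecayDeriv n) := by
  have h1 : Continuous fun t : ℝ => (1 + Complex.I * t : ℂ) := by fun_prop
  have h2 : Continuous fun t : ℝ => (Real.pi : ℂ) / (1 + Complex.I * t) :=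
    continuous_const.div h1 one_add_I_mul_ne_zero
  refine (continuous_const.mul ?_).mul
    (continuous_const.div (h1.pow 2) fun t => pow_ne_zero 2 (one_add_I_mul_ne_zero t))
  exact continuous_iff_continuousAt.2 fun t =>
    (h2.continuousAt).cpow continuousAt_const (pi_div_mem_slitPlane t)

theorem le_sqrt_one_add_sq (t : ℝ) : t ≤ √(1 + t ^ 2) :=
  Real.le_sqrt_of_sq_le (by linarith)

theorem norm_kernelDecay_le (n : ℕ) {t : ℝ} (ht : 0 < t) :
    ‖kernelDecay n t‖ ≤ Real.pi ^ ((n : ℝ) / 2) * t ^ (-((n : ℝ) / 2)) := by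
  rw [norm_kernelDecay, Real.rpow_neg ht.le, ← div_eq_mul_inv, ← Real.div_rpow Real.pi_pos.le ht.le]
  refine Real.rpow_le_rpow (by positivity) ?_ (by positivity)
  exact div_le_div_of_nonneg_left Real.pi_pos.le ht (le_sqrt_one_add_sq t)

theorem norm_kernelDecayDeriv_le (n : ℕ) {t : ℝ} (ht : 0 < t) :
    ‖kernelDecayDeriv n t‖ ≤
      (n / 2 : ℝ) * (Real.pi ^ ((n : ℝ) / 2) * t ^ (-((n : ℝ) / 2) - 1)) := by
  have hpi := Real.pi_pos
  have hs : 0 < √(1 + t ^ 2) := by positivity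
  have hle := le_sqrt_one_add_sq t
  have e : ((n : ℂ) / 2 - 1) = (((n : ℝ) / 2 - 1 : ℝ) : ℂ) := by push_cast; rfl
  have : ‖kernelDecayDeriv n t‖ = (n / 2 : ℝ) *
      ((Real.pi / √(1 + t ^ 2)) ^ ((n : ℝ) / 2) * (√(1 + t ^ 2))⁻¹) := by
    rw [kernelDecayDeriv, e]
    simp only [norm_mul, Complex.norm_cpow_real, norm_div, norm_neg, norm_pow, norm_one_add_I_mul,
      Complex.norm_real, Real.norm_eq_abs, abs_of_pos hpi, Complex.norm_I, Complex.norm_natCast,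
      Complex.norm_ofNat]
    rw [Real.rpow_sub_one (by positivity)]
    field_simp
  rw [this]
  refine mul_le_mul_of_nonneg_left ?_ (by positivity)
  rw [Real.rpow_sub_one ht.ne', div_eq_mul_inv (t ^ _) t, ← mul_assoc]
  refine mul_le_mul ?_ (inv_anti₀ ht hle) (by positivity) (by positivity)
  rw [← norm_kernelDecay]
  exact norm_kernelDecay_le n ht

theorem hasDerivAt_kernelGauss (r t : ℝ) :
    HasDerivAt (kernelGauss r)
      (kernelGauss r t * (r ^ 2 / (4 * (1 + t ^ 2)) * (2 * t / (1 + t ^ 2)))) t := by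
  have h1 : HasDerivAt (fun t : ℝ => 4 * (1 + t ^ 2)) (8 * t) t := by
    have := (((hasDerivAt_pow 2 t).const_add 1).const_mul 4)
    refine this.congr_deriv ?_
    norm_num
    ring
  have hne : (4 * (1 + t ^ 2) : ℝ) ≠ 0 := by positivity
  have h2 := (((hasDerivAt_const t (r ^ 2)).div h1 hne).neg).exp
  refine h2.congr_deriv ?_
  simp only [Pi.neg_apply, Pi.div_apply, kernelGauss]
  have : (1 + t ^ 2 : ℝ) ≠ 0 := by positivity
  field_simp
  ring

def kernelPhaseDeriv (r t : ℝ) : ℝ := 1 + r ^ 2 / 4 * ((1 - t ^ 2) / (1 + t ^ 2) ^ 2)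

def kernelPhaseDeriv2 (r t : ℝ) : ℝ := r ^ 2 / 4 * (2 * t * (t ^ 2 - 3) / (1 + t ^ 2) ^ 3)

theorem hasDerivAt_kernelPhase (r t : ℝ) :
    HasDerivAt (kernelPhase r) (kernelPhaseDeriv r t) t := by
  have hne : (1 + t ^ 2 : ℝ) ≠ 0 := by positivity
  have h1 : HasDerivAt (fun t : ℝ => 1 + t ^ 2) (2 * t) t := by
    simpa using (hasDerivAt_pow 2 t).const_add 1
  have h2 := (hasDerivAt_id t).add (((hasDerivAt_id t).div h1 hne).const_mul (r ^ 2 / 4))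
  refine h2.congr_deriv ?_
  simp only [id, kernelPhaseDeriv]
  congr 3
  ring

theorem hasDerivAt_kernelPhaseDeriv (r t : ℝ) :
    HasDerivAt (kernelPhaseDeriv r) (kernelPhaseDeriv2 r t) t := by
  have hne : (1 + t ^ 2 : ℝ) ≠ 0 := by positivity
  have h0 : HasDerivAt (fun t : ℝ => 1 - t ^ 2) (-(2 * t)) t := by
    simpa using (hasDerivAt_pow 2 t).const_sub 1
  have h1 : HasDerivAt (fun t : ℝ => (1 + t ^ 2) ^ 2) (2 * (1 + t ^ 2) * (2 * t)) t := by
    simpa using ((hasDerivAt_pow 2 t).const_add 1).fun_pow 2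
  have h2 := ((h0.div h1 (pow_ne_zero 2 hne)).const_mul (r ^ 2 / 4)).const_add 1
  refine h2.congr_deriv ?_
  simp only [kernelPhaseDeriv2]
  field_simp
  ring

theorem continuous_kernelPhase (r : ℝ) : Continuous (kernelPhase r) :=
  continuous_iff_continuousAt.2 fun t => (hasDerivAt_kernelPhase r t).continuousAt

theorem continuous_kernelPhaseDeriv2 (r : ℝ) : Continuous (kernelPhaseDeriv2 r) := by
  unfold kernelPhaseDeriv2
  exact continuous_const.mul (Continuous.div (by fun_prop) (by fun_prop) fun t => by positivity)

/-- For `t ≥ r` the derivative of the `r²`-term has modulus at most `1/4`, so the linear term `t`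
dominates and there is no stationary point. -/
theorem kernelPhaseDeriv_ge {r t : ℝ} (ht : 2 ≤ t) (hr : 0 ≤ r) (hrt : r ≤ t) :
    1 / 2 ≤ |kernelPhaseDeriv r t| := by
  refine le_trans ?_ (le_abs_self _)
  have h1 : r ^ 2 ≤ t ^ 2 := pow_le_pow_left₀ hr hrt 2
  have h2 : -(1 / t ^ 2) ≤ (1 - t ^ 2) / (1 + t ^ 2) ^ 2 := by
    rw [← neg_div, div_le_div_iff₀ (by positivity) (by positivity)]
    nlinarith [sq_nonneg t]
  have h3 : r ^ 2 / 4 * (1 / t ^ 2) ≤ 1 / 4 := by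
    rw [mul_one_div, div_le_iff₀ (by positivity)]
    linarith
  have := mul_le_mul_of_nonneg_left h2 (by positivity : 0 ≤ r ^ 2 / 4)
  rw [kernelPhaseDeriv]
  linarith

theorem kernelPhaseDeriv2_nonneg {t : ℝ} (r : ℝ) (ht : 2 ≤ t) : 0 ≤ kernelPhaseDeriv2 r t := by
  have : 0 ≤ t ^ 2 - 3 := by nlinarith
  have : 0 ≤ t := by linarith
  unfold kernelPhaseDeriv2
  positivity

/-- For `t ≤ r` the second derivative has order at least `r²/t³`, which is least at `t = r`. -/
theorem kernelPhaseDeriv2_ge {r t : ℝ} (ht : 2 ≤ t) (hrt : t ≤ r) :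
    1 / (16 * r) ≤ kernelPhaseDeriv2 r t := by
  have ht0 : 0 < t := by linarith
  have hr0 : 0 < r := by linarith
  have h1 : 1 / (4 * t ^ 3) ≤ 2 * t * (t ^ 2 - 3) / (1 + t ^ 2) ^ 3 := by
    rw [div_le_div_iff₀ (by positivity) (by positivity)]
    have hz : 0 ≤ t ^ 2 - 4 := by nlinarith
    -- Expanding about `t² = 4` leaves only positive coefficients.
    have : 8 * t ^ 4 * (t ^ 2 - 3) - (1 + t ^ 2) ^ 3 =
      3 + 117 * (t ^ 2 - 4) + 57 * (t ^ 2 - 4) ^ 2 + 7 * (t ^ 2 - 4) ^ 3 := by ring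
    have h0 : 0 ≤ 8 * t ^ 4 * (t ^ 2 - 3) - (1 + t ^ 2) ^ 3 := by rw [this]; positivity
    nlinarith [h0]
  have h2 : 1 / (16 * r) ≤ r ^ 2 / 4 * (1 / (4 * t ^ 3)) := by
    rw [div_mul_div_comm, div_le_div_iff₀ (by positivity) (by positivity)]
    have := pow_le_pow_left₀ ht0.le hrt 3
    nlinarith
  exact h2.trans (mul_le_mul_of_nonneg_left h1 (by positivity))

end Kernel

end BochnerRiesz

namespace BochnerRiesz

/-! ### Decay of truncated superpositions of the kernel -/

noncomputable section KernelBounds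

theorem exists_rpow_mul_exp_neg_le (κ : ℝ) (hκ : 0 ≤ κ) :
    ∃ C : ℝ, 0 ≤ C ∧ ∀ y : ℝ, 0 ≤ y → y ^ κ * Real.exp (-y) ≤ C := by
  refine ⟨1 + (⌈κ⌉₊).factorial, by positivity, fun y hy => ?_⟩
  have h1 : y ^ κ ≤ 1 + y ^ ⌈κ⌉₊ := by
    rcases le_total y 1 with h | h
    · exact (Real.rpow_le_one hy h hκ).trans (by linarith [pow_nonneg hy ⌈κ⌉₊])
    · calc y ^ κ ≤ y ^ (⌈κ⌉₊ : ℝ) := Real.rpow_le_rpow_of_exponent_le h (Nat.le_ceil κ)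
        _ = y ^ ⌈κ⌉₊ := Real.rpow_natCast _ _
        _ ≤ _ := by linarith
  have h2 := Real.pow_div_factorial_le_exp y hy ⌈κ⌉₊
  rw [div_le_iff₀ (by positivity)] at h2
  have h3 : (1 : ℝ) ≤ Real.exp y := Real.one_le_exp hy
  rw [Real.exp_neg, ← div_eq_mul_inv, div_le_iff₀ (Real.exp_pos y)]
  nlinarith

/-- The quantity governing the Gaussian factor of the kernel. -/
def gaussArg (r t : ℝ) : ℝ := r ^ 2 / (4 * (1 + t ^ 2))

theorem gaussArg_nonneg (r t : ℝ) : 0 ≤ gaussArg r t := by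
  unfold gaussArg
  positivity

/-- The Gaussian factor trades decay in `t` for decay in `r`: for `2 ≤ t` one has `(r/t)² ≤ 5
gaussArg r t`, so any power of `r/t` is absorbed by the exponential. -/
theorem exists_gaussArg_bound (b c : ℝ) (hb : 0 ≤ b) (hc : 0 ≤ c) :
    ∃ C : ℝ, 0 ≤ C ∧ ∀ r t : ℝ, 2 ≤ t → t ≤ r →
      t ^ (-b) * ((c + 2 * gaussArg r t) * Real.exp (-gaussArg r t)) ≤ C * r ^ (-b) := by
  obtain ⟨C1, hC1, h1⟩ := exists_rpow_mul_exp_neg_le (b / 2) (by positivity)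
  obtain ⟨C2, hC2, h2⟩ := exists_rpow_mul_exp_neg_le (b / 2 + 1) (by positivity)
  refine ⟨5 ^ (b / 2) * (c * C1 + 2 * C2), by positivity, fun r t ht htr => ?_⟩
  have ht0 : 0 < t := by linarith
  have hr0 : 0 < r := by linarith
  set y := gaussArg r t with hy
  have hy0 : 0 ≤ y := gaussArg_nonneg r t
  have hle : (r / t) ^ 2 ≤ 5 * y := by
    rw [hy, gaussArg, div_pow, mul_div_assoc', div_le_div_iff₀ (by positivity) (by positivity)]
    nlinarith [mul_nonneg (sq_nonneg r) (by nlinarith : 0 ≤ t ^ 2 - 4)]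
  have hypos : 0 < y := by
    have : 0 < (r / t) ^ 2 := by positivity
    linarith
  have e1 : (r / t) ^ b ≤ 5 ^ (b / 2) * y ^ (b / 2) := by
    rw [← Real.mul_rpow (by norm_num) hy0]
    calc (r / t) ^ b = ((r / t) ^ 2) ^ (b / 2) := by
          rw [← Real.rpow_natCast, ← Real.rpow_mul (by positivity)]
          congr 1
          push_cast
          ring
      _ ≤ _ := Real.rpow_le_rpow (by positivity) hle (by positivity)
  have e2 : t ^ (-b) = (r / t) ^ b * r ^ (-b) := by
    rw [Real.div_rpow hr0.le ht0.le, Real.rpow_neg ht0.le, Real.rpow_neg hr0.le]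
    have : r ^ b ≠ 0 := by positivity
    field_simp
  have e3 : y ^ (b / 2) * ((c + 2 * y) * Real.exp (-y)) ≤ c * C1 + 2 * C2 := by
    have : y ^ (b / 2) * ((c + 2 * y) * Real.exp (-y)) =
        c * (y ^ (b / 2) * Real.exp (-y)) + 2 * (y ^ (b / 2 + 1) * Real.exp (-y)) := by
      rw [Real.rpow_add_one hypos.ne']
      ring
    rw [this]
    exact add_le_add (mul_le_mul_of_nonneg_left (h1 y hy0) hc)
      (mul_le_mul_of_nonneg_left (h2 y hy0) (by norm_num))
  calc t ^ (-b) * ((c + 2 * y) * Real.exp (-y))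
      = (r / t) ^ b * ((c + 2 * y) * Real.exp (-y)) * r ^ (-b) := by rw [e2]; ring
    _ ≤ 5 ^ (b / 2) * y ^ (b / 2) * ((c + 2 * y) * Real.exp (-y)) * r ^ (-b) := by gcongr
    _ = 5 ^ (b / 2) * (y ^ (b / 2) * ((c + 2 * y) * Real.exp (-y))) * r ^ (-b) := by ring
    _ ≤ _ := by gcongr

/-- A symbol of order `γ` on `[T, T']`, with constant `H`. -/
structure IsSymbolOn (h h' : ℝ → ℝ) (γ H T T' : ℝ) : Prop where
  hasDerivAt : ∀ t ∈ Set.Icc T T', HasDerivAt h (h' t) t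
  continuousOn : ContinuousOn h' (Set.Icc T T')
  bound : ∀ t ∈ Set.Icc T T', |h t| ≤ H * t ^ γ
  bound' : ∀ t ∈ Set.Icc T T', |h' t| ≤ H * t ^ (γ - 1)

theorem IsSymbolOn.mono {h h' : ℝ → ℝ} {γ H T T' S S' : ℝ} (hs : IsSymbolOn h h' γ H T T')
    (h1 : T ≤ S) (h2 : S' ≤ T') : IsSymbolOn h h' γ H S S' :=
  have hsub : Set.Icc S S' ⊆ Set.Icc T T' := Set.Icc_subset_Icc h1 h2
  ⟨fun t ht => hs.hasDerivAt t (hsub ht), hs.continuousOn.mono hsub,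
    fun t ht => hs.bound t (hsub ht), fun t ht => hs.bound' t (hsub ht)⟩

/-- Amplitude of the kernel integrand. -/
def kernelAmp (n : ℕ) (h : ℝ → ℝ) (r t : ℝ) : ℂ :=
  (h t : ℂ) * (kernelDecay n t * (kernelGauss r t : ℂ))

def kernelAmpDeriv (n : ℕ) (h h' : ℝ → ℝ) (r t : ℝ) : ℂ :=
  (h' t : ℂ) * (kernelDecay n t * (kernelGauss r t : ℂ)) +
    (h t : ℂ) * (kernelDecayDeriv n t * (kernelGauss r t : ℂ) + kernelDecay n t *
      ((kernelGauss r t * (r ^ 2 / (4 * (1 + t ^ 2)) * (2 * t / (1 + t ^ 2))) : ℝ) : ℂ))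

theorem hasDerivAt_kernelAmp {n : ℕ} {h : ℝ → ℝ} {d t : ℝ} (r : ℝ) {h' : ℝ → ℝ}
    (hd : h' t = d) (hh : HasDerivAt h d t) :
    HasDerivAt (kernelAmp n h r) (kernelAmpDeriv n h h' r t) t := by
  subst hd
  exact hh.ofReal_comp.mul ((hasDerivAt_kernelDecay n t).mul (hasDerivAt_kernelGauss r t).ofReal_comp)

theorem continuous_kernelGauss (r : ℝ) : Continuous (kernelGauss r) :=
  continuous_iff_continuousAt.2 fun t => (hasDerivAt_kernelGauss r t).continuousAt

theorem continuousOn_kernelAmpDeriv {n : ℕ} {h h' : ℝ → ℝ} {s : Set ℝ} (r : ℝ)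
    (hh : ContinuousOn h s) (hh' : ContinuousOn h' s) :
    ContinuousOn (kernelAmpDeriv n h h' r) s := by
  have c1 := (continuous_kernelDecay n).continuousOn (s := s)
  have c2 := (continuous_kernelDecayDeriv n).continuousOn (s := s)
  have c3 : ContinuousOn (fun t => (kernelGauss r t : ℂ)) s :=
    (Complex.continuous_ofReal.comp (continuous_kernelGauss r)).continuousOn
  have c4 : Continuous fun t : ℝ =>
      kernelGauss r t * (r ^ 2 / (4 * (1 + t ^ 2)) * (2 * t / (1 + t ^ 2))) := by
    refine (continuous_kernelGauss r).mul (Continuous.mul ?_ ?_)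
    · exact continuous_const.div (by fun_prop) fun t => by positivity
    · exact Continuous.div (by fun_prop) (by fun_prop) fun t => by positivity
  have c5 := (Complex.continuous_ofReal.comp c4).continuousOn (s := s)
  exact ((Complex.continuous_ofReal.comp_continuousOn hh').mul (c1.mul c3)).add
    ((Complex.continuous_ofReal.comp_continuousOn hh).mul ((c2.mul c3).add (c1.mul c5)))

theorem norm_kernelAmp_le {n : ℕ} {h : ℝ → ℝ} {γ H r t : ℝ} (ht : 0 < t)
    (hb : |h t| ≤ H * t ^ γ) :
    ‖kernelAmp n h r t‖ ≤ H * Real.pi ^ ((n : ℝ) / 2) *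
      (t ^ (-((n : ℝ) / 2 - γ)) * Real.exp (-gaussArg r t)) := by
  rw [kernelAmp, norm_mul, norm_mul, Complex.norm_real, Complex.norm_real, Real.norm_eq_abs,
    Real.norm_eq_abs, abs_of_pos (kernelGauss_pos r t)]
  have e : t ^ (-((n : ℝ) / 2 - γ)) = t ^ γ * t ^ (-((n : ℝ) / 2)) := by
    rw [← Real.rpow_add ht]
    congr 1
    ring
  have hH : 0 ≤ H * t ^ γ := (abs_nonneg _).trans hb
  calc _ ≤ H * t ^ γ * (Real.pi ^ ((n : ℝ) / 2) * t ^ (-((n : ℝ) / 2)) * kernelGauss r t) :=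
        mul_le_mul hb (mul_le_mul_of_nonneg_right (norm_kernelDecay_le n ht)
          (kernelGauss_pos r t).le) (by have := kernelGauss_pos r t; positivity) hH
    _ = _ := by
        rw [e]
        simp only [kernelGauss, gaussArg]
        ring

theorem norm_kernelAmpDeriv_le {n : ℕ} {h h' : ℝ → ℝ} {γ H r t : ℝ} (ht : 0 < t)
    (hb : |h t| ≤ H * t ^ γ) (hb' : |h' t| ≤ H * t ^ (γ - 1)) :
    ‖kernelAmpDeriv n h h' r t‖ ≤ H * Real.pi ^ ((n : ℝ) / 2) *
      (t ^ (-((n : ℝ) / 2 - γ + 1)) *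
        ((n / 2 + 1 + 2 * gaussArg r t) * Real.exp (-gaussArg r t))) := by
  have hG := kernelGauss_pos r t
  have hy0 := gaussArg_nonneg r t
  have hH : 0 ≤ H * t ^ γ := (abs_nonneg _).trans hb
  have hH' : 0 ≤ H * t ^ (γ - 1) := (abs_nonneg _).trans hb'
  have hD := norm_kernelDecay_le n ht
  have hD' := norm_kernelDecayDeriv_le n ht
  have hfrac : 2 * t / (1 + t ^ 2) ≤ 2 * t⁻¹ := by
    rw [← div_eq_mul_inv, div_le_div_iff₀ (by positivity) ht]
    nlinarith
  have e0 : t ^ (-((n : ℝ) / 2) - 1) = t ^ (-((n : ℝ) / 2)) * t⁻¹ := by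
    rw [Real.rpow_sub_one ht.ne', div_eq_mul_inv]
  have e1 : t ^ (γ - 1) = t ^ γ * t⁻¹ := by rw [Real.rpow_sub_one ht.ne', div_eq_mul_inv]
  have e : t ^ (-((n : ℝ) / 2 - γ + 1)) = t ^ γ * t ^ (-((n : ℝ) / 2)) * t⁻¹ := by
    rw [← Real.rpow_add ht, ← div_eq_mul_inv, ← Real.rpow_sub_one ht.ne']
    congr 1
    ring
  set P : ℝ := Real.pi ^ ((n : ℝ) / 2) * t ^ (-((n : ℝ) / 2)) with hP
  have hP0 : 0 ≤ P := by positivity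
  rw [e0, ← mul_assoc (Real.pi ^ ((n : ℝ) / 2)), ← hP] at hD'
  have n1 : ‖(h' t : ℂ) * (kernelDecay n t * (kernelGauss r t : ℂ))‖ ≤
      H * t ^ (γ - 1) * (P * kernelGauss r t) := by
    rw [norm_mul, norm_mul, Complex.norm_real, Complex.norm_real, Real.norm_eq_abs,
      Real.norm_eq_abs, abs_of_pos hG]
    gcongr
  have n2 : ‖kernelDecayDeriv n t * (kernelGauss r t : ℂ)‖ ≤
      (n / 2 : ℝ) * (P * t⁻¹) * kernelGauss r t := by
    rw [norm_mul, Complex.norm_real, Real.norm_eq_abs, abs_of_pos hG]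
    gcongr
  have n3 : ‖kernelDecay n t *
      ((kernelGauss r t * (r ^ 2 / (4 * (1 + t ^ 2)) * (2 * t / (1 + t ^ 2))) : ℝ) : ℂ)‖ ≤
      P * (kernelGauss r t * (gaussArg r t * (2 * t⁻¹))) := by
    rw [norm_mul, Complex.norm_real, Real.norm_eq_abs, abs_of_nonneg (by positivity)]
    unfold gaussArg
    gcongr
  calc _ ≤ H * t ^ (γ - 1) * (P * kernelGauss r t) + H * t ^ γ *
        ((n / 2 : ℝ) * (P * t⁻¹) * kernelGauss r t +
          P * (kernelGauss r t * (gaussArg r t * (2 * t⁻¹)))) := by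
        refine (norm_add_le _ _).trans (add_le_add n1 ?_)
        rw [norm_mul, Complex.norm_real, Real.norm_eq_abs]
        exact mul_le_mul hb ((norm_add_le _ _).trans (add_le_add n2 n3)) (norm_nonneg _) hH
    _ = _ := by
        rw [e, e1, hP]
        simp only [kernelGauss, gaussArg]
        ring

theorem integral_gaussKernel_eq (n : ℕ) (h : ℝ → ℝ) (r T T' : ℝ) :
    ∫ t in T..T', (h t : ℂ) * gaussKernel n t r =
      ∫ t in T..T', kernelAmp n h r t * Complex.exp (Complex.I * (kernelPhase r t : ℂ)) := by
  refine intervalIntegral.integral_congr fun t _ => ?_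
  simp only [gaussKernel_eq, kernelAmp]
  ring

theorem continuous_cexp_kernelPhase (r : ℝ) :
    Continuous fun t => Complex.exp (Complex.I * (kernelPhase r t : ℂ)) :=
  (continuous_const.mul (Complex.continuous_ofReal.comp (continuous_kernelPhase r))).cexp

/-- The nonstationary range. The first derivative test with `l = 1/2` bounds the phase integrals by
`8`, and the amplitude has supremum and variation of order `T^(-b)`. -/
theorem norm_integral_gaussKernel_le_of_ge {n : ℕ} {h h' : ℝ → ℝ} {γ H r T T' : ℝ} (hT : 2 ≤ T)
    (hTT : T ≤ T') (hr : 0 ≤ r) (hrT : r ≤ T) (hs : IsSymbolOn h h' γ H T T')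
    (hb : 1 / 2 ≤ (n : ℝ) / 2 - γ) (hH : 0 ≤ H) :
    ‖∫ t in T..T', (h t : ℂ) * gaussKernel n t r‖ ≤
      8 * (H * Real.pi ^ ((n : ℝ) / 2) * (n + 7) * T ^ (-((n : ℝ) / 2 - γ))) := by
  set b := (n : ℝ) / 2 - γ with hbdef
  have hT0 : 0 < T := by linarith
  rw [integral_gaussKernel_eq]
  refine norm_integral_mul_le_of_primitive_le (A' := kernelAmpDeriv n h h' r) hTT (by norm_num)
    (fun t ht => hasDerivAt_kernelAmp r rfl (hs.hasDerivAt t ht))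
    (continuousOn_kernelAmpDeriv r
      (fun t ht => (hs.hasDerivAt t ht).continuousAt.continuousWithinAt) hs.continuousOn)
    (continuous_cexp_kernelPhase r) (fun x hx => ?_) ?_
  · refine (norm_integral_cexp_le_of_deriv (l := 1 / 2) hx.1 (by norm_num)
      (fun t _ => hasDerivAt_kernelPhase r t) (fun t _ => hasDerivAt_kernelPhaseDeriv r t)
      (continuous_kernelPhaseDeriv2 r).continuousOn
      (fun t ht => kernelPhaseDeriv2_nonneg r (hT.trans ht.1))
      fun t ht => kernelPhaseDeriv_ge (hT.trans ht.1) hr (hrT.trans ht.1)).trans (by norm_num)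
  · set c := H * Real.pi ^ ((n : ℝ) / 2) with hc
    have hc0 : 0 ≤ c := by positivity
    have h1 : ‖kernelAmp n h r T'‖ ≤ c * T ^ (-b) := by
      refine (norm_kernelAmp_le (hT0.trans_le hTT) (hs.bound T' ⟨hTT, le_rfl⟩)).trans ?_
      refine mul_le_mul_of_nonneg_left ?_ hc0
      calc T' ^ (-b) * Real.exp (-gaussArg r T') ≤ T' ^ (-b) * 1 := by
            have := hT0.trans_le hTT
            refine mul_le_mul_of_nonneg_left ?_ (by positivity)
            exact Real.exp_le_one_iff.2 (neg_nonpos.2 (gaussArg_nonneg _ _))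
        _ ≤ T ^ (-b) := by
            rw [mul_one]
            exact Real.rpow_le_rpow_of_nonpos hT0 hTT (by linarith)
    have h2 : ∫ t in T..T', ‖kernelAmpDeriv n h h' r t‖ ≤ c * ((n / 2 + 3) * (2 * T ^ (-b))) := by
      have hmem : (0 : ℝ) ∉ Set.uIcc T T' := by
        rw [Set.uIcc_of_le hTT]
        exact fun hh => absurd hh.1 (not_le.2 hT0)
      have hle : ∫ t in T..T', ‖kernelAmpDeriv n h h' r t‖ ≤
          ∫ t in T..T', c * (n / 2 + 3) * t ^ (-b - 1) := by
        refine intervalIntegral.integral_mono_on hTT ?_ ?_ fun t ht => ?_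
        · refine ContinuousOn.intervalIntegrable ?_
          rw [Set.uIcc_of_le hTT]
          exact (continuousOn_kernelAmpDeriv r
            (fun t ht => (hs.hasDerivAt t ht).continuousAt.continuousWithinAt) hs.continuousOn).norm
        · exact (intervalIntegral.intervalIntegrable_rpow (Or.inr hmem)).const_mul _
        · have ht0 : 0 < t := hT0.trans_le ht.1
          refine (norm_kernelAmpDeriv_le ht0 (hs.bound t ht) (hs.bound' t ht)).trans ?_
          rw [mul_assoc c]
          refine mul_le_mul_of_nonneg_left ?_ hc0
          have e : -(b + 1) = -b - 1 := by ring
          rw [← hbdef, e, mul_comm]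
          refine mul_le_mul_of_nonneg_right ?_ (by positivity)
          have hy := gaussArg_nonneg r t
          set y := gaussArg r t
          have h1 : Real.exp (-y) ≤ 1 := Real.exp_le_one_iff.2 (neg_nonpos.2 hy)
          have h2 : y * Real.exp (-y) ≤ 1 := by
            rw [Real.exp_neg, ← div_eq_mul_inv, div_le_one (Real.exp_pos y)]
            linarith [Real.add_one_le_exp y]
          have h3 : ((n : ℝ) / 2 + 1) * Real.exp (-y) ≤ ((n : ℝ) / 2 + 1) * 1 :=
            mul_le_mul_of_nonneg_left h1 (by positivity)
          linarith
      refine hle.trans ?_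
      rw [intervalIntegral.integral_const_mul, integral_rpow (Or.inr ⟨by linarith, hmem⟩), mul_assoc]
      refine mul_le_mul_of_nonneg_left (mul_le_mul_of_nonneg_left ?_ (by positivity)) hc0
      have e : -b - 1 + 1 = -b := by ring
      rw [e]
      have hb0 : 0 < b := by linarith
      have h3 : 0 ≤ T' ^ (-b) := Real.rpow_nonneg (by linarith) _
      have h4 : 0 ≤ T ^ (-b) := Real.rpow_nonneg (by linarith) _
      rw [div_neg, ← neg_div, div_le_iff₀ hb0]
      nlinarith
    calc _ ≤ c * T ^ (-b) + c * ((n / 2 + 3) * (2 * T ^ (-b))) := add_le_add h1 h2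
      _ = _ := by ring

/-- The range that may contain the stationary point. The second derivative test bounds the phase
integrals by `10 √(16 r) = 40 √r`, while the Gaussian factor makes the amplitude `O(r^(-b))` even
where `t` is much smaller than `r`. -/
theorem exists_norm_integral_gaussKernel_le_of_le (n : ℕ) (γ : ℝ)
    (hb : 1 / 2 ≤ (n : ℝ) / 2 - γ) :
    ∃ C : ℝ, 0 ≤ C ∧ ∀ (h h' : ℝ → ℝ) (H r T T' : ℝ), 0 ≤ H → 2 ≤ T → T ≤ T' → T' ≤ r →
      IsSymbolOn h h' γ H T T' →
      ‖∫ t in T..T', (h t : ℂ) * gaussKernel n t r‖ ≤ C * H * r ^ (1 / 2 - ((n : ℝ) / 2 - γ)) := by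
  set b := (n : ℝ) / 2 - γ with hbdef
  obtain ⟨C1, hC1, h1⟩ := exists_gaussArg_bound b 1 (by linarith) (by norm_num)
  obtain ⟨C2, hC2, h2⟩ := exists_gaussArg_bound (b + 1) (n / 2 + 1) (by linarith) (by positivity)
  refine ⟨40 * (Real.pi ^ ((n : ℝ) / 2) * (C1 + C2)), by positivity, ?_⟩
  intro h h' H r T T' hH hT hTT hTr hs
  have hr0 : 0 < r := by linarith
  have hsr : 0 < √r := Real.sqrt_pos.2 hr0
  rw [integral_gaussKernel_eq]
  set c := H * Real.pi ^ ((n : ℝ) / 2) with hc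
  have hc0 : 0 ≤ c := by positivity
  have key := norm_integral_mul_le_of_primitive_le (A := kernelAmp n h r)
    (A' := kernelAmpDeriv n h h' r)
    (e := fun t => Complex.exp (Complex.I * (kernelPhase r t : ℂ)))
    (M := 40 * √r) (K := c * (C1 + C2) * r ^ (-b)) hTT (by positivity)
    (fun t ht => hasDerivAt_kernelAmp r rfl (hs.hasDerivAt t ht))
    (continuousOn_kernelAmpDeriv r
      (fun t ht => (hs.hasDerivAt t ht).continuousAt.continuousWithinAt) hs.continuousOn)
    (continuous_cexp_kernelPhase r) (fun x hx => ?_) ?_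
  · refine key.trans (le_of_eq ?_)
    rw [show (1 / 2 - b) = 1 / 2 + -b by ring, Real.rpow_add hr0, ← Real.sqrt_eq_rpow, hc]
    ring
  · refine (norm_integral_cexp_le_of_deriv2 (l := 1 / (16 * r)) hx.1 (by positivity)
      (fun t _ => hasDerivAt_kernelPhase r t) (fun t _ => hasDerivAt_kernelPhaseDeriv r t)
      (continuous_kernelPhaseDeriv2 r).continuousOn
      (fun t ht => kernelPhaseDeriv2_ge (hT.trans ht.1) (ht.2.trans (hx.2.trans hTr)))).trans
      (le_of_eq ?_)
    rw [Real.sqrt_div (by norm_num), Real.sqrt_one, Real.sqrt_mul (by norm_num),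
      show √(16 : ℝ) = 4 by rw [show (16 : ℝ) = 4 ^ 2 by norm_num]; exact Real.sqrt_sq (by norm_num)]
    field_simp
    norm_num
  · have e1 : ‖kernelAmp n h r T'‖ ≤ c * (C1 * r ^ (-b)) := by
      have hy := gaussArg_nonneg r T'
      refine (norm_kernelAmp_le (by linarith) (hs.bound T' ⟨hTT, le_rfl⟩)).trans ?_
      refine mul_le_mul_of_nonneg_left (le_trans ?_ (h1 r T' (hT.trans hTT) hTr)) hc0
      refine mul_le_mul_of_nonneg_left ?_ (Real.rpow_nonneg (by linarith) _)
      have := Real.exp_pos (-gaussArg r T')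
      nlinarith
    have e2 : ∫ t in T..T', ‖kernelAmpDeriv n h h' r t‖ ≤ c * (C2 * r ^ (-b)) := by
      have hpt : ∀ t ∈ Set.Icc T T', ‖kernelAmpDeriv n h h' r t‖ ≤ c * (C2 * r ^ (-(b + 1))) := by
        intro t ht
        refine (norm_kernelAmpDeriv_le (by linarith [ht.1]) (hs.bound t ht) (hs.bound' t ht)).trans ?_
        exact mul_le_mul_of_nonneg_left (h2 r t (hT.trans ht.1) (ht.2.trans hTr)) hc0
      have hle : ∫ t in T..T', ‖kernelAmpDeriv n h h' r t‖ ≤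
          ∫ _t in T..T', c * (C2 * r ^ (-(b + 1))) := by
        refine intervalIntegral.integral_mono_on hTT ?_ (by simp) hpt
        refine ContinuousOn.intervalIntegrable ?_
        rw [Set.uIcc_of_le hTT]
        exact (continuousOn_kernelAmpDeriv r
          (fun t ht => (hs.hasDerivAt t ht).continuousAt.continuousWithinAt) hs.continuousOn).norm
      refine hle.trans ?_
      rw [intervalIntegral.integral_const, smul_eq_mul]
      have e : r ^ (-b) = r * r ^ (-(b + 1)) := by
        rw [show -(b + 1) = -b - 1 by ring, Real.rpow_sub_one hr0.ne']
        field_simp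
      rw [e]
      have h0 : 0 ≤ c * (C2 * r ^ (-(b + 1))) := by positivity
      calc _ ≤ r * (c * (C2 * r ^ (-(b + 1)))) := mul_le_mul_of_nonneg_right (by linarith) h0
        _ = _ := by ring
    calc _ ≤ c * (C1 * r ^ (-b)) + c * (C2 * r ^ (-b)) := add_le_add e1 e2
      _ = _ := by ring

/-- Decay of the truncated kernels, uniformly in the distance `r`. -/
theorem exists_norm_integral_gaussKernel_le (n : ℕ) (γ : ℝ) (hb : 1 / 2 ≤ (n : ℝ) / 2 - γ) :
    ∃ C : ℝ, 0 ≤ C ∧ ∀ (h h' : ℝ → ℝ) (H r T T' : ℝ), 0 ≤ H → 0 ≤ r → 2 ≤ T → T ≤ T' →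
      IsSymbolOn h h' γ H T T' →
      ‖∫ t in T..T', (h t : ℂ) * gaussKernel n t r‖ ≤ C * H * T ^ (1 / 2 - ((n : ℝ) / 2 - γ)) := by
  obtain ⟨C, hC, hle⟩ := exists_norm_integral_gaussKernel_le_of_le n γ hb
  set b := (n : ℝ) / 2 - γ with hbdef
  set D := 8 * (Real.pi ^ ((n : ℝ) / 2) * (n + 7)) with hD
  have hD0 : 0 ≤ D := by positivity
  have hpow : ∀ T r : ℝ, 2 ≤ T → T ≤ r → r ^ (1 / 2 - b) ≤ T ^ (1 / 2 - b) := fun T r hT hr =>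
    Real.rpow_le_rpow_of_nonpos (by linarith) hr (by linarith)
  have hlarge : ∀ (h h' : ℝ → ℝ) (H r T T' : ℝ), 0 ≤ H → 0 ≤ r → 2 ≤ T → T ≤ T' → r ≤ T →
      IsSymbolOn h h' γ H T T' →
      ‖∫ t in T..T', (h t : ℂ) * gaussKernel n t r‖ ≤ D * H * T ^ (1 / 2 - b) := by
    intro h h' H r T T' hH hr hT hTT hrT hs
    refine (norm_integral_gaussKernel_le_of_ge hT hTT hr hrT hs hb hH).trans ?_
    have : T ^ (-b) ≤ T ^ (1 / 2 - b) :=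
      Real.rpow_le_rpow_of_exponent_le (by linarith) (by linarith)
    calc _ = D * H * T ^ (-b) := by rw [hD]; ring
      _ ≤ _ := mul_le_mul_of_nonneg_left this (by positivity)
  refine ⟨C + D, by positivity, fun h h' H r T T' hH hr hT hTT hs => ?_⟩
  have hX : 0 ≤ H * T ^ (1 / 2 - b) := mul_nonneg hH (Real.rpow_nonneg (by linarith) _)
  rcases le_total r T with h1 | h1
  · refine (hlarge h h' H r T T' hH hr hT hTT h1 hs).trans ?_
    nlinarith
  rcases le_total T' r with h2 | h2
  · refine (hle h h' H r T T' hH hT hTT h2 hs).trans ?_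
    have := mul_le_mul_of_nonneg_left (hpow T r hT h1) (mul_nonneg hC hH)
    nlinarith
  -- When `r` lies inside the interval, cut there; each piece is `O(r^(1/2 - b))`, and the exponent
  -- is nonpositive, so `r` may be replaced by `T`.
  · have hI : ∀ u v, T ≤ u → u ≤ v → v ≤ T' →
        IntervalIntegrable (fun t => (h t : ℂ) * gaussKernel n t r) volume u v := by
      intro u v hu huv hv
      have e : (fun t => (h t : ℂ) * gaussKernel n t r) = fun t => kernelAmp n h r t *
          Complex.exp (Complex.I * (kernelPhase r t : ℂ)) := by
        funext t
        simp only [gaussKernel_eq, kernelAmp]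
        ring
      rw [e]
      refine ContinuousOn.intervalIntegrable ?_
      rw [Set.uIcc_of_le huv]
      intro t ht
      exact ((hasDerivAt_kernelAmp r rfl (hs.hasDerivAt t ⟨hu.trans ht.1, ht.2.trans hv⟩)
        ).continuousAt.mul (continuous_cexp_kernelPhase r).continuousAt).continuousWithinAt
    rw [← intervalIntegral.integral_add_adjacent_intervals (hI T r le_rfl h1 h2)
      (hI r T' h1 h2 le_rfl)]
    have a1 := hle h h' H r T r hH hT h1 le_rfl (hs.mono le_rfl h2)
    have a2 := hlarge h h' H r r T' hH hr (hT.trans h1) h2 le_rfl (hs.mono h1 le_rfl)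
    have a3 := mul_le_mul_of_nonneg_left (hpow T r hT h1) (mul_nonneg hC hH)
    have a4 := mul_le_mul_of_nonneg_left (hpow T r hT h1) (mul_nonneg hD0 hH)
    refine (norm_add_le _ _).trans ?_
    nlinarith

end KernelBounds

end BochnerRiesz

namespace BochnerRiesz

/-! ### Splitting a symbol at scale `T` into low and high parts -/

noncomputable section Splitting

/-- A symbol of order `γ` on the half-line, with constant `H`, which is integrable. -/
structure IsSymbol (h h' : ℝ → ℝ) (γ H : ℝ) : Prop where
  hasDerivAt : ∀ t, HasDerivAt h (h' t) t
  continuous_deriv : Continuous h'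
  bound : ∀ t, 0 ≤ t → |h t| ≤ H * t ^ γ
  bound' : ∀ t, 0 < t → |h' t| ≤ H * t ^ (γ - 1)
  integrableOn : IntegrableOn h (Set.Ioi 0)

theorem IsSymbol.continuous {h h' : ℝ → ℝ} {γ H : ℝ} (hs : IsSymbol h h' γ H) : Continuous h :=
  continuous_iff_continuousAt.2 fun t => (hs.hasDerivAt t).continuousAt

theorem IsSymbol.isSymbolOn {h h' : ℝ → ℝ} {γ H T T' : ℝ} (hs : IsSymbol h h' γ H) (hT : 0 < T) :
    IsSymbolOn h h' γ H T T' :=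
  ⟨fun t _ => hs.hasDerivAt t, hs.continuous_deriv.continuousOn,
    fun t ht => hs.bound t (hT.le.trans ht.1), fun t ht => hs.bound' t (hT.trans_le ht.1)⟩

theorem IsSymbol.nonneg {h h' : ℝ → ℝ} {γ H : ℝ} (hs : IsSymbol h h' γ H) : 0 ≤ H := by
  have := (abs_nonneg _).trans (hs.bound 1 zero_le_one)
  simpa using this

/-- The Fourier–Laplace multiplier of a function on the half-line. -/
def halfMultiplier (h : ℝ → ℝ) (s : ℝ) : ℂ :=
  ∫ t in Set.Ioi (0 : ℝ), (h t : ℂ) * Complex.exp (Complex.I * ((t * s : ℝ) : ℂ))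

/-- The superposition of the kernels `gaussKernel` with weight `h`. -/
def halfKernel (n : ℕ) (h : ℝ → ℝ) (r : ℝ) : ℂ :=
  ∫ t in Set.Ioi (0 : ℝ), (h t : ℂ) * gaussKernel n t r

/-- The low part of `h`: its restriction to `(0, T]`, corrected on `(T, 2T]` to have mean zero. -/
def lowPart (h : ℝ → ℝ) (T : ℝ) (t : ℝ) : ℝ :=
  (Set.Ioc 0 T).indicator h t - (Set.Ioc T (2 * T)).indicator (fun _ => (∫ t in 0..T, h t) / T) t

/-- The high part of `h`. -/
def highPart (h : ℝ → ℝ) (T : ℝ) (t : ℝ) : ℝ := h t - lowPart h T t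

theorem continuous_gaussKernel (n : ℕ) (r : ℝ) : Continuous fun t => gaussKernel n t r := by
  simp only [gaussKernel_eq]
  exact ((continuous_kernelDecay n).mul (Complex.continuous_ofReal.comp (continuous_kernelGauss r))).mul
    (continuous_cexp_kernelPhase r)

theorem IntegrableOn.lowPart {h : ℝ → ℝ} (T : ℝ) (hi : IntegrableOn h (Set.Ioi 0)) :
    IntegrableOn (lowPart h T) (Set.Ioi 0) := by
  refine Integrable.sub (hi.indicator measurableSet_Ioc) ?_
  refine IntegrableOn.integrable_indicator ?_ measurableSet_Ioc
  refine integrableOn_const (ne_of_lt ?_)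
  refine (Measure.restrict_apply_le _ _).trans_lt ?_
  simp

theorem IntegrableOn.highPart {h : ℝ → ℝ} (T : ℝ) (hi : IntegrableOn h (Set.Ioi 0)) :
    IntegrableOn (highPart h T) (Set.Ioi 0) :=
  Integrable.sub hi (IntegrableOn.lowPart T hi)

theorem IntegrableOn.mul_bounded {h : ℝ → ℝ} {e : ℝ → ℂ} {M : ℝ}
    (hi : IntegrableOn h (Set.Ioi 0)) (he : Continuous e) (hM : ∀ t, ‖e t‖ ≤ M) :
    IntegrableOn (fun t => (h t : ℂ) * e t) (Set.Ioi 0) :=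
  Integrable.mul_bdd (c := M) hi.ofReal he.aestronglyMeasurable (Eventually.of_forall hM)

theorem integral_lowPart_mul {h : ℝ → ℝ} {T : ℝ} (hh : Continuous h) (hT : 0 < T) {e : ℝ → ℂ}
    (he : Continuous e) :
    ∫ t in Set.Ioi (0 : ℝ), (lowPart h T t : ℂ) * e t =
      (∫ t in 0..T, (h t : ℂ) * e t) -
        (((∫ t in 0..T, h t) / T : ℝ) : ℂ) * ∫ t in T..(2 * T), e t := by
  set c : ℝ := (∫ t in 0..T, h t) / T with hc
  have hsub1 : Set.Ioc 0 T ⊆ Set.Ioi (0 : ℝ) := fun t ht => ht.1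
  have hsub2 : Set.Ioc T (2 * T) ⊆ Set.Ioi (0 : ℝ) := fun t ht => hT.trans ht.1
  have e1 : (fun t => (lowPart h T t : ℂ) * e t) = fun t =>
      (Set.Ioc 0 T).indicator (fun t => (h t : ℂ) * e t) t -
        (Set.Ioc T (2 * T)).indicator (fun t => (c : ℂ) * e t) t := by
    funext t
    simp only [lowPart, ← hc, Set.indicator_apply]
    split_ifs <;> push_cast <;> ring
  have i1 : IntegrableOn (fun t => (h t : ℂ) * e t) (Set.Ioc 0 T) :=
    (((Complex.continuous_ofReal.comp hh).mul he).integrableOn_Ioc)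
  have i2 : IntegrableOn (fun t => (c : ℂ) * e t) (Set.Ioc T (2 * T)) :=
    (continuous_const.mul he).integrableOn_Ioc
  rw [e1, integral_sub, integral_indicator measurableSet_Ioc, integral_indicator measurableSet_Ioc,
    Measure.restrict_restrict measurableSet_Ioc, Measure.restrict_restrict measurableSet_Ioc,
    Set.inter_eq_left.2 hsub1, Set.inter_eq_left.2 hsub2,
    intervalIntegral.integral_of_le hT.le, intervalIntegral.integral_of_le (by linarith),
    integral_const_mul]
  · exact (i1.integrable_indicator measurableSet_Ioc).integrableOn
  · exact (i2.integrable_indicator measurableSet_Ioc).integrableOn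

theorem continuous_cexp_mul (s : ℝ) :
    Continuous fun t : ℝ => Complex.exp (Complex.I * ((t * s : ℝ) : ℂ)) := by fun_prop

theorem IsSymbol.abs_mean_le {h h' : ℝ → ℝ} {γ H T : ℝ} (hs : IsSymbol h h' γ H) (hγ : 0 ≤ γ)
    (hT : 0 < T) : |(∫ t in 0..T, h t) / T| ≤ H * T ^ γ := by
  rw [abs_div, abs_of_pos hT, div_le_iff₀ hT]
  have := intervalIntegral.norm_integral_le_of_norm_le_const (a := 0) (b := T) (f := h)
    (C := H * T ^ γ) fun t ht => ?_
  · simpa [abs_of_pos hT] using this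
  · rw [Set.uIoc_of_le hT.le] at ht
    refine (hs.bound t ht.1.le).trans (mul_le_mul_of_nonneg_left ?_ hs.nonneg)
    exact Real.rpow_le_rpow ht.1.le ht.2 hγ

/-- The multiplier of the low part is small near `s = 0`. -/
theorem IsSymbol.norm_halfMultiplier_lowPart_le {h h' : ℝ → ℝ} {γ H T : ℝ} (s : ℝ)
    (hs : IsSymbol h h' γ H) (hγ : 0 ≤ γ) (hT : 0 < T) :
    ‖halfMultiplier (lowPart h T) s‖ ≤ 3 * H * T ^ (γ + 1) * (T * |s|) := by
  have hH := hs.nonneg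
  have hexp : ∀ x : ℝ, ‖Complex.exp (Complex.I * (x : ℂ)) - 1‖ ≤ |x| := fun x =>
    (Real.norm_exp_I_mul_ofReal_sub_one_le (x := x))
  have hmean := hs.abs_mean_le hγ hT
  set c : ℝ := (∫ t in 0..T, h t) / T with hc
  have hcT : ∫ t in 0..T, (h t : ℂ) = (c : ℂ) * T := by
    rw [intervalIntegral.integral_ofReal, hc, ← Complex.ofReal_mul, div_mul_cancel₀ _ hT.ne']
  -- Because the low part has mean zero, `1` may be subtracted from the exponential; this produces
  -- the factor `T|s|`.
  have e1 : halfMultiplier (lowPart h T) s =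
      (∫ t in 0..T, (h t : ℂ) * (Complex.exp (Complex.I * ((t * s : ℝ) : ℂ)) - 1)) -
        (c : ℂ) * ∫ t in T..(2 * T), (Complex.exp (Complex.I * ((t * s : ℝ) : ℂ)) - 1) := by
    rw [halfMultiplier, integral_lowPart_mul hs.continuous hT (continuous_cexp_mul s), ← hc,
      intervalIntegral.integral_sub ((continuous_cexp_mul s).intervalIntegrable _ _) (by simp)]
    simp only [mul_sub, mul_one]
    rw [intervalIntegral.integral_sub, hcT]
    · simp only [intervalIntegral.integral_const, Complex.real_smul, mul_one]
      push_cast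
      ring
    · exact ((Complex.continuous_ofReal.comp hs.continuous).mul
        (continuous_cexp_mul s)).intervalIntegrable _ _
    · exact (Complex.continuous_ofReal.comp hs.continuous).intervalIntegrable _ _
  have b1 : ‖∫ t in 0..T, (h t : ℂ) * (Complex.exp (Complex.I * ((t * s : ℝ) : ℂ)) - 1)‖ ≤
      H * T ^ γ * (T * |s|) * |T - 0| := by
    refine intervalIntegral.norm_integral_le_of_norm_le_const fun t ht => ?_
    rw [Set.uIoc_of_le hT.le] at ht
    rw [norm_mul, Complex.norm_real, Real.norm_eq_abs]
    refine mul_le_mul ?_ ((hexp _).trans ?_) (norm_nonneg _)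
      (mul_nonneg hH (Real.rpow_nonneg hT.le _))
    · refine (hs.bound t ht.1.le).trans (mul_le_mul_of_nonneg_left ?_ hH)
      exact Real.rpow_le_rpow ht.1.le ht.2 hγ
    · rw [abs_mul, abs_of_pos ht.1]
      exact mul_le_mul_of_nonneg_right ht.2 (abs_nonneg _)
  have b2 : ‖∫ t in T..(2 * T), (Complex.exp (Complex.I * ((t * s : ℝ) : ℂ)) - 1)‖ ≤
      2 * (T * |s|) * |2 * T - T| := by
    refine intervalIntegral.norm_integral_le_of_norm_le_const fun t ht => ?_
    rw [Set.uIoc_of_le (by linarith)] at ht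
    refine (hexp _).trans ?_
    rw [abs_mul, abs_of_pos (hT.trans ht.1), ← mul_assoc]
    exact mul_le_mul_of_nonneg_right ht.2 (abs_nonneg _)
  rw [e1]
  refine (norm_sub_le _ _).trans ?_
  rw [norm_mul, Complex.norm_real, Real.norm_eq_abs]
  have b3 := mul_le_mul hmean b2 (norm_nonneg _) (mul_nonneg hH (Real.rpow_nonneg hT.le _))
  rw [sub_zero, abs_of_pos hT] at b1
  rw [show 2 * T - T = T by ring, abs_of_pos hT] at b3
  rw [Real.rpow_add_one hT.ne']
  calc _ ≤ _ := add_le_add b1 b3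
    _ = _ := by ring

/-- The multiplier of the low part decays. -/
theorem IsSymbol.mul_norm_halfMultiplier_lowPart_le {h h' : ℝ → ℝ} {γ H T : ℝ} (s : ℝ)
    (hs : IsSymbol h h' γ H) (hγ : 0 < γ) (hT : 0 < T) :
    T * |s| * ‖halfMultiplier (lowPart h T) s‖ ≤ (3 + 1 / γ) * H * T ^ (γ + 1) := by
  have hH := hs.nonneg
  have hmean := hs.abs_mean_le hγ.le hT
  have hHT : 0 ≤ H * T ^ γ := mul_nonneg hH (Real.rpow_nonneg hT.le _)
  set c : ℝ := (∫ t in 0..T, h t) / T with hc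
  have hder : ∀ t : ℝ, HasDerivAt (fun t : ℝ => Complex.exp (Complex.I * ((t * s : ℝ) : ℂ)))
      (Complex.exp (Complex.I * ((t * s : ℝ) : ℂ)) * (Complex.I * (s : ℂ))) t := fun t =>
    hasDerivAt_cexp_I_mul (by simpa using (hasDerivAt_id t).mul_const s)
  have b1 : |s| * ‖∫ t in 0..T, (h t : ℂ) * Complex.exp (Complex.I * ((t * s : ℝ) : ℂ))‖ ≤
      H * T ^ γ * (1 + 1 / γ) := by
    have hparts := intervalIntegral.integral_mul_deriv_eq_deriv_mul (a := 0) (b := T)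
      (u := fun t => (h t : ℂ)) (u' := fun t => (h' t : ℂ))
      (v := fun t : ℝ => Complex.exp (Complex.I * ((t * s : ℝ) : ℂ)))
      (v' := fun t : ℝ => Complex.exp (Complex.I * ((t * s : ℝ) : ℂ)) * (Complex.I * (s : ℂ)))
      (fun t _ => (hs.hasDerivAt t).ofReal_comp) (fun t _ => hder t)
      ((Complex.continuous_ofReal.comp hs.continuous_deriv).intervalIntegrable _ _)
      (((continuous_cexp_mul s).mul continuous_const).intervalIntegrable _ _)
    -- Positivity of `γ` kills the boundary term at `0`, and also makes `t^(γ-1)` integrable there.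
    have h0 : h 0 = 0 := by
      have := hs.bound 0 le_rfl
      rw [Real.zero_rpow hγ.ne', mul_zero] at this
      exact abs_nonpos_iff.1 this
    have hl : |s| * ‖∫ t in 0..T, (h t : ℂ) * Complex.exp (Complex.I * ((t * s : ℝ) : ℂ))‖ =
        ‖∫ t in 0..T, (h t : ℂ) *
          (Complex.exp (Complex.I * ((t * s : ℝ) : ℂ)) * (Complex.I * (s : ℂ)))‖ := by
      simp only [← mul_assoc]
      rw [intervalIntegral.integral_mul_const, intervalIntegral.integral_mul_const, norm_mul,
        norm_mul, Complex.norm_I, Complex.norm_real, Real.norm_eq_abs]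
      ring
    rw [hl, hparts, h0]
    have a1 : ‖(h T : ℂ) * Complex.exp (Complex.I * ((T * s : ℝ) : ℂ))‖ ≤ H * T ^ γ := by
      rw [norm_mul, norm_cexp_I_mul_ofReal, mul_one, Complex.norm_real, Real.norm_eq_abs]
      exact hs.bound T hT.le
    have a2 : ‖∫ t in 0..T, (h' t : ℂ) * Complex.exp (Complex.I * ((t * s : ℝ) : ℂ))‖ ≤
        ∫ t in 0..T, H * t ^ (γ - 1) := by
      refine intervalIntegral.norm_integral_le_of_norm_le hT.le (Eventually.of_forall fun t ht => ?_)
        ((intervalIntegral.intervalIntegrable_rpow' (by linarith)).const_mul H)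
      rw [norm_mul, norm_cexp_I_mul_ofReal, mul_one, Complex.norm_real, Real.norm_eq_abs]
      exact hs.bound' t ht.1
    rw [intervalIntegral.integral_const_mul, integral_rpow (Or.inl (by linarith)), sub_add_cancel,
      Real.zero_rpow hγ.ne', sub_zero] at a2
    simp only [Complex.ofReal_zero, zero_mul, sub_zero]
    calc _ ≤ H * T ^ γ + H * (T ^ γ / γ) := (norm_sub_le _ _).trans (add_le_add a1 a2)
      _ = _ := by ring
  have b2 : |s| * ‖∫ t in T..(2 * T), Complex.exp (Complex.I * ((t * s : ℝ) : ℂ))‖ ≤ 2 := by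
    have hl : |s| * ‖∫ t in T..(2 * T), Complex.exp (Complex.I * ((t * s : ℝ) : ℂ))‖ =
        ‖∫ t in T..(2 * T),
          Complex.exp (Complex.I * ((t * s : ℝ) : ℂ)) * (Complex.I * (s : ℂ))‖ := by
      rw [intervalIntegral.integral_mul_const, norm_mul,
        norm_mul, Complex.norm_I, Complex.norm_real, Real.norm_eq_abs]
      ring
    rw [hl, intervalIntegral.integral_eq_sub_of_hasDerivAt (fun t _ => hder t)
      (((continuous_cexp_mul s).mul continuous_const).intervalIntegrable _ _)]
    refine (norm_sub_le _ _).trans ?_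
    rw [norm_cexp_I_mul_ofReal, norm_cexp_I_mul_ofReal]
    norm_num
  have e1 : halfMultiplier (lowPart h T) s =
      (∫ t in 0..T, (h t : ℂ) * Complex.exp (Complex.I * ((t * s : ℝ) : ℂ))) -
        (c : ℂ) * ∫ t in T..(2 * T), Complex.exp (Complex.I * ((t * s : ℝ) : ℂ)) := by
    rw [halfMultiplier, integral_lowPart_mul hs.continuous hT (continuous_cexp_mul s), ← hc]
  have b3 := mul_le_mul hmean b2 (by positivity) hHT
  have b4 : |s| * ‖halfMultiplier (lowPart h T) s‖ ≤ H * T ^ γ * (3 + 1 / γ) := by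
    rw [e1]
    refine (mul_le_mul_of_nonneg_left (norm_sub_le _ _) (abs_nonneg s)).trans ?_
    rw [norm_mul, Complex.norm_real, Real.norm_eq_abs]
    linarith
  rw [Real.rpow_add_one hT.ne']
  have := mul_le_mul_of_nonneg_left b4 hT.le
  linarith

/-- The kernel of the high part is small. -/
theorem exists_norm_halfKernel_highPart_le (n : ℕ) (γ : ℝ) (hγ : 0 ≤ γ)
    (hb : 1 / 2 ≤ (n : ℝ) / 2 - γ) :
    ∃ C : ℝ, 0 ≤ C ∧ ∀ (h h' : ℝ → ℝ) (H r T : ℝ), 0 ≤ r → 2 ≤ T → IsSymbol h h' γ H →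
      ‖halfKernel n (highPart h T) r‖ ≤ C * H * T ^ (1 / 2 - ((n : ℝ) / 2 - γ)) := by
  obtain ⟨C, hC, hle⟩ := exists_norm_integral_gaussKernel_le n γ hb
  refine ⟨2 * C, by positivity, fun h h' H r T hr hT hs => ?_⟩
  have hT0 : 0 < T := by linarith
  have hH := hs.nonneg
  have hmean := hs.abs_mean_le hγ hT0
  set c : ℝ := (∫ t in 0..T, h t) / T with hc
  have hK := continuous_gaussKernel n r
  have hint : IntegrableOn (fun t => (h t : ℂ) * gaussKernel n t r) (Set.Ioi 0) :=
    IntegrableOn.mul_bounded hs.integrableOn hK fun t => norm_gaussKernel_le n t r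
  have hsplit : halfKernel n (highPart h T) r =
      (∫ t in Set.Ioi T, (h t : ℂ) * gaussKernel n t r) +
        (c : ℂ) * ∫ t in T..(2 * T), gaussKernel n t r := by
    have e1 : halfKernel n (highPart h T) r = (∫ t in Set.Ioi (0 : ℝ), (h t : ℂ) * gaussKernel n t r)
        - ∫ t in Set.Ioi (0 : ℝ), (lowPart h T t : ℂ) * gaussKernel n t r := by
      rw [← integral_sub hint (IntegrableOn.mul_bounded (IntegrableOn.lowPart T hs.integrableOn) hK
        fun t => norm_gaussKernel_le n t r), halfKernel]
      congr 1
      funext t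
      simp only [highPart]
      push_cast
      ring
    rw [e1, integral_lowPart_mul hs.continuous hT0 hK, ← hc,
      ← intervalIntegral.integral_interval_add_Ioi hint
        (hint.mono_set (Set.Ioi_subset_Ioi hT0.le))]
    ring
  have b1 : ‖∫ t in Set.Ioi T, (h t : ℂ) * gaussKernel n t r‖ ≤
      C * H * T ^ (1 / 2 - ((n : ℝ) / 2 - γ)) := by
    have htend := (intervalIntegral_tendsto_integral_Ioi T
      (hint.mono_set (Set.Ioi_subset_Ioi hT0.le)) tendsto_id).norm
    refine le_of_tendsto htend ?_
    filter_upwards [eventually_ge_atTop T] with T' hT'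
    exact hle h h' H r T T' hH hr hT hT' (hs.isSymbolOn hT0)
  have b2 : ‖(c : ℂ) * ∫ t in T..(2 * T), gaussKernel n t r‖ ≤
      C * H * T ^ (1 / 2 - ((n : ℝ) / 2 - γ)) := by
    rw [← intervalIntegral.integral_const_mul]
    -- The constant mean value is itself a symbol of order `γ` on `[T, 2T]`, so the correction obeys
    -- the same kernel bound.
    refine hle (fun _ => c) (fun _ => 0) H r T (2 * T) hH hr hT (by linarith)
      ⟨fun t _ => hasDerivAt_const t c, continuousOn_const, fun t ht => ?_, fun t ht => ?_⟩
    · exact hmean.trans (mul_le_mul_of_nonneg_left (Real.rpow_le_rpow hT0.le ht.1 hγ) hH)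
    · rw [abs_zero]
      exact mul_nonneg hH (Real.rpow_nonneg (hT0.le.trans ht.1) _)
  rw [hsplit]
  refine (norm_add_le _ _).trans ((add_le_add b1 b2).trans (le_of_eq (by ring)))

/-- Cut at `2`: near the origin the kernel is bounded and `h` is at most `H 2^γ`, and the tail is
covered by the decay estimate. This replaces the splitting at scales below `2`, and settles `p = 1`
alone. -/
theorem exists_norm_halfKernel_le (n : ℕ) (γ : ℝ) (hγ : 0 ≤ γ)
    (hb : 1 / 2 ≤ (n : ℝ) / 2 - γ) :
    ∃ C : ℝ, 0 ≤ C ∧ ∀ (h h' : ℝ → ℝ) (H r : ℝ), 0 ≤ r → IsSymbol h h' γ H →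
      ‖halfKernel n h r‖ ≤ C * H := by
  obtain ⟨C, hC, hle⟩ := exists_norm_integral_gaussKernel_le n γ hb
  refine ⟨2 ^ γ * Real.pi ^ ((n : ℝ) / 2) * 2 + C * 2 ^ (1 / 2 - ((n : ℝ) / 2 - γ)), by positivity,
    fun h h' H r hr hs => ?_⟩
  have hH := hs.nonneg
  have hint : IntegrableOn (fun t => (h t : ℂ) * gaussKernel n t r) (Set.Ioi 0) :=
    IntegrableOn.mul_bounded hs.integrableOn (continuous_gaussKernel n r)
      fun t => norm_gaussKernel_le n t r
  have hint2 := hint.mono_set (Set.Ioi_subset_Ioi (zero_le_two (α := ℝ)))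
  rw [halfKernel, ← intervalIntegral.integral_interval_add_Ioi hint hint2]
  have b1 : ‖∫ t in Set.Ioi (2 : ℝ), (h t : ℂ) * gaussKernel n t r‖ ≤
      C * H * 2 ^ (1 / 2 - ((n : ℝ) / 2 - γ)) := by
    refine le_of_tendsto (intervalIntegral_tendsto_integral_Ioi 2 hint2 tendsto_id).norm ?_
    filter_upwards [eventually_ge_atTop 2] with T' hT'
    exact hle h h' H r 2 T' hH hr le_rfl hT' (hs.isSymbolOn two_pos)
  have b2 : ‖∫ t in (0 : ℝ)..2, (h t : ℂ) * gaussKernel n t r‖ ≤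
      H * 2 ^ γ * Real.pi ^ ((n : ℝ) / 2) * |2 - 0| := by
    refine intervalIntegral.norm_integral_le_of_norm_le_const fun t ht => ?_
    rw [Set.uIoc_of_le zero_le_two] at ht
    rw [norm_mul, Complex.norm_real, Real.norm_eq_abs]
    refine mul_le_mul ?_ (norm_gaussKernel_le n t r) (norm_nonneg _) (by positivity)
    exact (hs.bound t ht.1.le).trans (mul_le_mul_of_nonneg_left
      (Real.rpow_le_rpow ht.1.le ht.2 hγ) hH)
  rw [sub_zero, abs_of_pos two_pos] at b2
  exact (norm_add_le _ _).trans ((add_le_add b2 b1).trans (le_of_eq (by ring)))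

end Splitting

end BochnerRiesz

namespace BochnerRiesz

/-! ### Fourier transforms with the `e^{-iξ·x}` normalization: duality, uniqueness, Plancherel -/

noncomputable section FourierTheory

open scoped FourierTransform

variable {n : ℕ}

/-- The pairing with respect to which `fourierInt` is a `VectorFourier.fourierIntegral`. -/
def fourierPairing (n : ℕ) : E n →ₗ[ℝ] E n →ₗ[ℝ] ℝ := (2 * Real.pi)⁻¹ • innerₗ (E n)

theorem continuous_fourierPairing : Continuous fun p : E n × E n => fourierPairing n p.1 p.2 := by
  simp only [fourierPairing, LinearMap.smul_apply, innerₗ_apply_apply]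
  fun_prop

theorem fourierPairing_flip : (fourierPairing n).flip = fourierPairing n := by
  ext v w
  simp [fourierPairing, real_inner_comm]

theorem fourierInt_eq_fourierIntegral (f : E n → ℂ) :
    fourierInt f = VectorFourier.fourierIntegral Real.fourierChar volume (fourierPairing n) f := by
  funext ξ
  rw [VectorFourier.fourierIntegral, fourierInt]
  refine integral_congr_ae (Eventually.of_forall fun x => ?_)
  simp only [Circle.smul_def, smul_eq_mul, Real.fourierChar_apply, fourierPairing,
    LinearMap.smul_apply, innerₗ_apply_apply]
  congr 2
  rw [real_inner_comm]
  have : (Real.pi : ℂ) ≠ 0 := by exact_mod_cast Real.pi_ne_zero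
  push_cast
  field_simp

theorem continuous_fourierInt {f : E n → ℂ} (hf : Integrable f) : Continuous (fourierInt f) := by
  rw [fourierInt_eq_fourierIntegral]
  exact VectorFourier.fourierIntegral_continuous Real.continuous_fourierChar
    continuous_fourierPairing hf

theorem norm_fourierInt_le (f : E n → ℂ) (ξ : E n) : ‖fourierInt f ξ‖ ≤ ∫ x, ‖f x‖ := by
  rw [fourierInt_eq_fourierIntegral]
  exact VectorFourier.norm_fourierIntegral_le_integral_norm _ _ _ _ _

theorem integral_fourierInt_mul {f g : E n → ℂ} (hf : Integrable f) (hg : Integrable g) :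
    ∫ ξ, fourierInt f ξ * g ξ = ∫ x, f x * fourierInt g x := by
  have := VectorFourier.integral_fourierIntegral_smul_eq_flip (L := fourierPairing n)
    Real.continuous_fourierChar continuous_fourierPairing hf hg
  rw [fourierPairing_flip, ← fourierInt_eq_fourierIntegral, ← fourierInt_eq_fourierIntegral] at this
  exact this

/-- Dilation by a nonzero real number as a continuous linear equivalence. -/
def dilation (n : ℕ) (c : ℝ) (hc : c ≠ 0) : E n ≃L[ℝ] E n :=
  (LinearEquiv.smulOfNeZero ℝ (E n) c hc).toContinuousLinearEquiv

theorem two_pi_ne_zero : (2 * Real.pi) ≠ 0 := by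
  have := Real.pi_ne_zero
  positivity

/-- A Schwartz function precomposed with a dilation. -/
def dilate (c : ℝ) (hc : c ≠ 0) (φ : 𝓢(E n, ℂ)) : 𝓢(E n, ℂ) :=
  SchwartzMap.compCLMOfContinuousLinearEquiv ℂ (dilation n c hc) φ

theorem dilate_apply (c : ℝ) (hc : c ≠ 0) (φ : 𝓢(E n, ℂ)) (x : E n) :
    dilate c hc φ x = φ (c • x) := rfl

/-- The Fourier transform `fourierInt φ` of a Schwartz function, as a Schwartz function. -/
def schwartzFourier (φ : 𝓢(E n, ℂ)) : 𝓢(E n, ℂ) :=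
  dilate (2 * Real.pi)⁻¹ (inv_ne_zero two_pi_ne_zero) (𝓕 φ)

theorem schwartzFourier_apply (φ : 𝓢(E n, ℂ)) (ξ : E n) :
    schwartzFourier φ ξ = fourierInt φ ξ := by
  rw [schwartzFourier, dilate_apply, fourierInt_eq_fourier, SchwartzMap.fourier_coe]

theorem isFourierTransform_of_integrable {f : E n → ℂ} (hf : Integrable f) :
    IsFourierTransform f (fourierInt f) := by
  intro φ
  refine ⟨?_, ?_, integral_fourierInt_mul hf φ.integrable⟩
  · exact Integrable.bdd_mul (c := ∫ x, ‖f x‖) φ.integrable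
      (continuous_fourierInt hf).aestronglyMeasurable (Eventually.of_forall (norm_fourierInt_le f))
  · exact Integrable.mul_bdd (c := ∫ x, ‖φ x‖) hf
      (continuous_fourierInt φ.integrable).aestronglyMeasurable
      (Eventually.of_forall (norm_fourierInt_le φ))

theorem IsFourierTransform.add {f f' g g' : E n → ℂ} (h : IsFourierTransform f g)
    (h' : IsFourierTransform f' g') :
    IsFourierTransform (fun x => f x + f' x) (fun ξ => g ξ + g' ξ) := by
  intro φ
  obtain ⟨a, b, c⟩ := h φ
  obtain ⟨a', b', c'⟩ := h' φ
  simp only [add_mul]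
  exact ⟨a.add a', b.add b', by rw [integral_add a a', integral_add b b', c, c']⟩

theorem IsFourierTransform.congr_ae {f f' g g' : E n → ℂ} (h : IsFourierTransform f g)
    (hf : f =ᵐ[volume] f') (hg : g =ᵐ[volume] g') : IsFourierTransform f' g' := by
  intro φ
  obtain ⟨a, b, c⟩ := h φ
  have e1 : (fun ξ => g ξ * φ ξ) =ᵐ[volume] fun ξ => g' ξ * φ ξ := hg.mono fun ξ hξ => by
    simp only [hξ]
  have e2 : (fun x => f x * fourierInt φ x) =ᵐ[volume] fun x => f' x * fourierInt φ x :=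
    hf.mono fun ξ hξ => by simp only [hξ]
  exact ⟨a.congr e1, b.congr e2, by rw [← integral_congr_ae e1, ← integral_congr_ae e2, c]⟩

/-- Test against a smooth bump equal to `1` on a unit ball about the given point. -/
theorem locallyIntegrable_of_integrable_mul_schwartz {g : E n → ℂ}
    (hg : ∀ φ : 𝓢(E n, ℂ), Integrable fun ξ => g ξ * φ ξ) : LocallyIntegrable g := by
  intro x
  let b : ContDiffBump x := ⟨1, 2, one_pos, one_lt_two⟩
  have hsupp : HasCompactSupport fun y => (b y : ℂ) :=
    b.hasCompactSupport.comp_left (g := fun r : ℝ => (r : ℂ)) rfl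
  have hsm : ContDiff ℝ (⊤ : ℕ∞) fun y => (b y : ℂ) := Complex.ofRealCLM.contDiff.comp b.contDiff
  refine ⟨Metric.closedBall x 1, Metric.closedBall_mem_nhds x one_pos, ?_⟩
  have h1 : IntegrableOn (fun ξ => g ξ * (hsupp.toSchwartzMap hsm) ξ) (Metric.closedBall x 1) :=
    (hg _).integrableOn
  refine h1.congr_fun (fun y hy => ?_) Metric.isClosed_closedBall.measurableSet
  have : b y = 1 := b.one_of_mem_closedBall hy
  change g y * (b y : ℂ) = g y
  rw [this]
  simp

theorem IsFourierTransform.ae_eq {f g g' : E n → ℂ} (h : IsFourierTransform f g)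
    (h' : IsFourierTransform f g') : g =ᵐ[volume] g' := by
  refine ae_eq_of_integral_contDiff_smul_eq
    (locallyIntegrable_of_integrable_mul_schwartz fun φ => (h φ).1)
    (locallyIntegrable_of_integrable_mul_schwartz fun φ => (h' φ).1) fun k hk hks => ?_
  have hsupp : HasCompactSupport fun y => (k y : ℂ) :=
    hks.comp_left (g := fun r : ℝ => (r : ℂ)) rfl
  have hsm : ContDiff ℝ (⊤ : ℕ∞) fun y => (k y : ℂ) := Complex.ofRealCLM.contDiff.comp hk
  have e := (h (hsupp.toSchwartzMap hsm)).2.2.trans (h' (hsupp.toSchwartzMap hsm)).2.2.symm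
  have conv : ∀ u : E n → ℂ, ∫ x, k x • u x = ∫ x, u x * (hsupp.toSchwartzMap hsm) x := fun u => by
    refine integral_congr_ae (Eventually.of_forall fun x => ?_)
    change k x • u x = u x * (k x : ℂ)
    rw [Complex.real_smul, mul_comm]
  rw [conv, conv, e]

/-- Scaling of the `L²` norm under dilations. -/
theorem exists_eLpNorm_dilate_le (n : ℕ) (c : ℝ) (hc : c ≠ 0) :
    ∃ C : ℝ≥0, ∀ f : E n → ℂ, MemLp f 2 volume →
      MemLp (fun x => f (c • x)) 2 volume ∧
        eLpNorm (fun x => f (c • x)) 2 volume ≤ C * eLpNorm f 2 volume := by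
  set k : ℝ≥0∞ := ENNReal.ofReal |(c ^ Module.finrank ℝ (E n))⁻¹| with hk
  have hmap : Measure.map (fun x : E n => c • x) volume = k • volume :=
    Measure.map_addHaar_smul volume hc
  have hme : MeasurableEmbedding (fun x : E n => c • x) :=
    (Homeomorph.smulOfNeZero c hc).measurableEmbedding
  have hfin : k ^ (1 / (2 : ℝ≥0∞).toReal) ≠ ⊤ :=
    ENNReal.rpow_ne_top_of_nonneg (by positivity) ENNReal.ofReal_ne_top
  have hnorm : ∀ f : E n → ℂ, eLpNorm (fun x => f (c • x)) 2 volume =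
      k ^ (1 / (2 : ℝ≥0∞).toReal) * eLpNorm f 2 volume := fun f => by
    have h1 : eLpNorm f 2 (Measure.map (fun x : E n => c • x) volume) =
        eLpNorm (fun x => f (c • x)) 2 volume := hme.eLpNorm_map_measure
    rw [← h1, hmap, eLpNorm_smul_measure_of_ne_top (by norm_num), smul_eq_mul]
    simp
  refine ⟨(k ^ (1 / (2 : ℝ≥0∞).toReal)).toNNReal, fun f hf => ?_⟩
  rw [ENNReal.coe_toNNReal hfin]
  refine ⟨⟨?_, ?_⟩, (hnorm f).le⟩
  · refine hf.1.comp_quasiMeasurePreserving ⟨hme.measurable, ?_⟩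
    rw [hmap]
    exact Measure.smul_absolutelyContinuous
  · rw [hnorm f]
    exact ENNReal.mul_lt_top (lt_top_iff_ne_top.2 hfin) hf.2

theorem fourier_dilate (φ : 𝓢(E n, ℂ)) (x : E n) :
    (𝓕 (dilate (2 * Real.pi) two_pi_ne_zero φ)) x =
      (|((2 * Real.pi) ^ n)⁻¹| : ℝ) * fourierInt φ x := by
  rw [SchwartzMap.fourier_coe, fourierInt_eq_fourier, Real.fourier_eq', Real.fourier_eq']
  have := Measure.integral_comp_smul (volume : Measure (E n)) (fun v : E n =>
    Complex.exp (↑(-2 * Real.pi * inner ℝ v ((2 * Real.pi)⁻¹ • x)) * Complex.I) • φ v) (2 * Real.pi)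
  rw [finrank_euclideanSpace, Fintype.card_fin, Complex.real_smul] at this
  rw [← this]
  refine integral_congr_ae (Eventually.of_forall fun v => ?_)
  simp only [dilate_apply]
  congr 4
  rw [inner_smul_left, inner_smul_right]
  have := Real.pi_ne_zero
  simp
  field_simp

/-- The Fourier transform of a function in `L²`, rescaled. -/
theorem isFourierTransform_Lp (f : Lp ℂ 2 (volume : Measure (E n))) :
    IsFourierTransform f (fun ξ => (𝓕 f : Lp ℂ 2 (volume : Measure (E n))) ((2 * Real.pi)⁻¹ • ξ)) := by
  intro φ
  obtain ⟨_, hd⟩ := exists_eLpNorm_dilate_le n (2 * Real.pi)⁻¹ (inv_ne_zero two_pi_ne_zero)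
  have m1 := (hd _ (Lp.memLp (𝓕 f : Lp ℂ 2 (volume : Measure (E n))))).1
  have hi2 : Integrable fun x => f x * fourierInt φ x := by
    have := (Lp.memLp f).integrable_mul (q := 2) ((schwartzFourier φ).memLp 2)
    refine this.congr (Eventually.of_forall fun x => ?_)
    simp only [Pi.mul_apply, schwartzFourier_apply]
  refine ⟨m1.integrable_mul (q := 2) (φ.memLp 2), hi2, ?_⟩
  -- The identity between the `L²` and distributional transforms is evaluated at a dilate of `φ`, so
  -- that both normalizations produce the same Jacobian, which then cancels.
  have h1 := congrArg (fun T => T (dilate (2 * Real.pi) two_pi_ne_zero φ))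
    (Lp.fourier_toTemperedDistribution_eq f)
  simp only [TemperedDistribution.fourier_apply, Lp.toTemperedDistribution_apply,
    smul_eq_mul] at h1
  have h2 := Measure.integral_comp_smul (volume : Measure (E n)) (fun ξ : E n =>
    (𝓕 f : Lp ℂ 2 (volume : Measure (E n))) ((2 * Real.pi)⁻¹ • ξ) * φ ξ) (2 * Real.pi)
  have hne := Real.pi_ne_zero
  have h3 : ∀ ξ : E n, (2 * Real.pi)⁻¹ • (2 * Real.pi) • ξ = ξ := fun ξ => by
    rw [smul_smul, inv_mul_cancel₀ two_pi_ne_zero, one_smul]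
  simp only [h3] at h2
  have h4 : ∫ x, (dilate (2 * Real.pi) two_pi_ne_zero φ) x * (𝓕 f : Lp ℂ 2 (volume : Measure (E n))) x =
      ∫ x, (𝓕 f : Lp ℂ 2 (volume : Measure (E n))) x * φ ((2 * Real.pi) • x) := by
    refine integral_congr_ae (Eventually.of_forall fun x => ?_)
    simp only [dilate_apply, mul_comm]
  rw [h4, h2] at h1
  simp only [fourier_dilate] at h1
  rw [finrank_euclideanSpace, Fintype.card_fin, Complex.real_smul] at h1
  have h5 : ∫ x, ((|((2 * Real.pi) ^ n)⁻¹| : ℝ) : ℂ) * fourierInt φ x * f x =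
      ((|((2 * Real.pi) ^ n)⁻¹| : ℝ) : ℂ) * ∫ x, f x * fourierInt φ x := by
    rw [← integral_const_mul]
    refine integral_congr_ae (Eventually.of_forall fun x => ?_)
    simp only
    ring
  rw [h5] at h1
  have h6 : ((|((2 * Real.pi) ^ n)⁻¹| : ℝ) : ℂ) ≠ 0 := by
    have : |((2 * Real.pi) ^ n)⁻¹| ≠ 0 := by positivity
    exact_mod_cast this
  exact (mul_left_cancel₀ h6 h1).symm

theorem exists_isFourierTransform_of_memLp_two (n : ℕ) :
    ∃ C : ℝ≥0, ∀ f : E n → ℂ, MemLp f 2 volume → ∃ g : E n → ℂ, IsFourierTransform f g ∧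
      MemLp g 2 volume ∧ eLpNorm g 2 volume ≤ C * eLpNorm f 2 volume := by
  obtain ⟨C, hC⟩ := exists_eLpNorm_dilate_le n (2 * Real.pi)⁻¹ (inv_ne_zero two_pi_ne_zero)
  refine ⟨C, fun f hf => ?_⟩
  set F : Lp ℂ 2 (volume : Measure (E n)) := hf.toLp f with hF
  obtain ⟨h1, h2⟩ := hC _ (Lp.memLp (𝓕 F : Lp ℂ 2 (volume : Measure (E n))))
  refine ⟨_, (isFourierTransform_Lp F).congr_ae hf.coeFn_toLp ae_eq_rfl, h1, h2.trans (le_of_eq ?_)⟩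
  congr 1
  have e1 := Lp.enorm_def (𝓕 F : Lp ℂ 2 (volume : Measure (E n)))
  rw [← e1, ← eLpNorm_congr_ae hf.coeFn_toLp, ← Lp.enorm_def, ← ofReal_norm, ← ofReal_norm,
    Lp.norm_fourier_eq]

/-- The surjective half of Plancherel; it produces `S^{-α} f` once the weighted transform is known
to be in `L²`. -/
theorem exists_isFourierTransform_inverse (n : ℕ) :
    ∃ C : ℝ≥0, ∀ v : E n → ℂ, MemLp v 2 volume → ∃ u : E n → ℂ, IsFourierTransform u v ∧
      MemLp u 2 volume ∧ eLpNorm u 2 volume ≤ C * eLpNorm v 2 volume := by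
  obtain ⟨C, hC⟩ := exists_eLpNorm_dilate_le n (2 * Real.pi) two_pi_ne_zero
  refine ⟨C, fun v hv => ?_⟩
  obtain ⟨h1, h2⟩ := hC v hv
  set V : Lp ℂ 2 (volume : Measure (E n)) := h1.toLp _ with hV
  have hcoe : (V : E n → ℂ) =ᵐ[volume] fun x => v ((2 * Real.pi) • x) := h1.coeFn_toLp
  set U : Lp ℂ 2 (volume : Measure (E n)) := 𝓕⁻ V with hU
  have hFU : 𝓕 U = V := by rw [hU, FourierTransform.fourier_fourierInv_eq]
  refine ⟨U, ?_, Lp.memLp U, ?_⟩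
  · refine (isFourierTransform_Lp U).congr_ae ae_eq_rfl ?_
    rw [hFU]
    have hq : Measure.QuasiMeasurePreserving (fun x : E n => (2 * Real.pi)⁻¹ • x) volume volume := by
      refine ⟨measurable_const_smul _, ?_⟩
      rw [Measure.map_addHaar_smul volume (inv_ne_zero two_pi_ne_zero)]
      exact Measure.smul_absolutelyContinuous
    filter_upwards [hq.ae hcoe] with x hx
    rw [hx, smul_smul, mul_inv_cancel₀ two_pi_ne_zero, one_smul]
  · refine le_trans (le_of_eq ?_) h2
    rw [← eLpNorm_congr_ae hcoe, ← Lp.enorm_def, ← Lp.enorm_def, ← ofReal_norm, ← ofReal_norm,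
      ← Lp.norm_fourier_eq U, hFU]

theorem exists_eLpNorm_fourierInt_le (n : ℕ) :
    ∃ C : ℝ≥0, ∀ f : E n → ℂ, Integrable f → MemLp f 2 volume →
      MemLp (fourierInt f) 2 volume ∧
        eLpNorm (fourierInt f) 2 volume ≤ C * eLpNorm f 2 volume := by
  obtain ⟨C, hC⟩ := exists_isFourierTransform_of_memLp_two n
  refine ⟨C, fun f h1 h2 => ?_⟩
  obtain ⟨g, hg, hg2, hle⟩ := hC f h2
  have := hg.ae_eq (isFourierTransform_of_integrable h1)
  exact ⟨(memLp_congr_ae this).1 hg2, by rwa [← eLpNorm_congr_ae this]⟩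

end FourierTheory

end BochnerRiesz

namespace BochnerRiesz

/-! ### The quadratic form on the Fourier side and its convolution kernel -/

noncomputable section Form

open scoped ComplexConjugate

variable {n : ℕ}

theorem norm_halfMultiplier_le (h : ℝ → ℝ) (s : ℝ) :
    ‖halfMultiplier h s‖ ≤ ∫ t in Set.Ioi (0 : ℝ), |h t| := by
  refine (norm_integral_le_integral_norm _).trans (le_of_eq ?_)
  refine integral_congr_ae (Eventually.of_forall fun t => ?_)
  simp only [norm_mul, norm_cexp_I_mul_ofReal, mul_one, Complex.norm_real, Real.norm_eq_abs]

theorem continuous_halfMultiplier {h : ℝ → ℝ} (hi : IntegrableOn h (Set.Ioi 0)) :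
    Continuous (halfMultiplier h) := by
  refine continuous_of_dominated (bound := fun t => |h t|) (fun s => ?_) (fun s => ?_) hi.abs ?_
  · exact (IntegrableOn.mul_bounded hi (continuous_cexp_mul s)
      fun t => (norm_cexp_I_mul_ofReal _).le).aestronglyMeasurable
  · refine Eventually.of_forall fun t => ?_
    rw [norm_mul, norm_cexp_I_mul_ofReal, mul_one, Complex.norm_real, Real.norm_eq_abs]
  · exact Eventually.of_forall fun t => by fun_prop

theorem integrable_exp_neg_norm_sq : Integrable fun ξ : E n => Real.exp (-‖ξ‖ ^ 2) := by
  have := GaussianFourier.integrable_cexp_neg_mul_sq_norm_add (V := E n) (b := 1) (by simp) 0 0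
  refine this.norm.congr (Eventually.of_forall fun ξ => ?_)
  simp [Complex.norm_exp, ← Complex.ofReal_pow]

/-- The symbol of the quadratic form attached to `h`. -/
def formSymbol (n : ℕ) (h : ℝ → ℝ) (ξ : E n) : ℂ :=
  halfMultiplier h (1 - ‖ξ‖ ^ 2) * (Real.exp (-‖ξ‖ ^ 2) : ℂ)

theorem continuous_formSymbol {h : ℝ → ℝ} (hi : IntegrableOn h (Set.Ioi 0)) :
    Continuous (formSymbol n h) :=
  ((continuous_halfMultiplier hi).comp (by fun_prop)).mul (by fun_prop)

theorem norm_formSymbol_le' (h : ℝ → ℝ) (ξ : E n) :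
    ‖formSymbol n h ξ‖ ≤ (∫ t in Set.Ioi (0 : ℝ), |h t|) * Real.exp (-‖ξ‖ ^ 2) := by
  rw [formSymbol, norm_mul, Complex.norm_real, Real.norm_eq_abs, abs_of_pos (Real.exp_pos _)]
  exact mul_le_mul_of_nonneg_right (norm_halfMultiplier_le h _) (Real.exp_pos _).le

theorem norm_formSymbol_le (h : ℝ → ℝ) (ξ : E n) :
    ‖formSymbol n h ξ‖ ≤ ‖halfMultiplier h (1 - ‖ξ‖ ^ 2)‖ := by
  rw [formSymbol, norm_mul, Complex.norm_real, Real.norm_eq_abs, abs_of_pos (Real.exp_pos _)]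
  refine mul_le_of_le_one_right (norm_nonneg _) (Real.exp_le_one_iff.2 ?_)
  have := sq_nonneg ‖ξ‖
  linarith

theorem integrable_formSymbol {h : ℝ → ℝ} (hi : IntegrableOn h (Set.Ioi 0)) :
    Integrable (formSymbol n h) :=
  (integrable_exp_neg_norm_sq.const_mul _).mono' (continuous_formSymbol hi).aestronglyMeasurable
    (Eventually.of_forall (norm_formSymbol_le' h))

/-- The function is `e^{it}` times the complex Gaussian `e^{-(1+it)|ξ|²}`. -/
theorem fourierInt_gauss (t : ℝ) (x : E n) :
    fourierInt (fun ξ : E n => Complex.exp (Complex.I * ((t * (1 - ‖ξ‖ ^ 2) : ℝ) : ℂ)) *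
      (Real.exp (-‖ξ‖ ^ 2) : ℂ)) x = gaussKernel n t ‖x‖ := by
  have hb : 0 < (1 + Complex.I * (t : ℂ)).re := by simp
  have h := GaussianFourier.integral_cexp_neg_mul_sq_norm_add hb (-Complex.I) x
  rw [finrank_euclideanSpace, Fintype.card_fin] at h
  have h2 : (-Complex.I) ^ 2 = -1 := by rw [neg_sq, Complex.I_sq]
  rw [gaussKernel, mul_assoc, ← neg_one_mul ((‖x‖ : ℂ) ^ 2), ← h2, ← h, ← integral_const_mul,
    fourierInt]
  refine integral_congr_ae (Eventually.of_forall fun ξ => ?_)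
  simp only
  rw [Complex.ofReal_exp, ← Complex.exp_add, ← Complex.exp_add, ← Complex.exp_add]
  congr 1
  push_cast
  ring

/-- Fubini's theorem; the Gaussian factor in `ξ` and the integrability of `h` give absolute
convergence. -/
theorem fourierInt_formSymbol {h : ℝ → ℝ} (hi : IntegrableOn h (Set.Ioi 0)) (x : E n) :
    fourierInt (formSymbol n h) x = halfKernel n h ‖x‖ := by
  have e1 : ∀ ξ : E n, Complex.exp (-Complex.I * ((inner ℝ x ξ : ℝ) : ℂ)) * formSymbol n h ξ =
      ∫ t in Set.Ioi (0 : ℝ), Complex.exp (-Complex.I * ((inner ℝ x ξ : ℝ) : ℂ)) *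
        ((h t : ℂ) * (Complex.exp (Complex.I * ((t * (1 - ‖ξ‖ ^ 2) : ℝ) : ℂ)) *
          (Real.exp (-‖ξ‖ ^ 2) : ℂ))) := by
    intro ξ
    rw [integral_const_mul, formSymbol, halfMultiplier, ← integral_mul_const]
    simp only [mul_assoc]
  have hint : Integrable (Function.uncurry fun (ξ : E n) (t : ℝ) =>
      Complex.exp (-Complex.I * ((inner ℝ x ξ : ℝ) : ℂ)) *
        ((h t : ℂ) * (Complex.exp (Complex.I * ((t * (1 - ‖ξ‖ ^ 2) : ℝ) : ℂ)) *
          (Real.exp (-‖ξ‖ ^ 2) : ℂ)))) (volume.prod (volume.restrict (Set.Ioi 0))) := by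
    have i1 : Integrable (fun z : E n × ℝ => ((Real.exp (-‖z.1‖ ^ 2) : ℝ) : ℂ) * (h z.2 : ℂ))
        (volume.prod (volume.restrict (Set.Ioi 0))) :=
      Integrable.mul_prod (f := fun ξ : E n => ((Real.exp (-‖ξ‖ ^ 2) : ℝ) : ℂ))
        integrable_exp_neg_norm_sq.ofReal (Integrable.ofReal hi)
    have c1 : Continuous fun z : E n × ℝ => Complex.exp (-Complex.I * ((inner ℝ x z.1 : ℝ) : ℂ)) *
        Complex.exp (Complex.I * ((z.2 * (1 - ‖z.1‖ ^ 2) : ℝ) : ℂ)) := by fun_prop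
    refine (Integrable.bdd_mul (c := 1) i1 c1.aestronglyMeasurable
      (Eventually.of_forall fun z => ?_)).congr (Eventually.of_forall fun z => ?_)
    · rw [norm_mul, norm_cexp_I_mul_ofReal, mul_one]
      have : -Complex.I * ((inner ℝ x z.1 : ℝ) : ℂ) = Complex.I * ((-inner ℝ x z.1 : ℝ) : ℂ) := by
        push_cast
        ring
      rw [this, norm_cexp_I_mul_ofReal]
    · simp only [Function.uncurry]
      ring
  rw [fourierInt]
  simp only [e1]
  rw [integral_integral_swap hint, halfKernel]
  refine integral_congr_ae (Eventually.of_forall fun t => ?_)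
  simp only
  rw [← fourierInt_gauss, fourierInt, ← integral_const_mul]
  refine integral_congr_ae (Eventually.of_forall fun ξ => ?_)
  simp only
  ring

/-- A sesquilinear form on the Fourier side. -/
def fourierForm (W f g : E n → ℂ) : ℂ := ∫ ξ, W ξ * (fourierInt f ξ * conj (fourierInt g ξ))

theorem integrable_fourierForm {W f g : E n → ℂ} (hW : Integrable W) (hf : Integrable f)
    (hg : Integrable g) :
    Integrable fun ξ => W ξ * (fourierInt f ξ * conj (fourierInt g ξ)) := by
  refine Integrable.mul_bdd (c := (∫ x, ‖f x‖) * ∫ x, ‖g x‖) hW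
    ((continuous_fourierInt hf).mul
      (Complex.continuous_conj.comp (continuous_fourierInt hg))).aestronglyMeasurable
    (Eventually.of_forall fun ξ => ?_)
  rw [norm_mul, RCLike.norm_conj]
  exact mul_le_mul (norm_fourierInt_le f ξ) (norm_fourierInt_le g ξ) (norm_nonneg _)
    (integral_nonneg fun _ => norm_nonneg _)

/-- A bound for the Fourier transform of the symbol gives an `L¹` bound for the form. -/
theorem norm_fourierForm_le {W f g : E n → ℂ} {M : ℝ} (hW : Integrable W) (hf : Integrable f)
    (hg : Integrable g) (hM : ∀ x, ‖fourierInt W x‖ ≤ M) :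
    ‖fourierForm W f g‖ ≤ M * ((∫ x, ‖f x‖) * ∫ x, ‖g x‖) := by
  have hexp : ∀ x ξ : E n, ‖Complex.exp (-Complex.I * ((inner ℝ x ξ : ℝ) : ℂ))‖ = 1 := fun x ξ => by
    have : -Complex.I * ((inner ℝ x ξ : ℝ) : ℂ) = Complex.I * ((-inner ℝ x ξ : ℝ) : ℂ) := by
      push_cast
      ring
    rw [this, norm_cexp_I_mul_ofReal]
  have hM0 : 0 ≤ M := (norm_nonneg _).trans (hM 0)
  have hG : Integrable fun ξ => W ξ * conj (fourierInt g ξ) :=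
    Integrable.mul_bdd (c := ∫ x, ‖g x‖) hW
      (Complex.continuous_conj.comp (continuous_fourierInt hg)).aestronglyMeasurable
      (Eventually.of_forall fun ξ => by
        rw [RCLike.norm_conj]
        exact norm_fourierInt_le g ξ)
  have hGb : ∀ x, ‖fourierInt (fun ξ => W ξ * conj (fourierInt g ξ)) x‖ ≤ M * ∫ y, ‖g y‖ := by
    intro x
    -- Conjugation is moved so that the multiplication formula applies; the transform of `A` at `y`
    -- is the conjugate of that of `W` at `x - y`, exhibiting the form as a convolution form.
    set A : E n → ℂ := fun ξ =>
      conj (Complex.exp (-Complex.I * ((inner ℝ x ξ : ℝ) : ℂ)) * W ξ) with hA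
    have hAi : Integrable A := by
      have : Integrable fun ξ : E n => Complex.exp (-Complex.I * ((inner ℝ x ξ : ℝ) : ℂ)) * W ξ :=
        Integrable.bdd_mul (c := 1) hW (by fun_prop) (Eventually.of_forall fun ξ => (hexp x ξ).le)
      refine this.norm.mono' (Complex.continuous_conj.comp_aestronglyMeasurable
        this.aestronglyMeasurable) (Eventually.of_forall fun ξ => ?_)
      rw [hA]
      simp only [RCLike.norm_conj]
      exact le_rfl
    have h1 : fourierInt (fun ξ => W ξ * conj (fourierInt g ξ)) x =
        conj (∫ ξ, fourierInt g ξ * A ξ) := by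
      rw [← integral_conj, fourierInt]
      refine integral_congr_ae (Eventually.of_forall fun ξ => ?_)
      simp only [hA, map_mul, Complex.conj_conj]
      ring
    have h2 : ∀ y, fourierInt A y = conj (fourierInt W (x - y)) := by
      intro y
      rw [fourierInt, fourierInt, ← integral_conj]
      refine integral_congr_ae (Eventually.of_forall fun ξ => ?_)
      simp only [hA, map_mul, ← Complex.exp_conj, map_neg, Complex.conj_I, Complex.conj_ofReal,
        neg_neg]
      rw [← mul_assoc, ← Complex.exp_add, inner_sub_left]
      congr 2
      push_cast
      ring
    rw [h1, RCLike.norm_conj, integral_fourierInt_mul hg hAi, ← integral_const_mul]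
    refine norm_integral_le_of_norm_le (hg.norm.const_mul M) (Eventually.of_forall fun y => ?_)
    rw [norm_mul, h2, RCLike.norm_conj, mul_comm]
    exact mul_le_mul_of_nonneg_right (hM _) (norm_nonneg _)
  have e : fourierForm W f g = ∫ ξ, fourierInt f ξ * (W ξ * conj (fourierInt g ξ)) := by
    refine integral_congr_ae (Eventually.of_forall fun ξ => ?_)
    simp only
    ring
  rw [e, integral_fourierInt_mul hf hG]
  calc _ ≤ ∫ x, M * (∫ y, ‖g y‖) * ‖f x‖ := by
        refine norm_integral_le_of_norm_le (hf.norm.const_mul _) (Eventually.of_forall fun x => ?_)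
        rw [norm_mul, mul_comm]
        exact mul_le_mul_of_nonneg_right (hGb x) (norm_nonneg _)
    _ = _ := by
        rw [integral_const_mul]
        ring

theorem fourierInt_finset_sum {ι : Type*} (S : Finset ι) {f : ι → E n → ℂ}
    (hf : ∀ i ∈ S, Integrable (f i)) (ξ : E n) :
    fourierInt (fun x => ∑ i ∈ S, f i x) ξ = ∑ i ∈ S, fourierInt (f i) ξ := by
  simp only [fourierInt, Finset.mul_sum]
  refine integral_finsetSum S fun i hi => ?_
  refine Integrable.bdd_mul (c := 1) (hf i hi) (by fun_prop) (Eventually.of_forall fun x => ?_)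
  have : -Complex.I * ((inner ℝ ξ x : ℝ) : ℂ) = Complex.I * ((-inner ℝ ξ x : ℝ) : ℂ) := by
    push_cast
    ring
  rw [this, norm_cexp_I_mul_ofReal]

theorem fourierForm_finset_sum {ι : Type*} (S : Finset ι) {W : E n → ℂ} {f : ι → E n → ℂ}
    (hW : Integrable W) (hf : ∀ i ∈ S, Integrable (f i)) :
    fourierForm W (fun x => ∑ i ∈ S, f i x) (fun x => ∑ i ∈ S, f i x) =
      ∑ i ∈ S, ∑ j ∈ S, fourierForm W (f i) (f j) := by
  have e : ∀ ξ, W ξ * (fourierInt (fun x => ∑ i ∈ S, f i x) ξ *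
      conj (fourierInt (fun x => ∑ i ∈ S, f i x) ξ)) =
        ∑ i ∈ S, ∑ j ∈ S, W ξ * (fourierInt (f i) ξ * conj (fourierInt (f j) ξ)) := fun ξ => by
    rw [fourierInt_finset_sum S hf, map_sum, Finset.sum_mul_sum, Finset.mul_sum]
    exact Finset.sum_congr rfl fun i _ => Finset.mul_sum _ _ _
  simp only [fourierForm, e]
  rw [integral_finsetSum _ fun i hi => integrable_finsetSum _ fun j hj =>
    integrable_fourierForm hW (hf i hi) (hf j hj)]
  exact Finset.sum_congr rfl fun i hi => integral_finsetSum _ fun j hj =>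
    integrable_fourierForm hW (hf i hi) (hf j hj)

theorem formSymbol_highPart_add_lowPart {h : ℝ → ℝ} (hi : IntegrableOn h (Set.Ioi 0)) (T : ℝ)
    (ξ : E n) :
    formSymbol n h ξ = formSymbol n (lowPart h T) ξ + formSymbol n (highPart h T) ξ := by
  simp only [formSymbol, ← add_mul]
  congr 1
  have b := fun t : ℝ => (norm_cexp_I_mul_ofReal (t * (1 - ‖ξ‖ ^ 2))).le
  simp only [halfMultiplier]
  rw [← integral_add
    (IntegrableOn.mul_bounded (IntegrableOn.lowPart T hi) (continuous_cexp_mul _) b)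
    (IntegrableOn.mul_bounded (IntegrableOn.highPart T hi) (continuous_cexp_mul _) b)]
  refine integral_congr_ae (Eventually.of_forall fun t => ?_)
  simp only [highPart]
  push_cast
  ring

theorem norm_fourierForm_formSymbol_le {h : ℝ → ℝ} {f g : E n → ℂ} {M : ℝ}
    (hi : IntegrableOn h (Set.Ioi 0)) (hf : Integrable f) (hg : Integrable g)
    (hM : ∀ r, 0 ≤ r → ‖halfKernel n h r‖ ≤ M) :
    ‖fourierForm (formSymbol n h) f g‖ ≤ M * ((∫ x, ‖f x‖) * ∫ x, ‖g x‖) :=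
  norm_fourierForm_le (integrable_formSymbol hi) hf hg fun x => by
    rw [fourierInt_formSymbol hi]
    exact hM _ (norm_nonneg _)

end Form

end BochnerRiesz

namespace BochnerRiesz

/-! ### Lattice sums and Schur's test -/

noncomputable section Schur

theorem summable_exp_neg_mul_abs_int {d : ℝ} (hd : 0 < d) :
    Summable fun j : ℤ => Real.exp (-(d * |(j : ℝ)|)) := by
  have h : Summable fun j : ℕ => Real.exp (-(d * (j : ℝ))) := by
    have := Real.summable_exp_nat_mul_iff.2 (neg_lt_zero.2 hd)
    refine this.congr fun j => ?_
    congr 1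
    ring
  refine Summable.of_nat_of_neg (h.congr fun j => ?_) (h.congr fun j => ?_) <;> simp

/-- Sums of two-sided exponentially decaying functions over a translated lattice. -/
theorem exists_sum_exp_neg_abs_le {d : ℝ} (hd : 0 < d) :
    ∃ C : ℝ, 0 ≤ C ∧ ∀ (S : Finset ℤ) (c : ℝ),
      ∑ k ∈ S, Real.exp (-|d * (k : ℝ) - c|) ≤ C := by
  have hsum := summable_exp_neg_mul_abs_int hd
  refine ⟨Real.exp d * ∑' j : ℤ, Real.exp (-(d * |(j : ℝ)|)), by positivity, fun S c => ?_⟩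
  set k0 : ℤ := ⌊c / d⌋ with hk0
  have h1 : (k0 : ℝ) ≤ c / d := Int.floor_le _
  have h2 : c / d < k0 + 1 := Int.lt_floor_add_one _
  have hterm : ∀ k : ℤ, Real.exp (-|d * (k : ℝ) - c|) ≤
      Real.exp d * Real.exp (-(d * |((k - k0 : ℤ) : ℝ)|)) := by
    intro k
    rw [← Real.exp_add]
    refine Real.exp_le_exp.2 ?_
    have e : d * (k : ℝ) - c = d * ((k : ℝ) - c / d) := by
      rw [mul_sub, mul_div_cancel₀ _ hd.ne']
    rw [e, abs_mul, abs_of_pos hd]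
    push_cast
    have h3 : |(k : ℝ) - k0| ≤ |(k : ℝ) - c / d| + 1 := by
      have : (k : ℝ) - k0 = (k - c / d) + (c / d - k0) := by ring
      rw [this]
      refine (abs_add_le _ _).trans (add_le_add le_rfl ?_)
      rw [abs_of_nonneg (by linarith)]
      linarith
    nlinarith
  have hshift : Summable fun k : ℤ => Real.exp (-(d * |((k - k0 : ℤ) : ℝ)|)) :=
    ((Equiv.subRight k0).summable_iff (f := fun j : ℤ => Real.exp (-(d * |(j : ℝ)|)))).2 hsum
  have htsum : ∑' k : ℤ, Real.exp (-(d * |((k - k0 : ℤ) : ℝ)|)) =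
      ∑' j : ℤ, Real.exp (-(d * |(j : ℝ)|)) :=
    (Equiv.subRight k0).tsum_eq fun j : ℤ => Real.exp (-(d * |(j : ℝ)|))
  calc _ ≤ ∑ k ∈ S, Real.exp d * Real.exp (-(d * |((k - k0 : ℤ) : ℝ)|)) :=
        Finset.sum_le_sum fun k _ => hterm k
    _ = Real.exp d * ∑ k ∈ S, Real.exp (-(d * |((k - k0 : ℤ) : ℝ)|)) := by rw [Finset.mul_sum]
    _ ≤ _ := by
        refine mul_le_mul_of_nonneg_left ?_ (Real.exp_pos _).le
        rw [← htsum]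
        exact hshift.sum_le_tsum S fun _ _ => (Real.exp_pos _).le

theorem min_exp_inv (u : ℝ) : min (Real.exp u) (Real.exp u)⁻¹ = Real.exp (-|u|) := by
  rw [← Real.exp_neg]
  rcases le_total 0 u with h | h
  · rw [abs_of_nonneg h, min_eq_right (Real.exp_le_exp.2 (by linarith))]
  · rw [abs_of_nonpos h, neg_neg, min_eq_left (Real.exp_le_exp.2 (by linarith))]

/-- On a logarithmic scale the terms decay exponentially on both sides of a centre determined by
`y`; moving the centre costs only a constant. -/
theorem exists_sum_min_inv_le {δ : ℝ} (hδ : 0 < δ) :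
    ∃ C : ℝ, 0 ≤ C ∧ ∀ (S : Finset ℤ) (y : ℝ), 0 ≤ y →
      ∑ k ∈ S, min ((2 : ℝ) ^ (-(δ * k)) * y) ((2 : ℝ) ^ (-(δ * k)) * y)⁻¹ ≤ C := by
  have hl : 0 < Real.log 2 := Real.log_pos one_lt_two
  obtain ⟨C, hC, h⟩ := exists_sum_exp_neg_abs_le (d := Real.log 2 * δ) (by positivity)
  refine ⟨C, hC, fun S y hy => ?_⟩
  -- At `y = 0` every term is `0`, because `0⁻¹ = 0`.
  rcases hy.eq_or_lt with rfl | hy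
  · simpa using hC
  refine le_trans (le_of_eq (Finset.sum_congr rfl fun k _ => ?_)) (h S (Real.log y))
  have e : (2 : ℝ) ^ (-(δ * k)) * y = Real.exp (-(Real.log 2 * δ * k - Real.log y)) := by
    rw [Real.rpow_def_of_pos two_pos]
    nth_rewrite 1 [← Real.exp_log hy]
    rw [← Real.exp_add]
    congr 1
    ring
  rw [e, min_exp_inv, abs_neg]

/-- Since the matrix depends only on `k + l`, each row sum is a sum of `κ` over a translate of `S`;
then `2 x_k x_l ≤ x_k² + x_l²`. -/
theorem schur_sum_le {κ : ℤ → ℝ} {C : ℝ} (hκ : ∀ k, 0 ≤ κ k)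
    (hC : ∀ S : Finset ℤ, ∑ k ∈ S, κ k ≤ C) (S : Finset ℤ) (x : ℤ → ℝ) :
    ∑ k ∈ S, ∑ l ∈ S, κ (k + l) * (x k * x l) ≤ C * ∑ k ∈ S, x k ^ 2 := by
  have hrow : ∀ k, ∑ l ∈ S, κ (k + l) ≤ C := fun k => by
    have := hC (S.map (addLeftEmbedding k))
    simpa using this
  have h1 : ∑ k ∈ S, ∑ l ∈ S, κ (k + l) * x k ^ 2 ≤ C * ∑ k ∈ S, x k ^ 2 := by
    rw [Finset.mul_sum]
    refine Finset.sum_le_sum fun k _ => ?_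
    rw [← Finset.sum_mul]
    exact mul_le_mul_of_nonneg_right (hrow k) (sq_nonneg _)
  have h2 : ∑ k ∈ S, ∑ l ∈ S, κ (k + l) * x l ^ 2 ≤ C * ∑ k ∈ S, x k ^ 2 := by
    rw [Finset.sum_comm]
    simpa only [add_comm] using h1
  have h3 : ∑ k ∈ S, ∑ l ∈ S, κ (k + l) * (x k * x l) ≤
      ∑ k ∈ S, ∑ l ∈ S, (κ (k + l) * x k ^ 2 + κ (k + l) * x l ^ 2) / 2 := by
    refine Finset.sum_le_sum fun k _ => Finset.sum_le_sum fun l _ => ?_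
    nlinarith [mul_nonneg (hκ (k + l)) (sq_nonneg (x k - x l))]
  simp only [add_div, Finset.sum_add_distrib, ← Finset.sum_div] at h3
  linarith

end Schur

/-! ### The form on a pair of functions at a given scale -/

noncomputable section PairBound

variable {n : ℕ}

theorem integral_norm_sq_eq_of_memLp {f : E n → ℂ} (hf : MemLp f 2 volume) :
    ∫ x, ‖f x‖ ^ 2 = (eLpNorm f 2 volume).toReal ^ 2 := by
  rw [hf.eLpNorm_eq_integral_rpow_norm (by norm_num) (by norm_num)]
  simp only [ENNReal.toReal_ofNat, Real.rpow_ofNat]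
  have h0 : 0 ≤ ∫ x, ‖f x‖ ^ 2 := integral_nonneg fun _ => by positivity
  rw [ENNReal.toReal_ofReal (by positivity), ← Real.rpow_natCast, ← Real.rpow_mul h0]
  norm_num

theorem exists_integral_fourierInt_sq_le (n : ℕ) :
    ∃ C : ℝ, 0 ≤ C ∧ ∀ f : E n → ℂ, Integrable f → MemLp f 2 volume →
      MemLp (fourierInt f) 2 volume ∧
        ∫ ξ, ‖fourierInt f ξ‖ ^ 2 ≤ C * ∫ x, ‖f x‖ ^ 2 := by
  obtain ⟨C, hC⟩ := exists_eLpNorm_fourierInt_le n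
  refine ⟨(C : ℝ) ^ 2, by positivity, fun f h1 h2 => ?_⟩
  obtain ⟨h3, h4⟩ := hC f h1 h2
  refine ⟨h3, ?_⟩
  rw [integral_norm_sq_eq_of_memLp h3, integral_norm_sq_eq_of_memLp h2, ← mul_pow]
  refine pow_le_pow_left₀ ENNReal.toReal_nonneg ?_ 2
  have := ENNReal.toReal_mono (ENNReal.mul_ne_top ENNReal.coe_ne_top h2.2.ne) h4
  simpa using this

/-- The profile `min(x, 1/x)`. -/
def minInv (x : ℝ) : ℝ := min x x⁻¹

theorem minInv_nonneg {x : ℝ} (hx : 0 ≤ x) : 0 ≤ minInv x := le_min hx (inv_nonneg.2 hx)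

theorem minInv_le_one (x : ℝ) : minInv x ≤ 1 := by
  rcases le_total x 1 with h | h
  · exact (min_le_left _ _).trans h
  · exact (min_le_right _ _).trans (inv_le_one_of_one_le₀ h)

theorem measurable_minInv : Measurable minInv := measurable_id.min measurable_inv

theorem IsSymbol.norm_halfMultiplier_lowPart_le_minInv {h h' : ℝ → ℝ} {γ H T : ℝ} (s : ℝ)
    (hs : IsSymbol h h' γ H) (hγ : 0 < γ) (hT : 0 < T) :
    ‖halfMultiplier (lowPart h T) s‖ ≤ (3 + 1 / γ) * H * T ^ (γ + 1) * minInv (T * |s|) := by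
  have h1 := hs.norm_halfMultiplier_lowPart_le s hγ.le hT
  have h2 := hs.mul_norm_halfMultiplier_lowPart_le s hγ hT
  have hH := hs.nonneg
  have hx : 0 ≤ T * |s| := by positivity
  have hle : 3 * H * T ^ (γ + 1) ≤ (3 + 1 / γ) * H * T ^ (γ + 1) := by
    have : (3 : ℝ) ≤ 3 + 1 / γ := by
      have : 0 < 1 / γ := by positivity
      linarith
    gcongr
  rw [minInv, mul_min_of_nonneg _ _ (by positivity)]
  refine le_min (h1.trans (mul_le_mul_of_nonneg_right hle hx)) ?_
  -- At `T|s| = 0` the right side is `0` by the convention for inverses; the bound still holds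
  -- because the low part has mean zero.
  rcases hx.eq_or_lt with h0 | h0
  · rw [← h0] at h1 ⊢
    simpa using h1
  · rw [← div_eq_mul_inv, le_div_iff₀ h0, mul_comm]
    exact h2

/-- Interpolated bound for the form on a pair of functions, at the scale `T`. -/
theorem exists_fourierForm_pair_bound (n : ℕ) (α a : ℝ) (hα : 1 / 2 < α) (ha : 0 ≤ a)
    (han : a ≤ ((n : ℝ) + 1) / 2 - 2 * α) :
    ∃ C : ℝ, 0 ≤ C ∧ ∀ (h h' : ℝ → ℝ) (H T : ℝ) (f g : E n → ℂ), IsSymbol h h' (2 * α - 1) H →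
      0 < T → Integrable f → Integrable g →
      MemLp (fourierInt f) 2 volume → MemLp (fourierInt g) 2 volume →
      ‖fourierForm (formSymbol n h) f g‖ ≤
        C * H * (T ^ (2 * α) * (∫ ξ, minInv (T * |1 - ‖ξ‖ ^ 2|) *
          (‖fourierInt f ξ‖ * ‖fourierInt g ξ‖)) + T ^ (-a) * ((∫ x, ‖f x‖) * ∫ x, ‖g x‖)) := by
  have hγ : 0 < 2 * α - 1 := by linarith
  have hb : 1 / 2 ≤ (n : ℝ) / 2 - (2 * α - 1) := by linarith
  obtain ⟨C1, hC1, h1⟩ := exists_norm_halfKernel_le n (2 * α - 1) hγ.le hb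
  obtain ⟨C2, hC2, h2⟩ := exists_norm_halfKernel_highPart_le n (2 * α - 1) hγ.le hb
  set C3 : ℝ := 3 + 1 / (2 * α - 1) with hC3
  have hC30 : 0 ≤ C3 := by positivity
  refine ⟨C1 * 2 ^ a + C2 + C3, by positivity, fun h h' H T f g hs hT hf hg hf2 hg2 => ?_⟩
  have hH := hs.nonneg
  set P := (∫ x, ‖f x‖) * ∫ x, ‖g x‖ with hP
  have hP0 : 0 ≤ P := mul_nonneg (integral_nonneg fun _ => norm_nonneg _)
    (integral_nonneg fun _ => norm_nonneg _)
  set J := ∫ ξ, minInv (T * |1 - ‖ξ‖ ^ 2|) * (‖fourierInt f ξ‖ * ‖fourierInt g ξ‖) with hJ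
  have hm0 : ∀ ξ : E n, 0 ≤ minInv (T * |1 - ‖ξ‖ ^ 2|) := fun ξ =>
    minInv_nonneg (by positivity)
  have hJ0 : 0 ≤ J := integral_nonneg fun ξ => mul_nonneg (hm0 ξ) (by positivity)
  have hTa : 0 ≤ T ^ (-a) := by positivity
  have hT2 : 0 ≤ T ^ (2 * α) := by positivity
  have hfg : Integrable fun ξ => ‖fourierInt f ξ‖ * ‖fourierInt g ξ‖ :=
    hf2.norm.integrable_mul (q := 2) hg2.norm
  -- The oscillatory estimates need `T ≥ 2`. For smaller scales the unsplit kernel bound suffices,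
  -- as `T^(-a)` is then at least `2^(-a)`.
  rcases lt_or_ge T 2 with hlt | hge
  · have e1 := norm_fourierForm_formSymbol_le hs.integrableOn hf hg
      fun r hr => h1 h h' H r hr hs
    have e2 : 1 ≤ 2 ^ a * T ^ (-a) := by
      rw [Real.rpow_neg hT.le, ← div_eq_mul_inv, ← Real.div_rpow zero_le_two hT.le]
      exact Real.one_le_rpow ((one_le_div hT).2 hlt.le) ha
    calc _ ≤ C1 * H * P := e1
      _ ≤ C1 * H * P * (2 ^ a * T ^ (-a)) := le_mul_of_one_le_right (by positivity) e2
      _ = C1 * 2 ^ a * H * (0 + T ^ (-a) * P) := by ring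
      _ ≤ (C1 * 2 ^ a + C2 + C3) * H * (T ^ (2 * α) * J + T ^ (-a) * P) := by
          have : 0 ≤ T ^ (2 * α) * J := by positivity
          gcongr
          linarith
  · have hlow := IntegrableOn.lowPart T hs.integrableOn
    have hhigh := IntegrableOn.highPart T hs.integrableOn
    have esplit : fourierForm (formSymbol n h) f g =
        fourierForm (formSymbol n (lowPart h T)) f g +
          fourierForm (formSymbol n (highPart h T)) f g := by
      simp only [fourierForm]
      rw [← integral_add (integrable_fourierForm (integrable_formSymbol hlow) hf hg)
        (integrable_fourierForm (integrable_formSymbol hhigh) hf hg)]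
      refine integral_congr_ae (Eventually.of_forall fun ξ => ?_)
      simp only
      rw [formSymbol_highPart_add_lowPart hs.integrableOn T ξ]
      ring
    have e1 := norm_fourierForm_formSymbol_le hhigh hf hg
      fun r hr => h2 h h' H r T hr hge hs
    -- The exponent on the left is `2α - (n+1)/2`, which is at most `-a` by `han`.
    have e2 : T ^ (1 / 2 - ((n : ℝ) / 2 - (2 * α - 1))) ≤ T ^ (-a) :=
      Real.rpow_le_rpow_of_exponent_le (by linarith) (by linarith)
    have e3 : ‖fourierForm (formSymbol n (lowPart h T)) f g‖ ≤ C3 * H * T ^ (2 * α) * J := by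
      rw [hJ, ← integral_const_mul]
      refine norm_integral_le_of_norm_le (Integrable.const_mul ?_ _) (Eventually.of_forall fun ξ => ?_)
      · refine Integrable.bdd_mul (c := 1) hfg
          (measurable_minInv.comp (by fun_prop)).aestronglyMeasurable
          (Eventually.of_forall fun ξ => ?_)
        rw [Real.norm_eq_abs, abs_of_nonneg (hm0 ξ)]
        exact minInv_le_one _
      · rw [norm_mul, norm_mul, RCLike.norm_conj, ← mul_assoc (C3 * H * T ^ (2 * α))]
        refine mul_le_mul_of_nonneg_right ((norm_formSymbol_le _ _).trans ?_) (by positivity)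
        have := hs.norm_halfMultiplier_lowPart_le_minInv (1 - ‖ξ‖ ^ 2) hγ hT
        rwa [sub_add_cancel] at this
    rw [esplit]
    calc _ ≤ C3 * H * T ^ (2 * α) * J + C2 * H * T ^ (1 / 2 - ((n : ℝ) / 2 - (2 * α - 1))) * P :=
          (norm_add_le _ _).trans (add_le_add e3 e1)
      _ ≤ C3 * H * T ^ (2 * α) * J + C2 * H * T ^ (-a) * P := by gcongr
      _ ≤ (C1 * 2 ^ a + C2 + C3) * H * (T ^ (2 * α) * J) +
            (C1 * 2 ^ a + C2 + C3) * H * (T ^ (-a) * P) := by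
          have h3 : 0 ≤ C1 * 2 ^ a := by positivity
          rw [mul_assoc (C3 * H), mul_assoc (C2 * H)]
          gcongr <;> linarith
      _ = _ := by ring

end PairBound

end BochnerRiesz

namespace BochnerRiesz

/-! ### Level sets and the `L^p` bound for the form -/

noncomputable section Levels

open scoped ComplexConjugate

variable {n : ℕ}

/-- The part of `f` where `2 ^ k ≤ ‖f‖ < 2 ^ (k + 1)`. -/
def levelPart (f : E n → ℂ) (k : ℤ) : E n → ℂ :=
  {x | (2 : ℝ) ^ (k : ℝ) ≤ ‖f x‖ ∧ ‖f x‖ < (2 : ℝ) ^ ((k : ℝ) + 1)}.indicator f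

theorem measurableSet_level {f : E n → ℂ} (hf : Continuous f) (k : ℤ) :
    MeasurableSet {x | (2 : ℝ) ^ (k : ℝ) ≤ ‖f x‖ ∧ ‖f x‖ < (2 : ℝ) ^ ((k : ℝ) + 1)} :=
  (measurableSet_le measurable_const hf.norm.measurable).inter
    (measurableSet_lt hf.norm.measurable measurable_const)

theorem level_iff {r : ℝ} (hr : 0 < r) (k : ℤ) :
    ((2 : ℝ) ^ (k : ℝ) ≤ r ∧ r < (2 : ℝ) ^ ((k : ℝ) + 1)) ↔ k = ⌊Real.logb 2 r⌋ := by
  rw [eq_comm, Int.floor_eq_iff, Real.le_logb_iff_rpow_le one_lt_two hr,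
    Real.logb_lt_iff_lt_rpow one_lt_two hr]

theorem levelPart_apply_of_ne {f : E n → ℂ} {x : E n} (hx : f x ≠ 0) (k : ℤ) :
    levelPart f k x = if k = ⌊Real.logb 2 ‖f x‖⌋ then f x else 0 := by
  rw [levelPart, Set.indicator_apply]
  simp only [Set.mem_ofPred_eq, level_iff (norm_pos_iff.2 hx) k]

theorem levelPart_apply_of_eq_zero {f : E n → ℂ} {x : E n} (hx : f x = 0) (k : ℤ) :
    levelPart f k x = 0 := by
  rw [levelPart, Set.indicator_apply_eq_zero]
  exact fun _ => hx

theorem sum_levelPart (f : E n → ℂ) (S : Finset ℤ) (x : E n) :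
    ∑ k ∈ S, levelPart f k x = if ⌊Real.logb 2 ‖f x‖⌋ ∈ S then f x else 0 := by
  by_cases hx : f x = 0
  · rw [Finset.sum_eq_zero fun k _ => levelPart_apply_of_eq_zero hx k, hx, ite_self]
  · simp only [levelPart_apply_of_ne hx, Finset.sum_ite_eq']

theorem norm_levelPart_le (f : E n → ℂ) (k : ℤ) (x : E n) : ‖levelPart f k x‖ ≤ ‖f x‖ :=
  norm_indicator_le_norm_self f x

theorem sum_norm_levelPart_rpow_le (f : E n → ℂ) {p : ℝ} (hp : 0 < p) (S : Finset ℤ) (x : E n) :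
    ∑ k ∈ S, ‖levelPart f k x‖ ^ p ≤ ‖f x‖ ^ p := by
  by_cases hx : f x = 0
  · rw [Finset.sum_eq_zero fun k _ => by
      rw [levelPart_apply_of_eq_zero hx k, norm_zero, Real.zero_rpow hp.ne']]
    positivity
  · have : ∀ k ∈ S, ‖levelPart f k x‖ ^ p =
        if k = ⌊Real.logb 2 ‖f x‖⌋ then ‖f x‖ ^ p else 0 := fun k _ => by
      rw [levelPart_apply_of_ne hx]
      split_ifs
      · rfl
      · rw [norm_zero, Real.zero_rpow hp.ne']
    rw [Finset.sum_congr rfl this, Finset.sum_ite_eq']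
    split_ifs
    · exact le_rfl
    · positivity

theorem aestronglyMeasurable_levelPart {f : E n → ℂ} (hf : Continuous f) (k : ℤ) :
    AEStronglyMeasurable (levelPart f k) volume :=
  hf.aestronglyMeasurable.indicator (measurableSet_level hf k)

theorem memLp_levelPart {f : E n → ℂ} {q : ℝ≥0∞} (hf : Continuous f) (h : MemLp f q volume)
    (k : ℤ) : MemLp (levelPart f k) q volume :=
  h.mono (aestronglyMeasurable_levelPart hf k) (Eventually.of_forall (norm_levelPart_le f k))

theorem integrable_levelPart {f : E n → ℂ} (hf : Continuous f) (h : Integrable f)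
    (k : ℤ) : Integrable (levelPart f k) :=
  h.mono (aestronglyMeasurable_levelPart hf k) (Eventually.of_forall (norm_levelPart_le f k))

/-- The lower height bound `2^k ≤ |f|` converts the `L¹` norm of a piece into its contribution to `∫
|f|^p`. -/
theorem norm_levelPart_mul_le (f : E n → ℂ) {p : ℝ} (hp : 1 ≤ p) (k : ℤ) (x : E n) :
    (2 : ℝ) ^ ((k : ℝ) * (p - 1)) * ‖levelPart f k x‖ ≤ ‖levelPart f k x‖ ^ p := by
  by_cases hx : x ∈ {x | (2 : ℝ) ^ (k : ℝ) ≤ ‖f x‖ ∧ ‖f x‖ < (2 : ℝ) ^ ((k : ℝ) + 1)}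
  · rw [levelPart, Set.indicator_of_mem hx]
    have h0 : 0 < ‖f x‖ := lt_of_lt_of_le (by positivity) hx.1
    have e : ‖f x‖ ^ p = ‖f x‖ ^ (p - 1) * ‖f x‖ := by
      rw [Real.rpow_sub_one h0.ne', div_mul_cancel₀ _ h0.ne']
    rw [e, Real.rpow_mul zero_le_two]
    exact mul_le_mul_of_nonneg_right (Real.rpow_le_rpow (by positivity) hx.1 (by linarith)) h0.le
  · rw [levelPart, Set.indicator_of_notMem hx, norm_zero, mul_zero]
    positivity

/-- The counterpart for `L²` norms, from the upper height bound; the width of a level costs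
`2^(2-p)`. -/
theorem norm_levelPart_sq_mul_le (f : E n → ℂ) {p : ℝ} (hp : 0 < p) (hp2 : p ≤ 2) (k : ℤ)
    (x : E n) :
    (2 : ℝ) ^ (-((k : ℝ) * (2 - p))) * ‖levelPart f k x‖ ^ 2 ≤
      2 ^ (2 - p) * ‖levelPart f k x‖ ^ p := by
  by_cases hx : x ∈ {x | (2 : ℝ) ^ (k : ℝ) ≤ ‖f x‖ ∧ ‖f x‖ < (2 : ℝ) ^ ((k : ℝ) + 1)}
  · rw [levelPart, Set.indicator_of_mem hx]
    have h0 : 0 < ‖f x‖ := lt_of_lt_of_le (by positivity) hx.1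
    have e : ‖f x‖ ^ 2 = ‖f x‖ ^ (2 - p) * ‖f x‖ ^ p := by
      rw [← Real.rpow_add h0, sub_add_cancel, Real.rpow_two]
    have h1 : ‖f x‖ ^ (2 - p) ≤ (2 : ℝ) ^ (((k : ℝ) + 1) * (2 - p)) := by
      rw [Real.rpow_mul zero_le_two]
      exact Real.rpow_le_rpow h0.le hx.2.le (by linarith)
    have h2 : (2 : ℝ) ^ (-((k : ℝ) * (2 - p))) * 2 ^ (((k : ℝ) + 1) * (2 - p)) = 2 ^ (2 - p) := by
      rw [← Real.rpow_add two_pos]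
      congr 1
      ring
    rw [e, ← h2, ← mul_assoc]
    gcongr
  · rw [levelPart, Set.indicator_of_notMem hx, norm_zero, Real.zero_rpow hp.ne']
    simp

theorem tendsto_fourierInt_sum_levelPart {f : E n → ℂ} (hf : Continuous f) (hi : Integrable f)
    (ξ : E n) :
    Tendsto (fun N : ℕ => fourierInt (fun x => ∑ k ∈ Finset.Icc (-(N : ℤ)) N, levelPart f k x) ξ)
      atTop (𝓝 (fourierInt f ξ)) := by
  have hexp : ∀ x : E n, ‖Complex.exp (-Complex.I * ((inner ℝ ξ x : ℝ) : ℂ))‖ = 1 := fun x => by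
    have : -Complex.I * ((inner ℝ ξ x : ℝ) : ℂ) = Complex.I * ((-inner ℝ ξ x : ℝ) : ℂ) := by
      push_cast
      ring
    rw [this, norm_cexp_I_mul_ofReal]
  refine tendsto_integral_of_dominated_convergence (fun x => ‖f x‖) (fun N => ?_) hi.norm
    (fun N => Eventually.of_forall fun x => ?_) (Eventually.of_forall fun x => ?_)
  · refine AEStronglyMeasurable.mul (by fun_prop) ?_
    exact Finset.aestronglyMeasurable_fun_sum _ fun k _ => aestronglyMeasurable_levelPart hf k
  · rw [norm_mul, hexp, one_mul]
    beta_reduce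
    rw [sum_levelPart]
    split_ifs
    · exact le_rfl
    · rw [norm_zero]
      exact norm_nonneg _
  · refine Tendsto.const_mul _ (tendsto_const_nhds.congr' ?_)
    set m := ⌊Real.logb 2 ‖f x‖⌋ with hm
    filter_upwards [eventually_ge_atTop m.natAbs] with N hN
    rw [sum_levelPart, if_pos]
    rw [Finset.mem_Icc]
    omega

/-- Finite sums of level parts are dominated by `|f|`, so their transforms converge pointwise and
are bounded by `‖f‖₁`; dominated convergence applies twice. -/
theorem tendsto_fourierForm_sum_levelPart {W f : E n → ℂ} (hW : Integrable W) (hf : Continuous f)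
    (hi : Integrable f) :
    Tendsto (fun N : ℕ => fourierForm W (fun x => ∑ k ∈ Finset.Icc (-(N : ℤ)) N, levelPart f k x)
      (fun x => ∑ k ∈ Finset.Icc (-(N : ℤ)) N, levelPart f k x)) atTop (𝓝 (fourierForm W f f)) := by
  have hsumint : ∀ N : ℕ, Integrable
      (fun x => ∑ k ∈ Finset.Icc (-(N : ℤ)) N, levelPart f k x) := fun N =>
    integrable_finsetSum _ fun k _ => integrable_levelPart hf hi k
  have hb : ∀ (N : ℕ) (ξ : E n),
      ‖fourierInt (fun x => ∑ k ∈ Finset.Icc (-(N : ℤ)) N, levelPart f k x) ξ‖ ≤ ∫ x, ‖f x‖ := by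
    intro N ξ
    refine (norm_fourierInt_le _ ξ).trans (integral_mono (hsumint N).norm hi.norm fun x => ?_)
    simp only
    rw [sum_levelPart]
    split_ifs
    · exact le_rfl
    · rw [norm_zero]
      exact norm_nonneg _
  refine tendsto_integral_of_dominated_convergence
    (fun ξ => ‖W ξ‖ * ((∫ x, ‖f x‖) * ∫ x, ‖f x‖)) (fun N => ?_) (hW.norm.mul_const _)
    (fun N => Eventually.of_forall fun ξ => ?_) (Eventually.of_forall fun ξ => ?_)
  · exact (integrable_fourierForm hW (hsumint N) (hsumint N)).aestronglyMeasurable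
  · rw [norm_mul, norm_mul, RCLike.norm_conj]
    refine mul_le_mul_of_nonneg_left ?_ (norm_nonneg _)
    exact mul_le_mul (hb N ξ) (hb N ξ) (norm_nonneg _) (integral_nonneg fun _ => norm_nonneg _)
  · have := tendsto_fourierInt_sum_levelPart hf hi ξ
    exact (this.mul ((Complex.continuous_conj.tendsto _).comp this)).const_mul _

/-- The form bound for sums of level parts. -/
theorem exists_fourierForm_sum_levelPart_le (n : ℕ) (α p : ℝ) (hα : 1 / 2 < α) (hp : 1 < p)
    (hp' : p ≤ (2 * (n : ℝ) + 2) / ((n : ℝ) + 1 + 4 * α)) :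
    ∃ C : ℝ, 0 ≤ C ∧ ∀ (h h' : ℝ → ℝ) (H : ℝ) (f : E n → ℂ) (S : Finset ℤ),
      IsSymbol h h' (2 * α - 1) H → Continuous f → Integrable f → MemLp f 2 volume →
      Integrable (fun x => ‖f x‖ ^ p) →
      ‖fourierForm (formSymbol n h) (fun x => ∑ k ∈ S, levelPart f k x)
        (fun x => ∑ k ∈ S, levelPart f k x)‖ ≤
        C * H * ((∫ x, ‖f x‖ ^ p) + (∫ x, ‖f x‖ ^ p) ^ 2) := by
  have hn0 : (0 : ℝ) ≤ n := Nat.cast_nonneg n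
  have hp2 : p < 2 := by
    refine lt_of_le_of_lt hp' ?_
    rw [div_lt_iff₀ (by linarith)]
    linarith
  have hcrit : p * ((n : ℝ) + 1 + 4 * α) ≤ 2 * n + 2 := by
    rwa [le_div_iff₀ (by linarith)] at hp'
  -- The parameters `a` and `δ` solve `δ a = p - 1` and `4 α δ = 2 - p`, the powers of the height
  -- required by the `L¹` and the `L²` sums respectively.
  set a : ℝ := 4 * α * (p - 1) / (2 - p) with ha
  have h2p : 0 < 2 - p := by linarith
  have ha0 : 0 ≤ a := div_nonneg (by nlinarith) h2p.le
  -- After clearing denominators this is exactly `hcrit`: it is here that the critical exponent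
  -- enters.
  have han : a ≤ ((n : ℝ) + 1) / 2 - 2 * α := by
    rw [ha, div_le_iff₀ h2p]
    nlinarith
  set δ : ℝ := (2 - p) / (4 * α) with hδ
  have hδ0 : 0 < δ := div_pos h2p (by linarith)
  have hδa : δ * a = p - 1 := by
    rw [hδ, ha]
    have : α ≠ 0 := by linarith
    field_simp
  have hδα : δ * (4 * α) = 2 - p := by
    rw [hδ, div_mul_cancel₀ _ (by linarith)]
  obtain ⟨C1, hC1, hpair⟩ := exists_fourierForm_pair_bound n α a hα ha0 han
  obtain ⟨C2, hC2, hplan⟩ := exists_integral_fourierInt_sq_le n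
  obtain ⟨C3, hC3, hgeom⟩ := exists_sum_min_inv_le hδ0
  refine ⟨C1 * (C3 * C2 * 2 ^ (2 - p) + 1), by positivity,
    fun h h' H f S hs hfc hfi hf2 hfp => ?_⟩
  have hH := hs.nonneg
  set P := ∫ x, ‖f x‖ ^ p with hP
  have hP0 : 0 ≤ P := integral_nonneg fun _ => by positivity
  set g : ℤ → E n → ℂ := levelPart f with hg
  have gi : ∀ k, Integrable (g k) := fun k => integrable_levelPart hfc hfi k
  have g2 : ∀ k, MemLp (g k) 2 volume := fun k => memLp_levelPart hfc hf2 k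
  have gF : ∀ k, MemLp (fourierInt (g k)) 2 volume := fun k => (hplan _ (gi k) (g2 k)).1
  have gp : ∀ k, Integrable fun x => ‖g k x‖ ^ p := fun k => by
    refine hfp.mono' ?_ (Eventually.of_forall fun x => ?_)
    · exact ((aestronglyMeasurable_levelPart hfc k).norm.aemeasurable.pow_const p).aestronglyMeasurable
    · rw [Real.norm_eq_abs, abs_of_nonneg (by positivity)]
      exact Real.rpow_le_rpow (norm_nonneg _) (norm_levelPart_le f k x) (by linarith)
  have hsum : ∑ k ∈ S, ∫ x, ‖g k x‖ ^ p ≤ P := by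
    rw [← integral_finsetSum S fun k _ => gp k]
    exact integral_mono (integrable_finsetSum S fun k _ => gp k) hfp
      fun x => sum_norm_levelPart_rpow_le f (by linarith) S x
  -- The pair `(k, l)` is treated at scale `τ k * τ l`, a product, so every power of it separates
  -- into a factor for each piece.
  set τ : ℤ → ℝ := fun k => (2 : ℝ) ^ (-(δ * k)) with hτ
  have hτ0 : ∀ k, 0 < τ k := fun k => by positivity
  have hτmul : ∀ k l, τ k * τ l = (2 : ℝ) ^ (-(δ * ((k + l : ℤ) : ℝ))) := fun k l => by
    simp only [hτ]
    rw [← Real.rpow_add two_pos]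
    congr 1
    push_cast
    ring
  have hτα : ∀ k, (τ k ^ (2 * α)) ^ 2 = (2 : ℝ) ^ (-((k : ℝ) * (2 - p))) := fun k => by
    simp only [hτ]
    rw [← Real.rpow_natCast, ← Real.rpow_mul (hτ0 k).le, ← Real.rpow_mul zero_le_two, ← hδα]
    congr 1
    push_cast
    ring
  have hτa : ∀ k, τ k ^ (-a) = (2 : ℝ) ^ ((k : ℝ) * (p - 1)) := fun k => by
    simp only [hτ]
    rw [← Real.rpow_mul zero_le_two, ← hδa]
    congr 1
    ring
  set x : ℤ → E n → ℝ := fun k ξ => τ k ^ (2 * α) * ‖fourierInt (g k) ξ‖ with hx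
  have xint : ∀ k l, Integrable fun ξ => x k ξ * x l ξ := fun k l =>
    ((gF k).norm.const_mul _).integrable_mul (q := 2) ((gF l).norm.const_mul _)
  have hmeas : ∀ k l : ℤ, AEStronglyMeasurable
      (fun ξ : E n => minInv ((2 : ℝ) ^ (-(δ * ((k + l : ℤ) : ℝ))) * |1 - ‖ξ‖ ^ 2|)) volume :=
    fun k l => (measurable_minInv.comp (by fun_prop)).aestronglyMeasurable
  have kint : ∀ k l, Integrable fun ξ : E n =>
      minInv ((2 : ℝ) ^ (-(δ * ((k + l : ℤ) : ℝ))) * |1 - ‖ξ‖ ^ 2|) * (x k ξ * x l ξ) := fun k l => by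
    refine Integrable.bdd_mul (c := 1) (xint k l) (hmeas k l) (Eventually.of_forall fun ξ => ?_)
    rw [Real.norm_eq_abs, abs_of_nonneg (minInv_nonneg (by positivity))]
    exact minInv_le_one _
  have hsq : ∑ k ∈ S, ∑ l ∈ S, (τ k * τ l) ^ (2 * α) * (∫ ξ, minInv (τ k * τ l * |1 - ‖ξ‖ ^ 2|) *
      (‖fourierInt (g k) ξ‖ * ‖fourierInt (g l) ξ‖)) ≤ C3 * C2 * 2 ^ (2 - p) * P := by
    have e1 : ∀ k l, (τ k * τ l) ^ (2 * α) * (∫ ξ, minInv (τ k * τ l * |1 - ‖ξ‖ ^ 2|) *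
        (‖fourierInt (g k) ξ‖ * ‖fourierInt (g l) ξ‖)) = ∫ ξ : E n,
          minInv ((2 : ℝ) ^ (-(δ * ((k + l : ℤ) : ℝ))) * |1 - ‖ξ‖ ^ 2|) * (x k ξ * x l ξ) := by
      intro k l
      rw [← integral_const_mul, ← hτmul, Real.mul_rpow (hτ0 k).le (hτ0 l).le]
      refine integral_congr_ae (Eventually.of_forall fun ξ => ?_)
      simp only [hx]
      ring
    calc _ = ∫ ξ : E n, ∑ k ∈ S, ∑ l ∈ S,
          minInv ((2 : ℝ) ^ (-(δ * ((k + l : ℤ) : ℝ))) * |1 - ‖ξ‖ ^ 2|) * (x k ξ * x l ξ) := by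
          rw [integral_finsetSum S fun k _ => integrable_finsetSum S fun l _ => kint k l]
          refine Finset.sum_congr rfl fun k _ => ?_
          rw [integral_finsetSum S fun l _ => kint k l]
          exact Finset.sum_congr rfl fun l _ => e1 k l
      _ ≤ ∫ ξ : E n, C3 * ∑ k ∈ S, x k ξ ^ 2 := by
          refine integral_mono (integrable_finsetSum S fun k _ => integrable_finsetSum S
            fun l _ => kint k l) (Integrable.const_mul (integrable_finsetSum S fun k _ => ?_) _)
            fun ξ => ?_
          · simpa only [sq] using xint k k
          -- Schur's test is applied at fixed `ξ`, with a constant independent of `|1 - |ξ|²|`; this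
          -- gains summability over all pairs.
          · exact schur_sum_le (κ := fun k => minInv ((2 : ℝ) ^ (-(δ * k)) * |1 - ‖ξ‖ ^ 2|))
              (fun k => minInv_nonneg (by positivity))
              (fun S' => hgeom S' _ (abs_nonneg _)) S fun k => x k ξ
      _ = C3 * ∑ k ∈ S, (τ k ^ (2 * α)) ^ 2 * ∫ ξ, ‖fourierInt (g k) ξ‖ ^ 2 := by
          rw [integral_const_mul, integral_finsetSum S fun k _ => by
            simpa only [sq] using xint k k]
          simp only [hx, mul_pow, integral_const_mul]
      _ ≤ C3 * ∑ k ∈ S, C2 * 2 ^ (2 - p) * ∫ x, ‖g k x‖ ^ p := by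
          refine mul_le_mul_of_nonneg_left (Finset.sum_le_sum fun k _ => ?_) hC3
          have h1 := (hplan _ (gi k) (g2 k)).2
          have h2 : (τ k ^ (2 * α)) ^ 2 * ∫ x, ‖g k x‖ ^ 2 ≤ 2 ^ (2 - p) * ∫ x, ‖g k x‖ ^ p := by
            rw [hτα, ← integral_const_mul, ← integral_const_mul]
            exact integral_mono ((g2 k).integrable_norm_pow two_ne_zero |>.const_mul _)
              ((gp k).const_mul _)
              fun x => norm_levelPart_sq_mul_le f (by linarith) hp2.le k x
          calc _ ≤ (τ k ^ (2 * α)) ^ 2 * (C2 * ∫ x, ‖g k x‖ ^ 2) :=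
                mul_le_mul_of_nonneg_left h1 (by positivity)
            _ = C2 * ((τ k ^ (2 * α)) ^ 2 * ∫ x, ‖g k x‖ ^ 2) := by ring
            _ ≤ C2 * (2 ^ (2 - p) * ∫ x, ‖g k x‖ ^ p) := mul_le_mul_of_nonneg_left h2 hC2
            _ = _ := by ring
      _ = C3 * C2 * 2 ^ (2 - p) * ∑ k ∈ S, ∫ x, ‖g k x‖ ^ p := by
          rw [← Finset.mul_sum]
          ring
      _ ≤ _ := mul_le_mul_of_nonneg_left hsum (by positivity)
  -- The double sum is the square of `∑ τ_k^(-a) ‖f_k‖₁`.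
  have hone : ∑ k ∈ S, ∑ l ∈ S, (τ k * τ l) ^ (-a) * ((∫ x, ‖g k x‖) * ∫ x, ‖g l x‖) ≤ P ^ 2 := by
    have e1 : ∀ k, τ k ^ (-a) * ∫ x, ‖g k x‖ ≤ ∫ x, ‖g k x‖ ^ p := fun k => by
      rw [hτa, ← integral_const_mul]
      exact integral_mono ((gi k).norm.const_mul _) (gp k)
        fun x => norm_levelPart_mul_le f hp.le k x
    have e2 : ∑ k ∈ S, τ k ^ (-a) * ∫ x, ‖g k x‖ ≤ P :=
      (Finset.sum_le_sum fun k _ => e1 k).trans hsum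
    have e3 : 0 ≤ ∑ k ∈ S, τ k ^ (-a) * ∫ x, ‖g k x‖ := Finset.sum_nonneg fun k _ =>
      mul_nonneg (Real.rpow_nonneg (hτ0 k).le _) (integral_nonneg fun _ => norm_nonneg _)
    refine le_trans (le_of_eq ?_) (pow_le_pow_left₀ e3 e2 2)
    rw [sq, Finset.sum_mul_sum]
    refine Finset.sum_congr rfl fun k _ => Finset.sum_congr rfl fun l _ => ?_
    rw [Real.mul_rpow (hτ0 k).le (hτ0 l).le]
    ring
  rw [fourierForm_finset_sum S (integrable_formSymbol hs.integrableOn) fun k _ => gi k]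
  calc _ ≤ ∑ k ∈ S, ∑ l ∈ S, ‖fourierForm (formSymbol n h) (g k) (g l)‖ :=
        (norm_sum_le _ _).trans (Finset.sum_le_sum fun k _ => norm_sum_le _ _)
    _ ≤ ∑ k ∈ S, ∑ l ∈ S, C1 * H * ((τ k * τ l) ^ (2 * α) *
          (∫ ξ, minInv (τ k * τ l * |1 - ‖ξ‖ ^ 2|) *
            (‖fourierInt (g k) ξ‖ * ‖fourierInt (g l) ξ‖)) +
          (τ k * τ l) ^ (-a) * ((∫ x, ‖g k x‖) * ∫ x, ‖g l x‖)) :=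
        Finset.sum_le_sum fun k _ => Finset.sum_le_sum fun l _ =>
          hpair h h' H _ (g k) (g l) hs (mul_pos (hτ0 k) (hτ0 l)) (gi k) (gi l) (gF k) (gF l)
    _ = C1 * H * ((∑ k ∈ S, ∑ l ∈ S, (τ k * τ l) ^ (2 * α) *
          (∫ ξ, minInv (τ k * τ l * |1 - ‖ξ‖ ^ 2|) *
            (‖fourierInt (g k) ξ‖ * ‖fourierInt (g l) ξ‖))) +
          ∑ k ∈ S, ∑ l ∈ S, (τ k * τ l) ^ (-a) * ((∫ x, ‖g k x‖) * ∫ x, ‖g l x‖)) := by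
        simp only [← Finset.mul_sum, Finset.sum_add_distrib]
    _ ≤ C1 * H * (C3 * C2 * 2 ^ (2 - p) * P + P ^ 2) := by gcongr
    _ ≤ _ := by
        have h1 : 0 ≤ C3 * C2 * 2 ^ (2 - p) := by positivity
        rw [mul_right_comm C1 _ H, mul_assoc (C1 * H)]
        refine mul_le_mul_of_nonneg_left ?_ (by positivity)
        nlinarith [mul_nonneg h1 (sq_nonneg P)]

/-- The fundamental bound for the form, at the scale-invariant exponent. -/
theorem exists_fourierForm_le (n : ℕ) (α p : ℝ) (hα : 1 / 2 < α) (hp : 1 ≤ p)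
    (hp' : p ≤ (2 * (n : ℝ) + 2) / ((n : ℝ) + 1 + 4 * α)) :
    ∃ C : ℝ, 0 ≤ C ∧ ∀ (h h' : ℝ → ℝ) (H : ℝ) (φ : 𝓢(E n, ℂ)), IsSymbol h h' (2 * α - 1) H →
      ‖fourierForm (formSymbol n h) φ φ‖ ≤ C * H * (∫ x, ‖φ x‖ ^ p) ^ (2 / p) := by
  have hn0 : (0 : ℝ) ≤ n := Nat.cast_nonneg n
  rcases hp.eq_or_lt with rfl | hp1
  -- For `p = 1` a bounded kernel is enough, and the exponent condition is precisely the hypothesis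
  -- of the kernel bound.
  · have hb : 1 / 2 ≤ (n : ℝ) / 2 - (2 * α - 1) := by
      rw [le_div_iff₀ (by linarith)] at hp'
      linarith
    obtain ⟨C, hC, hle⟩ := exists_norm_halfKernel_le n (2 * α - 1) (by linarith) hb
    refine ⟨C, hC, fun h h' H φ hs => ?_⟩
    have := norm_fourierForm_formSymbol_le hs.integrableOn φ.integrable φ.integrable
      fun r hr => hle h h' H r hr hs
    refine this.trans (le_of_eq ?_)
    simp only [Real.rpow_one, div_one, Real.rpow_ofNat]
    ring
  obtain ⟨C, hC, hle⟩ := exists_fourierForm_sum_levelPart_le n α p hα hp1 hp'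
  have hp0 : 0 < p := by linarith
  have hbase : ∀ (h h' : ℝ → ℝ) (H : ℝ) (φ : 𝓢(E n, ℂ)), IsSymbol h h' (2 * α - 1) H →
      ‖fourierForm (formSymbol n h) φ φ‖ ≤
        C * H * ((∫ x, ‖φ x‖ ^ p) + (∫ x, ‖φ x‖ ^ p) ^ 2) := by
    intro h h' H φ hs
    have hφp : Integrable fun x => ‖φ x‖ ^ p := by
      have := (φ.memLp (ENNReal.ofReal p)).integrable_norm_rpow
        (by simpa using hp0) ENNReal.ofReal_ne_top
      rwa [ENNReal.toReal_ofReal hp0.le] at this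
    exact le_of_tendsto (tendsto_fourierForm_sum_levelPart (integrable_formSymbol hs.integrableOn)
      φ.continuous φ.integrable).norm (Eventually.of_forall fun N =>
        hle h h' H φ _ hs φ.continuous φ.integrable (φ.memLp 2) hφp)
  refine ⟨2 * C, by positivity, fun h h' H φ hs => ?_⟩
  have hH := hs.nonneg
  set P := ∫ x, ‖φ x‖ ^ p with hP
  have hP0 : 0 ≤ P := integral_nonneg fun _ => by positivity
  rcases hP0.eq_or_lt with h0 | hpos
  · have := hbase h h' H φ hs
    rw [← hP, ← h0] at this
    rw [← h0]
    refine this.trans ?_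
    have h1 : (0 : ℝ) ≤ 0 ^ (2 / p) := Real.rpow_nonneg le_rfl _
    simp only [ne_eq, OfNat.ofNat_ne_zero, not_false_eq_true, zero_pow, add_zero, mul_zero]
    positivity
  -- Normalizing to `∫ |cφ|^p = 1` turns the inhomogeneous bound `P + P²` into one quadratic in the
  -- `L^p` norm.
  set c : ℝ := P ^ (-(1 / p)) with hc
  have hc0 : 0 < c := by positivity
  have hcp : c ^ p * P = 1 := by
    rw [hc, ← Real.rpow_mul hP0, show -(1 / p) * p = -1 by field_simp, Real.rpow_neg_one,
      inv_mul_cancel₀ hpos.ne']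
  have hcoe : ∀ x, ((c : ℂ) • φ) x = (c : ℂ) * φ x := fun x => rfl
  have hscale : ∀ ξ, fourierInt ((c : ℂ) • φ : 𝓢(E n, ℂ)) ξ = (c : ℂ) * fourierInt φ ξ := by
    intro ξ
    simp only [fourierInt, hcoe]
    rw [← integral_const_mul]
    refine integral_congr_ae (Eventually.of_forall fun x => ?_)
    simp only
    ring
  have e1 : fourierForm (formSymbol n h) ((c : ℂ) • φ : 𝓢(E n, ℂ)) ((c : ℂ) • φ : 𝓢(E n, ℂ)) =
      ((c ^ 2 : ℝ) : ℂ) * fourierForm (formSymbol n h) φ φ := by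
    simp only [fourierForm, hscale]
    rw [← integral_const_mul]
    refine integral_congr_ae (Eventually.of_forall fun ξ => ?_)
    simp only [map_mul, Complex.conj_ofReal]
    push_cast
    ring
  have e2 : ∫ x, ‖((c : ℂ) • φ : 𝓢(E n, ℂ)) x‖ ^ p = 1 := by
    rw [← hcp, hP, ← integral_const_mul]
    refine integral_congr_ae (Eventually.of_forall fun x => ?_)
    simp only [hcoe, norm_mul, Complex.norm_real, Real.norm_eq_abs, abs_of_pos hc0]
    rw [Real.mul_rpow hc0.le (norm_nonneg _)]
  have := hbase h h' H ((c : ℂ) • φ) hs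
  rw [e1, e2, norm_mul, Complex.norm_real, Real.norm_eq_abs, abs_of_pos (by positivity)] at this
  have e3 : c ^ 2 * P ^ (2 / p) = 1 := by
    rw [hc, ← Real.rpow_natCast, ← Real.rpow_mul hP0, ← Real.rpow_add hpos]
    rw [show -(1 / p) * ((2 : ℕ) : ℝ) + 2 / p = 0 by push_cast; ring, Real.rpow_zero]
  have hQ : 0 ≤ P ^ (2 / p) := by positivity
  calc ‖fourierForm (formSymbol n h) φ φ‖
      = c ^ 2 * ‖fourierForm (formSymbol n h) φ φ‖ * P ^ (2 / p) := by
        rw [mul_right_comm, e3, one_mul]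
    _ ≤ C * H * (1 + 1 ^ 2) * P ^ (2 / p) := mul_le_mul_of_nonneg_right this hQ
    _ = _ := by ring

end Levels

end BochnerRiesz

namespace BochnerRiesz

/-! ### Gaussian approximations to `t^γ` and to the singular weight -/

noncomputable section Weights

/-- The scale `4⁻⁽ⁱ⁺¹⁾`. -/
def quarterScale (i : ℕ) : ℝ := ((4 : ℝ) ^ (i + 1))⁻¹

theorem quarterScale_pos (i : ℕ) : 0 < quarterScale i := by
  unfold quarterScale
  positivity

theorem quarterScale_le {i m : ℕ} (h : i ≤ m) : quarterScale m ≤ quarterScale i :=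
  inv_anti₀ (by positivity) (pow_le_pow_right₀ (by norm_num) (by omega))

/-- Sum of differences of Gaussians, approximating a multiple of `|t| ^ γ`. -/
def gaussDiff (γ : ℝ) (I m : ℕ) (t : ℝ) : ℝ :=
  ∑ i ∈ Finset.range (I + 1), (2 : ℝ) ^ (γ * i) *
    (Real.exp (-quarterScale m * t ^ 2) - Real.exp (-quarterScale i * t ^ 2))

def gaussDiffDeriv (γ : ℝ) (I m : ℕ) (t : ℝ) : ℝ :=
  ∑ i ∈ Finset.range (I + 1), (2 : ℝ) ^ (γ * i) *
    (Real.exp (-quarterScale m * t ^ 2) * (-quarterScale m * (2 * t)) -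
      Real.exp (-quarterScale i * t ^ 2) * (-quarterScale i * (2 * t)))

theorem hasDerivAt_gaussDiff (γ : ℝ) (I m : ℕ) (t : ℝ) :
    HasDerivAt (gaussDiff γ I m) (gaussDiffDeriv γ I m t) t := by
  have h : ∀ c : ℝ, HasDerivAt (fun t : ℝ => Real.exp (-c * t ^ 2))
      (Real.exp (-c * t ^ 2) * (-c * (2 * t))) t := fun c => by
    have := ((hasDerivAt_pow 2 t).const_mul (-c)).exp
    simpa using this
  exact HasDerivAt.fun_sum fun i _ => ((h _).sub (h _)).const_mul _

theorem mul_exp_neg_le_min {x : ℝ} (hx : 0 ≤ x) : x * Real.exp (-x) ≤ min 1 x := by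
  refine le_min ?_ (mul_le_of_le_one_right hx (Real.exp_le_one_iff.2 (by linarith)))
  rw [Real.exp_neg, ← div_eq_mul_inv, div_le_one (Real.exp_pos x)]
  linarith [Real.add_one_le_exp x]

theorem abs_exp_sub_exp_le_min {x y : ℝ} (hy : 0 ≤ y) (hyx : y ≤ x) :
    |Real.exp (-y) - Real.exp (-x)| ≤ min 1 x := by
  have h1 : Real.exp (-x) ≤ Real.exp (-y) := Real.exp_le_exp.2 (by linarith)
  have h2 : Real.exp (-y) ≤ 1 := Real.exp_le_one_iff.2 (by linarith)
  have h3 := Real.exp_pos (-x)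
  have h4 := Real.add_one_le_exp (-x)
  rw [abs_of_nonneg (by linarith)]
  exact le_min (by linarith) (by linarith)

theorem abs_mul_exp_sub_le_min {x y : ℝ} (hy : 0 ≤ y) (hyx : y ≤ x) :
    |x * Real.exp (-x) - y * Real.exp (-y)| ≤ min 1 x := by
  have h1 := mul_exp_neg_le_min (hy.trans hyx)
  have h2 := (mul_exp_neg_le_min hy).trans (min_le_min_left 1 hyx)
  have h3 : 0 ≤ x * Real.exp (-x) := mul_nonneg (hy.trans hyx) (Real.exp_pos _).le
  have h4 : 0 ≤ y * Real.exp (-y) := mul_nonneg hy (Real.exp_pos _).le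
  rw [abs_le]
  constructor <;> linarith

/-- Away from `2^i ≈ t` the terms decay geometrically, like `2^(γi)` below and like `2^((γ-2)i) t²`
above. Convergence on both sides is the condition `0 < γ < 2`, hence `α < 3/2`. -/
theorem exists_sum_min_quarterScale_le {γ : ℝ} (hγ : 0 < γ) (hγ2 : γ < 2) :
    ∃ C : ℝ, 0 ≤ C ∧ ∀ (I : ℕ) (t : ℝ), 0 < t →
      ∑ i ∈ Finset.range (I + 1), (2 : ℝ) ^ (γ * i) * min 1 (quarterScale i * t ^ 2) ≤
        C * t ^ γ := by
  set κ := min γ (2 - γ) with hκ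
  have hκ0 : 0 < κ := lt_min hγ (by linarith)
  have hl : 0 < Real.log 2 := Real.log_pos one_lt_two
  obtain ⟨C, hC, hsum⟩ := exists_sum_exp_neg_abs_le (d := κ * Real.log 2) (by positivity)
  refine ⟨C, hC, fun I t ht => ?_⟩
  have hterm : ∀ i : ℕ, (2 : ℝ) ^ (γ * i) * min 1 (quarterScale i * t ^ 2) ≤
      Real.exp (-|κ * Real.log 2 * ((i : ℤ) : ℝ) - κ * Real.log t|) * t ^ γ := by
    intro i
    set v : ℝ := Real.log 2 * i - Real.log t with hv
    have e1 : (2 : ℝ) ^ (γ * i) = Real.exp (γ * v) * t ^ γ := by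
      rw [Real.rpow_def_of_pos two_pos, Real.rpow_def_of_pos ht, ← Real.exp_add]
      congr 1
      rw [hv]
      ring
    have e2 : quarterScale i * t ^ 2 ≤ Real.exp (-(2 * v)) := by
      have h4 : (4 : ℝ) ^ i = Real.exp (2 * (Real.log 2 * i)) := by
        rw [show (4 : ℝ) = 2 ^ 2 by norm_num, ← pow_mul, ← Real.rpow_natCast,
          Real.rpow_def_of_pos two_pos]
        congr 1
        push_cast
        ring
      have ht2 : t ^ 2 = Real.exp (2 * Real.log t) := by
        rw [mul_comm, Real.exp_mul, Real.exp_log ht, Real.rpow_two]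
      have e3 : Real.exp (-(2 * v)) = ((4 : ℝ) ^ i)⁻¹ * t ^ 2 := by
        rw [h4, ht2, ← Real.exp_neg, ← Real.exp_add]
        congr 1
        rw [hv]
        ring
      rw [e3]
      refine mul_le_mul_of_nonneg_right (inv_anti₀ (by positivity) ?_) (sq_nonneg t)
      exact pow_le_pow_right₀ (by norm_num) (by omega)
    have e3 : Real.exp (γ * v) * min 1 (quarterScale i * t ^ 2) ≤ Real.exp (-(κ * |v|)) := by
      rcases le_total 0 v with h | h
      · rw [abs_of_nonneg h]
        calc _ ≤ Real.exp (γ * v) * Real.exp (-(2 * v)) :=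
              mul_le_mul_of_nonneg_left ((min_le_right _ _).trans e2) (Real.exp_pos _).le
          _ = Real.exp (-((2 - γ) * v)) := by
              rw [← Real.exp_add]
              congr 1
              ring
          _ ≤ _ := Real.exp_le_exp.2 (neg_le_neg
              (mul_le_mul_of_nonneg_right (min_le_right _ _) h))
      · rw [abs_of_nonpos h]
        calc _ ≤ Real.exp (γ * v) * 1 :=
              mul_le_mul_of_nonneg_left (min_le_left _ _) (Real.exp_pos _).le
          _ ≤ _ := by
              rw [mul_one]
              refine Real.exp_le_exp.2 ?_
              have : κ ≤ γ := min_le_left _ _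
              nlinarith
    have e4 : |κ * Real.log 2 * ((i : ℤ) : ℝ) - κ * Real.log t| = κ * |v| := by
      rw [← abs_of_pos hκ0, ← abs_mul, abs_of_pos hκ0]
      congr 1
      rw [hv]
      push_cast
      ring
    rw [e4, e1, mul_right_comm]
    exact mul_le_mul_of_nonneg_right e3 (by positivity)
  calc _ ≤ ∑ i ∈ Finset.range (I + 1),
        Real.exp (-|κ * Real.log 2 * ((i : ℤ) : ℝ) - κ * Real.log t|) * t ^ γ :=
        Finset.sum_le_sum fun i _ => hterm i
    _ = (∑ k ∈ (Finset.range (I + 1)).map (Nat.castEmbedding : ℕ ↪ ℤ),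
        Real.exp (-|κ * Real.log 2 * (k : ℝ) - κ * Real.log t|)) * t ^ γ := by
        rw [Finset.sum_map, Finset.sum_mul]
        rfl
    _ ≤ _ := mul_le_mul_of_nonneg_right (hsum _ _) (by positivity)

/-- The essential point is that `H` does not depend on `I` or `m`. Each difference of Gaussians, and
`t` times its derivative, is at most a constant times `min(1, 4^(-i-1) t²)`; `I ≤ m` ensures that
the `m`-th Gaussian is the wider one. -/
theorem exists_isSymbol_gaussDiff {γ : ℝ} (hγ : 0 < γ) (hγ2 : γ < 2) :
    ∃ H : ℝ, ∀ I m : ℕ, I ≤ m → IsSymbol (gaussDiff γ I m) (gaussDiffDeriv γ I m) γ H := by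
  obtain ⟨C, hC, hsum⟩ := exists_sum_min_quarterScale_le hγ hγ2
  refine ⟨2 * C, fun I m hIm => ⟨hasDerivAt_gaussDiff γ I m, ?_, fun t ht => ?_, fun t ht => ?_, ?_⟩⟩
  · unfold gaussDiffDeriv
    fun_prop
  · rcases ht.eq_or_lt with rfl | ht
    · simp [gaussDiff, Real.zero_rpow hγ.ne']
    · have h1 : |gaussDiff γ I m t| ≤ C * t ^ γ := by
        refine ((Finset.abs_sum_le_sum_abs _ _).trans (Finset.sum_le_sum fun i hi => ?_)).trans
          (hsum I t ht)
        rw [abs_mul, abs_of_pos (by positivity : (0 : ℝ) < 2 ^ (γ * i))]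
        refine mul_le_mul_of_nonneg_left ?_ (by positivity)
        rw [neg_mul, neg_mul]
        refine abs_exp_sub_exp_le_min (mul_nonneg (quarterScale_pos m).le (sq_nonneg t)) ?_
        exact mul_le_mul_of_nonneg_right (quarterScale_le (by
          have := Finset.mem_range.1 hi
          omega)) (sq_nonneg t)
      have : 0 ≤ C * t ^ γ := by positivity
      linarith
  · have h1 : |t * gaussDiffDeriv γ I m t| ≤ 2 * (C * t ^ γ) := by
      rw [gaussDiffDeriv, Finset.mul_sum]
      refine (Finset.abs_sum_le_sum_abs _ _).trans ?_
      refine le_trans (Finset.sum_le_sum fun i hi => ?_)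
        ((Finset.mul_sum _ _ _).symm.le.trans (mul_le_mul_of_nonneg_left (hsum I t ht) zero_le_two))
      have e : t * ((2 : ℝ) ^ (γ * i) *
          (Real.exp (-quarterScale m * t ^ 2) * (-quarterScale m * (2 * t)) -
            Real.exp (-quarterScale i * t ^ 2) * (-quarterScale i * (2 * t)))) =
          2 * (2 : ℝ) ^ (γ * i) * (quarterScale i * t ^ 2 * Real.exp (-(quarterScale i * t ^ 2)) -
            quarterScale m * t ^ 2 * Real.exp (-(quarterScale m * t ^ 2))) := by
        rw [neg_mul, neg_mul]
        ring_nf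
      rw [e, abs_mul, abs_of_pos (by positivity : (0 : ℝ) < 2 * 2 ^ (γ * i)), ← mul_assoc]
      refine mul_le_mul_of_nonneg_left ?_ (by positivity)
      refine abs_mul_exp_sub_le_min (mul_nonneg (quarterScale_pos m).le (sq_nonneg t)) ?_
      exact mul_le_mul_of_nonneg_right (quarterScale_le (by
        have := Finset.mem_range.1 hi
        omega)) (sq_nonneg t)
    rw [abs_mul, abs_of_pos ht] at h1
    rw [Real.rpow_sub_one ht.ne', mul_div_assoc', le_div_iff₀ ht]
    linarith
  · refine Integrable.integrableOn ?_
    refine integrable_finsetSum _ fun i _ => Integrable.const_mul (Integrable.sub ?_ ?_) _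
    · exact integrable_exp_neg_mul_sq (quarterScale_pos m)
    · exact integrable_exp_neg_mul_sq (quarterScale_pos i)

/-- By evenness the real part is half of the full Gaussian transform. The scale has `i + 1` in the
exponent so that `4c = 4^(-i)`. -/
theorem re_halfMultiplier_gauss (i : ℕ) (s : ℝ) :
    (halfMultiplier (fun t => Real.exp (-quarterScale i * t ^ 2)) s).re =
      √Real.pi * (2 ^ i * Real.exp (-(4 ^ i * s ^ 2))) := by
  set c := quarterScale i with hc
  have hc0 : 0 < c := quarterScale_pos i
  have hint : Integrable fun t : ℝ => ((Real.exp (-c * t ^ 2) : ℝ) : ℂ) *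
      Complex.exp (Complex.I * ((t * s : ℝ) : ℂ)) :=
    Integrable.mul_bdd (c := 1) (integrable_exp_neg_mul_sq hc0).ofReal
      (continuous_cexp_mul s).aestronglyMeasurable
      (Eventually.of_forall fun t => (norm_cexp_I_mul_ofReal _).le)
  have hre : ∀ t : ℝ, (((Real.exp (-c * t ^ 2) : ℝ) : ℂ) *
      Complex.exp (Complex.I * ((t * s : ℝ) : ℂ))).re = Real.exp (-c * t ^ 2) * Real.cos (t * s) := by
    intro t
    rw [Complex.re_ofReal_mul, mul_comm Complex.I, Complex.exp_ofReal_mul_I_re]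
  have e1 : (halfMultiplier (fun t => Real.exp (-c * t ^ 2)) s).re =
      ∫ t in Set.Ioi (0 : ℝ), Real.exp (-c * t ^ 2) * Real.cos (t * s) := by
    rw [halfMultiplier, ← RCLike.re_eq_complex_re, ← integral_re hint.integrableOn]
    exact integral_congr_ae (Eventually.of_forall fun t => hre t)
  have e2 : ∫ t : ℝ, Real.exp (-c * t ^ 2) * Real.cos (t * s) =
      2 * ∫ t in Set.Ioi (0 : ℝ), Real.exp (-c * t ^ 2) * Real.cos (t * s) := by
    rw [← integral_comp_abs]
    refine integral_congr_ae (Eventually.of_forall fun t => ?_)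
    rcases abs_choice t with h | h <;> simp only [h, neg_sq, neg_mul, Real.cos_neg]
  have e3 : ∫ t : ℝ, Real.exp (-c * t ^ 2) * Real.cos (t * s) =
      √(Real.pi / c) * Real.exp (-(s ^ 2 / (4 * c))) := by
    have hg := fourierIntegral_gaussian (b := (c : ℂ)) (by simpa using hc0) (s : ℂ)
    have h1 : ∫ t : ℝ, Real.exp (-c * t ^ 2) * Real.cos (t * s) =
        (∫ t : ℝ, Complex.exp (Complex.I * s * t) * Complex.exp (-c * (t : ℂ) ^ 2)).re := by
      rw [← RCLike.re_eq_complex_re, ← integral_re]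
      · refine integral_congr_ae (Eventually.of_forall fun t => ?_)
        simp only
        rw [← hre, RCLike.re_eq_complex_re, mul_comm]
        push_cast
        congr 3
        ring
      · refine hint.congr (Eventually.of_forall fun t => ?_)
        simp only
        rw [mul_comm]
        push_cast
        congr 2
        ring
    rw [h1, hg]
    have h2 : ((Real.pi : ℂ) / c) ^ (1 / 2 : ℂ) = ((√(Real.pi / c) : ℝ) : ℂ) := by
      rw [Real.sqrt_eq_rpow, Complex.ofReal_cpow (by positivity)]
      push_cast
      rfl
    have h3 : Complex.exp (-(s : ℂ) ^ 2 / (4 * c)) = ((Real.exp (-(s ^ 2 / (4 * c))) : ℝ) : ℂ) := by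
      push_cast
      congr 1
      ring
    rw [h2, h3, ← Complex.ofReal_mul, Complex.ofReal_re]
  have h4 : 4 * c = ((4 : ℝ) ^ i)⁻¹ := by
    rw [hc, quarterScale, pow_succ]
    field_simp
  have h5 : √(Real.pi / c) = √Real.pi * (2 * 2 ^ i) := by
    rw [Real.sqrt_div Real.pi_pos.le, div_eq_mul_inv]
    congr 1
    rw [hc, quarterScale, Real.sqrt_inv, inv_inv, show (4 : ℝ) ^ (i + 1) = (2 * 2 ^ i) ^ 2 by
      rw [← pow_succ', ← pow_mul, mul_comm, pow_mul]
      norm_num]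
    exact Real.sqrt_sq (by positivity)
  rw [h4, h5, div_inv_eq_mul, mul_comm (s ^ 2)] at e3
  rw [e1]
  linarith

/-- The dyadic approximation, from below, to a multiple of `|s| ^ (-(γ + 1))`. -/
def dyadicWeight (γ : ℝ) (I : ℕ) (s : ℝ) : ℝ :=
  ∑ i ∈ Finset.range (I + 1), (2 : ℝ) ^ (γ * i) * (2 ^ i * Real.exp (-(4 ^ i * s ^ 2)))

/-- The coefficient of the peak at `s = 0`. It is unbounded in `I`, which is why `I` stays fixed
until the sphere term has been removed. -/
def dyadicMass (γ : ℝ) (I : ℕ) : ℝ := ∑ i ∈ Finset.range (I + 1), (2 : ℝ) ^ (γ * i)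

theorem re_halfMultiplier_gaussDiff (γ : ℝ) (I m : ℕ) (s : ℝ) :
    (halfMultiplier (gaussDiff γ I m) s).re =
      √Real.pi * (dyadicMass γ I * (2 ^ m * Real.exp (-(4 ^ m * s ^ 2))) - dyadicWeight γ I s) := by
  have hG : ∀ i : ℕ, IntegrableOn (fun t : ℝ => ((Real.exp (-quarterScale i * t ^ 2) : ℝ) : ℂ) *
      Complex.exp (Complex.I * ((t * s : ℝ) : ℂ))) (Set.Ioi 0) := fun i =>
    IntegrableOn.mul_bounded (integrable_exp_neg_mul_sq (quarterScale_pos i)).integrableOn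
      (continuous_cexp_mul s) fun t => (norm_cexp_I_mul_ofReal _).le
  have e1 : halfMultiplier (gaussDiff γ I m) s = ∑ i ∈ Finset.range (I + 1),
      (((2 : ℝ) ^ (γ * i) : ℝ) : ℂ) *
        (halfMultiplier (fun t => Real.exp (-quarterScale m * t ^ 2)) s -
          halfMultiplier (fun t => Real.exp (-quarterScale i * t ^ 2)) s) := by
    simp only [halfMultiplier]
    have : ∀ t : ℝ, ((gaussDiff γ I m t : ℝ) : ℂ) * Complex.exp (Complex.I * ((t * s : ℝ) : ℂ)) =
        ∑ i ∈ Finset.range (I + 1), (((2 : ℝ) ^ (γ * i) : ℝ) : ℂ) *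
          (((Real.exp (-quarterScale m * t ^ 2) : ℝ) : ℂ) *
              Complex.exp (Complex.I * ((t * s : ℝ) : ℂ)) -
            ((Real.exp (-quarterScale i * t ^ 2) : ℝ) : ℂ) *
              Complex.exp (Complex.I * ((t * s : ℝ) : ℂ))) := fun t => by
      rw [gaussDiff, Complex.ofReal_sum, Finset.sum_mul]
      refine Finset.sum_congr rfl fun i _ => ?_
      push_cast
      ring
    simp only [this]
    have hD : ∀ i : ℕ, IntegrableOn (fun t : ℝ => (((2 : ℝ) ^ (γ * i) : ℝ) : ℂ) *
          (((Real.exp (-quarterScale m * t ^ 2) : ℝ) : ℂ) *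
              Complex.exp (Complex.I * ((t * s : ℝ) : ℂ)) -
            ((Real.exp (-quarterScale i * t ^ 2) : ℝ) : ℂ) *
              Complex.exp (Complex.I * ((t * s : ℝ) : ℂ)))) (Set.Ioi 0) := fun i =>
      ((hG m).sub (hG i)).const_mul _
    rw [integral_finsetSum _ fun i _ => hD i]
    refine Finset.sum_congr rfl fun i _ => ?_
    rw [integral_const_mul, integral_sub (hG m) (hG i)]
  rw [e1, Complex.re_sum, dyadicMass, dyadicWeight, Finset.sum_mul, ← Finset.sum_sub_distrib,
    Finset.mul_sum]
  refine Finset.sum_congr rfl fun i _ => ?_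
  rw [Complex.re_ofReal_mul, Complex.sub_re, re_halfMultiplier_gauss, re_halfMultiplier_gauss]
  ring

theorem dyadicWeight_nonneg (γ : ℝ) (I : ℕ) (s : ℝ) : 0 ≤ dyadicWeight γ I s :=
  Finset.sum_nonneg fun i _ => by positivity

theorem dyadicMass_nonneg (γ : ℝ) (I : ℕ) : 0 ≤ dyadicMass γ I :=
  Finset.sum_nonneg fun i _ => by positivity

theorem continuous_dyadicWeight (γ : ℝ) (I : ℕ) : Continuous (dyadicWeight γ I) := by
  unfold dyadicWeight
  fun_prop

/-- One term suffices: the index `i` with `2^i ≤ 1/s < 2^(i+1)`, which is available because `s ≥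
2^(-I)`. -/
theorem dyadicWeight_ge {γ s : ℝ} {I : ℕ} (hγ : 0 ≤ γ) (hs1 : s ≤ 1) (hsI : (2 ^ I : ℝ)⁻¹ ≤ s) :
    Real.exp (-1) * 2 ^ (-(γ + 1)) * s ^ (-(γ + 1)) ≤ dyadicWeight γ I s := by
  have hs0 : 0 < s := lt_of_lt_of_le (by positivity) hsI
  have hinv : 1 ≤ s⁻¹ := (one_le_inv₀ hs0).2 hs1
  obtain ⟨i, hi1, hi2⟩ := exists_nat_pow_near hinv (one_lt_two (α := ℝ))
  have hiI : i ≤ I := by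
    have : (2 : ℝ) ^ i ≤ 2 ^ I := hi1.trans (inv_le_of_inv_le₀ (by positivity) hsI)
    exact (pow_le_pow_iff_right₀ (one_lt_two (α := ℝ))).1 this
  have hterm : Real.exp (-1) * 2 ^ (-(γ + 1)) * s ^ (-(γ + 1)) ≤
      (2 : ℝ) ^ (γ * i) * (2 ^ i * Real.exp (-(4 ^ i * s ^ 2))) := by
    have h1 : (4 : ℝ) ^ i * s ^ 2 ≤ 1 := by
      have h2 : (2 : ℝ) ^ i * s ≤ 1 := by
        calc (2 : ℝ) ^ i * s ≤ s⁻¹ * s := mul_le_mul_of_nonneg_right hi1 hs0.le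
          _ = 1 := inv_mul_cancel₀ hs0.ne'
      have h3 : (4 : ℝ) ^ i * s ^ 2 = (2 ^ i * s) ^ 2 := by
        rw [mul_pow, ← pow_mul, mul_comm i 2, pow_mul]
        norm_num
      rw [h3]
      exact pow_le_one₀ (by positivity) h2
    have h2 : Real.exp (-1) ≤ Real.exp (-(4 ^ i * s ^ 2)) := Real.exp_le_exp.2 (by linarith)
    have h3 : (2 : ℝ) ^ (-(γ + 1)) * s ^ (-(γ + 1)) ≤ 2 ^ (γ * i) * 2 ^ i := by
      have e : (2 : ℝ) ^ (γ * i) * 2 ^ i = (2 ^ i) ^ (γ + 1) := by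
        rw [Real.rpow_add_one (by positivity), ← Real.rpow_natCast, ← Real.rpow_mul zero_le_two,
          mul_comm γ]
      rw [e, ← Real.mul_rpow zero_le_two hs0.le, Real.rpow_neg (by positivity),
        ← Real.inv_rpow (by positivity)]
      refine Real.rpow_le_rpow (by positivity) ?_ (by linarith)
      rw [mul_inv, inv_mul_le_iff₀ two_pos]
      calc s⁻¹ ≤ 2 ^ (i + 1) := hi2.le
        _ = 2 * 2 ^ i := by ring
    calc _ = (2 : ℝ) ^ (-(γ + 1)) * s ^ (-(γ + 1)) * Real.exp (-1) := by ring
      _ ≤ 2 ^ (γ * i) * 2 ^ i * Real.exp (-(4 ^ i * s ^ 2)) := by gcongr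
      _ = _ := by ring
  exact hterm.trans (Finset.single_le_sum (f := fun i : ℕ =>
    (2 : ℝ) ^ (γ * i) * (2 ^ i * Real.exp (-(4 ^ i * s ^ 2)))) (fun i _ => by positivity)
    (Finset.mem_range.2 (by omega)))

end Weights

end BochnerRiesz

namespace BochnerRiesz

/-! ### Concentration of Gaussian layers on the sphere -/

noncomputable section SphereLimit

variable {n : ℕ}

theorem integral_eq_integral_sphere [Nontrivial (E n)] {F : E n → ℝ} (hF : Integrable F) :
    ∫ ξ, F ξ = ∫ r in Set.Ioi (0 : ℝ), r ^ (n - 1) *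
      ∫ ω, F (r • (ω : E n)) ∂surfaceMeasure n := by
  have hmp := (volume : Measure (E n)).measurePreserving_homeomorphUnitSphereProd
  have hemb := (homeomorphUnitSphereProd (E n)).measurableEmbedding
  rw [finrank_euclideanSpace, Fintype.card_fin] at hmp
  set Φ : Metric.sphere (0 : E n) 1 × Set.Ioi (0 : ℝ) → ℝ := fun z => F (z.2.1 • z.1.1) with hΦ
  have hcomp : ∀ x : ({0}ᶜ : Set (E n)), Φ (homeomorphUnitSphereProd (E n) x) = F x := by
    intro x
    rw [hΦ]
    simp only
    rw [← homeomorphUnitSphereProd_symm_apply_coe, Homeomorph.symm_apply_apply]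
  have hms : MeasurableSet ({0}ᶜ : Set (E n)) := (measurableSet_singleton _).compl
  have hint : Integrable Φ ((surfaceMeasure n).prod (.volumeIoiPow (n - 1))) := by
    rw [← hmp.integrable_comp_emb hemb]
    have : Φ ∘ homeomorphUnitSphereProd (E n) = F ∘ Subtype.val := funext hcomp
    rw [this, ← integrableOn_iff_comap_subtypeVal hms]
    exact hF.integrableOn
  calc ∫ ξ, F ξ = ∫ x : ({0}ᶜ : Set (E n)), F x ∂((volume : Measure (E n)).comap (↑)) := by
        rw [integral_subtype_comap hms fun x => F x, restrict_compl_singleton]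
    _ = ∫ x : ({0}ᶜ : Set (E n)), Φ (homeomorphUnitSphereProd (E n) x)
          ∂((volume : Measure (E n)).comap (↑)) := by simp only [hcomp]
    _ = ∫ z, Φ z ∂((surfaceMeasure n).prod (.volumeIoiPow (n - 1))) := hmp.integral_comp hemb Φ
    _ = ∫ r : Set.Ioi (0 : ℝ), ∫ ω, F (r.1 • (ω : E n)) ∂surfaceMeasure n
          ∂(.volumeIoiPow (n - 1)) := integral_prod_symm _ hint
    _ = _ := by
      unfold Measure.volumeIoiPow ENNReal.ofReal
      rw [integral_withDensity_eq_integral_smul,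
        integral_subtype_comap measurableSet_Ioi fun a => Real.toNNReal (a ^ (n - 1)) •
          ∫ ω, F (a • (ω : E n)) ∂surfaceMeasure n]
      · refine setIntegral_congr_fun measurableSet_Ioi fun x hx => ?_
        rw [NNReal.smul_def, Real.coe_toNNReal _ (pow_nonneg (le_of_lt hx) _), smul_eq_mul]
      · exact (measurable_subtype_coe.pow_const _).real_toNNReal

theorem integrable_peak_mul {G : ℝ → ℝ} {B : ℝ} (hG : Continuous G) (hB : ∀ r, |G r| ≤ B)
    {c : ℝ} (hc : 0 < c) :
    Integrable fun r : ℝ => c * Real.exp (-(c * (r - 1)) ^ 2) * G r := by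
  have h1 : Integrable fun r : ℝ => c * Real.exp (-(c * (r - 1)) ^ 2) := by
    have := ((integrable_exp_neg_mul_sq (b := c ^ 2) (by positivity)).comp_sub_right 1).const_mul c
    refine this.congr (Eventually.of_forall fun r => ?_)
    simp only
    ring_nf
  exact h1.mul_bdd (c := B) hG.aestronglyMeasurable (Eventually.of_forall hB)

/-- Substituting `u = 2^m (r - 1)` gives a fixed Gaussian of mass `√π`, and dominated convergence
applies. -/
theorem tendsto_integral_peak_mul {G : ℝ → ℝ} {B : ℝ} (hG : Continuous G) (hB : ∀ r, |G r| ≤ B) :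
    Tendsto (fun m : ℕ => ∫ r : ℝ, 2 ^ m * Real.exp (-(2 ^ m * (r - 1)) ^ 2) * G r) atTop
      (𝓝 (√Real.pi * G 1)) := by
  have hsub : ∀ m : ℕ, ∫ r : ℝ, 2 ^ m * Real.exp (-(2 ^ m * (r - 1)) ^ 2) * G r =
      ∫ u : ℝ, Real.exp (-u ^ 2) * G (1 + (2 ^ m)⁻¹ * u) := by
    intro m
    have h1 := integral_sub_right_eq_self (μ := volume)
      (fun r : ℝ => 2 ^ m * Real.exp (-(2 ^ m * r) ^ 2) * G (1 + r)) 1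
    have h2 := Measure.integral_comp_mul_left
      (fun u : ℝ => Real.exp (-u ^ 2) * G (1 + (2 ^ m)⁻¹ * u)) ((2 : ℝ) ^ m)
    rw [abs_of_pos (by positivity), smul_eq_mul, eq_inv_mul_iff_mul_eq₀ (by positivity),
      ← integral_const_mul] at h2
    simp only [add_sub_cancel] at h1
    rw [h1, ← h2]
    refine integral_congr_ae (Eventually.of_forall fun r => ?_)
    simp only
    rw [inv_mul_cancel_left₀ (by positivity), mul_assoc]
  simp only [hsub]
  have hlim : ∫ u : ℝ, Real.exp (-u ^ 2) * G 1 = √Real.pi * G 1 := by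
    rw [integral_mul_const]
    have := integral_gaussian 1
    simp only [neg_mul, one_mul, div_one] at this
    rw [this]
  rw [← hlim]
  have hgi : Integrable fun u : ℝ => Real.exp (-u ^ 2) := by
    simpa using integrable_exp_neg_mul_sq (b := 1) one_pos
  refine tendsto_integral_of_dominated_convergence (fun u => Real.exp (-u ^ 2) * B)
    (fun m => by fun_prop) (hgi.mul_const B) (fun m => ?_) ?_
  · refine Eventually.of_forall fun u => ?_
    rw [norm_mul, Real.norm_eq_abs, Real.norm_eq_abs, abs_of_pos (Real.exp_pos _)]
    exact mul_le_mul_of_nonneg_left (hB _) (Real.exp_pos _).le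
  · refine Eventually.of_forall fun u => ?_
    refine Tendsto.const_mul _ ((hG.tendsto 1).comp ?_)
    have h0 : Tendsto (fun m : ℕ => ((2 : ℝ) ^ m)⁻¹) atTop (𝓝 0) :=
      tendsto_inv_atTop_zero.comp (tendsto_pow_atTop_atTop_of_one_lt one_lt_two)
    simpa using (h0.mul_const u).const_add 1

/-- The mass of `‖φ̂‖²` against a Gaussian layer of width about `2⁻ᵐ` around the sphere. -/
def layerMass (φ : E n → ℂ) (m : ℕ) : ℝ :=
  ∫ ξ, 2 ^ m * Real.exp (-(4 ^ m * (1 - ‖ξ‖ ^ 2) ^ 2)) *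
    (Real.exp (-‖ξ‖ ^ 2) * ‖fourierInt φ ξ‖ ^ 2)

theorem integrable_exp_mul_fourierInt_sq (φ : 𝓢(E n, ℂ)) :
    Integrable fun ξ : E n => Real.exp (-‖ξ‖ ^ 2) * ‖fourierInt φ ξ‖ ^ 2 := by
  refine integrable_exp_neg_norm_sq.mul_bdd (c := (∫ x, ‖φ x‖) ^ 2) ?_ ?_
  · exact ((continuous_fourierInt φ.integrable).norm.pow 2).aestronglyMeasurable
  · refine Eventually.of_forall fun ξ => ?_
    rw [norm_pow, norm_norm]
    exact pow_le_pow_left₀ (norm_nonneg _) (norm_fourierInt_le _ _) 2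

theorem integrable_layer (φ : 𝓢(E n, ℂ)) (m : ℕ) :
    Integrable fun ξ : E n => 2 ^ m * Real.exp (-(4 ^ m * (1 - ‖ξ‖ ^ 2) ^ 2)) *
      (Real.exp (-‖ξ‖ ^ 2) * ‖fourierInt φ ξ‖ ^ 2) := by
  refine (integrable_exp_mul_fourierInt_sq φ).bdd_mul (c := 2 ^ m)
    (Continuous.aestronglyMeasurable (by fun_prop)) (Eventually.of_forall fun ξ => ?_)
  rw [Real.norm_of_nonneg (by positivity)]
  refine mul_le_of_le_one_right (by positivity) (Real.exp_le_one_iff.2 ?_)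
  have : (0 : ℝ) ≤ 4 ^ m * (1 - ‖ξ‖ ^ 2) ^ 2 := by positivity
  linarith

theorem exists_abs_pow_mul_exp_le (k : ℕ) : ∃ B : ℝ, ∀ r : ℝ, |r| ^ k * Real.exp (-r ^ 2) ≤ B := by
  refine ⟨k.factorial * Real.exp 1, fun r => ?_⟩
  have h1 : |r| ^ k ≤ k.factorial * Real.exp |r| := by
    have := Real.pow_div_factorial_le_exp |r| (abs_nonneg r) k
    rwa [div_le_iff₀' (by positivity)] at this
  calc |r| ^ k * Real.exp (-r ^ 2) ≤ k.factorial * Real.exp |r| * Real.exp (-r ^ 2) := by gcongr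
    _ = k.factorial * Real.exp (|r| - r ^ 2) := by rw [mul_assoc, ← Real.exp_add, ← sub_eq_add_neg]
    _ ≤ _ := by
      gcongr
      nlinarith [sq_abs r, sq_nonneg (|r| - 1)]

/-- In polar coordinates the layer is dominated by a one-dimensional peak at `r = 1` acting on the
spherical means of `|φ̂|²`. An upper bound is enough, so the exact limiting constant is not
computed. -/
theorem exists_tendsto_layerMass_le (hn : 0 < n) (φ : 𝓢(E n, ℂ)) :
    ∃ a : ℕ → ℝ, (∀ m, layerMass φ m ≤ a m) ∧
      Tendsto a atTop (𝓝 (√Real.pi * (Real.exp (-1) *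
        ∫ ω, ‖fourierInt φ (ω : E n)‖ ^ 2 ∂surfaceMeasure n))) := by
  have : Nonempty (Fin n) := ⟨⟨0, hn⟩⟩
  have : Nontrivial (E n) := inferInstance
  have hcont := continuous_fourierInt (n := n) φ.integrable
  set M := (∫ x, ‖φ x‖) ^ 2 with hM
  have hbd : ∀ ξ : E n, ‖fourierInt φ ξ‖ ^ 2 ≤ M := fun ξ =>
    pow_le_pow_left₀ (norm_nonneg _) (norm_fourierInt_le _ _) 2
  set Q : ℝ → ℝ := fun r => ∫ ω, ‖fourierInt φ (r • (ω : E n))‖ ^ 2 ∂surfaceMeasure n with hQ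
  have hQc : Continuous Q := by
    refine continuous_of_dominated (bound := fun _ => M) (fun r => ?_) (fun r => ?_)
      (integrable_const _) ?_
    · exact Continuous.aestronglyMeasurable (by fun_prop)
    · refine Eventually.of_forall fun ω => ?_
      rw [norm_pow, norm_norm]
      exact hbd _
    · exact Eventually.of_forall fun ω => by fun_prop
  have hQ0 : ∀ r, 0 ≤ Q r := fun r => integral_nonneg fun ω => by positivity
  have hQM : ∀ r, Q r ≤ M * (surfaceMeasure n).real Set.univ := by
    intro r
    have h1 : ∫ ω, ‖fourierInt φ (r • (ω : E n))‖ ^ 2 ∂surfaceMeasure n ≤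
        ∫ _, M ∂surfaceMeasure n := by
      refine integral_mono_of_nonneg (Eventually.of_forall fun ω => by positivity)
        (integrable_const _) (Eventually.of_forall fun ω => hbd _)
    rwa [integral_const, smul_eq_mul, mul_comm] at h1
  obtain ⟨B, hB⟩ := exists_abs_pow_mul_exp_le (n - 1)
  set G : ℝ → ℝ := fun r => |r| ^ (n - 1) * Real.exp (-r ^ 2) * Q r with hG
  have hGc : Continuous G := by fun_prop
  have hG0 : ∀ r, 0 ≤ G r := fun r => mul_nonneg (by positivity) (hQ0 r)
  have hGB : ∀ r, |G r| ≤ B * (M * (surfaceMeasure n).real Set.univ) := fun r => by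
    rw [abs_of_nonneg (hG0 r)]
    exact mul_le_mul (hB r) (hQM r) (hQ0 r) ((by positivity : (0 : ℝ) ≤ _).trans (hB r))
  have hlim := tendsto_integral_peak_mul hGc hGB
  have hG1 : G 1 = Real.exp (-1) * ∫ ω, ‖fourierInt φ (ω : E n)‖ ^ 2 ∂surfaceMeasure n := by
    simp [hG, hQ]
  rw [hG1] at hlim
  refine ⟨_, fun m => ?_, hlim⟩
  rw [layerMass, integral_eq_integral_sphere (integrable_layer φ m)]
  have hpi := integrable_peak_mul hGc hGB (c := 2 ^ m) (by positivity)
  -- Enlarging the half-line to the whole line is harmless since `G ≥ 0`; the absolute value in `G`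
  -- serves this extension.
  refine le_trans ?_ (setIntegral_le_integral (s := Set.Ioi 0) hpi
    (Eventually.of_forall fun r => mul_nonneg (by positivity) (hG0 r)))
  refine integral_mono_of_nonneg ?_ hpi.integrableOn ?_
  · filter_upwards [ae_restrict_mem measurableSet_Ioi] with r hr
    have hr0 : (0 : ℝ) < r := hr
    exact mul_nonneg (by positivity) (integral_nonneg fun ω => by positivity)
  · filter_upwards [ae_restrict_mem measurableSet_Ioi] with r hr
    have hr0 : (0 : ℝ) < r := hr
    have hnorm : ∀ ω : Metric.sphere (0 : E n) 1, ‖r • (ω : E n)‖ = r := fun ω => by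
      rw [norm_smul, norm_eq_of_mem_sphere, mul_one, Real.norm_of_nonneg hr0.le]
    simp only [hnorm, integral_const_mul]
    have h1 : Real.exp (-(4 ^ m * (1 - r ^ 2) ^ 2)) ≤ Real.exp (-(2 ^ m * (r - 1)) ^ 2) := by
      refine Real.exp_le_exp.2 (neg_le_neg ?_)
      rw [mul_pow, ← pow_mul, mul_comm m 2, pow_mul, show (2 : ℝ) ^ 2 = 4 by norm_num]
      refine mul_le_mul_of_nonneg_left ?_ (by positivity)
      -- The identity used is `(1 - r²)² - (r - 1)² = (r - 1)² r (r + 2)`.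
      nlinarith [mul_nonneg (sq_nonneg (r - 1)) (by positivity : (0 : ℝ) ≤ r * (r + 2))]
    have h2 : G r = r ^ (n - 1) * Real.exp (-r ^ 2) * Q r := by
      rw [hG]
      simp only [abs_of_pos hr0]
    rw [h2]
    calc _ = 2 ^ m * Real.exp (-(4 ^ m * (1 - r ^ 2) ^ 2)) *
          (r ^ (n - 1) * Real.exp (-r ^ 2) * Q r) := by
          rw [hQ]
          ring
      _ ≤ _ := by
          have := hQ0 r
          gcongr

end SphereLimit

end BochnerRiesz

namespace BochnerRiesz

/-! ### The weighted inequality for Schwartz functions -/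

noncomputable section SchwartzBound

open scoped ComplexConjugate

variable {n : ℕ}

theorem integrable_dyadicWeight_mul (γ : ℝ) (I : ℕ) (φ : 𝓢(E n, ℂ)) :
    Integrable fun ξ : E n => dyadicWeight γ I (1 - ‖ξ‖ ^ 2) *
      (Real.exp (-‖ξ‖ ^ 2) * ‖fourierInt φ ξ‖ ^ 2) := by
  refine (integrable_exp_mul_fourierInt_sq φ).bdd_mul
    (c := ∑ i ∈ Finset.range (I + 1), (2 : ℝ) ^ (γ * i) * 2 ^ i)
    ((continuous_dyadicWeight γ I).comp (by fun_prop)).aestronglyMeasurable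
    (Eventually.of_forall fun ξ => ?_)
  rw [Real.norm_of_nonneg (dyadicWeight_nonneg _ _ _)]
  refine Finset.sum_le_sum fun i _ => mul_le_mul_of_nonneg_left ?_ (by positivity)
  refine mul_le_of_le_one_right (by positivity) (Real.exp_le_one_iff.2 ?_)
  have : (0 : ℝ) ≤ 4 ^ i * (1 - ‖ξ‖ ^ 2) ^ 2 := by positivity
  linarith

theorem re_fourierForm_gaussDiff {γ H : ℝ} {I m : ℕ}
    (hs : IsSymbol (gaussDiff γ I m) (gaussDiffDeriv γ I m) γ H) (φ : 𝓢(E n, ℂ)) :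
    (fourierForm (formSymbol n (gaussDiff γ I m)) φ φ).re =
      √Real.pi * (dyadicMass γ I * layerMass φ m - ∫ ξ : E n, dyadicWeight γ I (1 - ‖ξ‖ ^ 2) *
        (Real.exp (-‖ξ‖ ^ 2) * ‖fourierInt φ ξ‖ ^ 2)) := by
  rw [layerMass, ← integral_const_mul, ← integral_sub ((integrable_layer φ m).const_mul _)
    (integrable_dyadicWeight_mul γ I φ), ← integral_const_mul, fourierForm,
    ← RCLike.re_eq_complex_re,
    ← integral_re (integrable_fourierForm (integrable_formSymbol hs.integrableOn) φ.integrable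
      φ.integrable)]
  refine integral_congr_ae (Eventually.of_forall fun ξ => ?_)
  simp only
  rw [Complex.mul_conj, Complex.normSq_eq_norm_sq, RCLike.re_eq_complex_re, Complex.re_mul_ofReal,
    formSymbol, Complex.re_mul_ofReal, re_halfMultiplier_gaussDiff]
  ring

/-- The weight enters the real part of the form with a minus sign, so the form bound controls it up
to the peak term. For fixed `I`, letting `m → ∞` replaces that term by the sphere norm, as the form
bound is uniform in `m`. -/
theorem exists_integral_dyadicWeight_le {α p : ℝ} (hn : 0 < n) (hα : 1 / 2 < α) (hα' : α < 3 / 2)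
    (hp : 1 ≤ p) (hp' : p ≤ (2 * (n : ℝ) + 2) / ((n : ℝ) + 1 + 4 * α)) :
    ∃ C : ℝ, 0 ≤ C ∧ ∀ (I : ℕ) (φ : 𝓢(E n, ℂ)),
      ∫ ξ : E n, dyadicWeight (2 * α - 1) I (1 - ‖ξ‖ ^ 2) *
        (Real.exp (-‖ξ‖ ^ 2) * ‖fourierInt φ ξ‖ ^ 2) ≤
      dyadicMass (2 * α - 1) I * (√Real.pi * (Real.exp (-1) *
        ∫ ω, ‖fourierInt φ (ω : E n)‖ ^ 2 ∂surfaceMeasure n)) +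
      C * (∫ x, ‖φ x‖ ^ p) ^ (2 / p) := by
  obtain ⟨C, hC, hform⟩ := exists_fourierForm_le n α p hα hp hp'
  obtain ⟨H, hH⟩ := exists_isSymbol_gaussDiff (γ := 2 * α - 1) (by linarith) (by linarith)
  have hH0 := (hH 0 0 le_rfl).nonneg
  have hpi : 0 < √Real.pi := Real.sqrt_pos.2 Real.pi_pos
  refine ⟨C * H / √Real.pi, by positivity, fun I φ => ?_⟩
  obtain ⟨a, ha, hlim⟩ := exists_tendsto_layerMass_le hn φ
  refine ge_of_tendsto ((hlim.const_mul (dyadicMass (2 * α - 1) I)).add_const _) ?_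
  filter_upwards [eventually_ge_atTop I] with m hm
  have h1 := (neg_le_abs _).trans
    ((Complex.abs_re_le_norm _).trans (hform _ _ H φ (hH I m hm)))
  rw [re_fourierForm_gaussDiff (hH I m hm) φ] at h1
  have h2 := mul_le_mul_of_nonneg_left (ha m) (dyadicMass_nonneg (2 * α - 1) I)
  have h3 : C * H / √Real.pi * (∫ x, ‖φ x‖ ^ p) ^ (2 / p) =
      C * H * (∫ x, ‖φ x‖ ^ p) ^ (2 / p) / √Real.pi := by ring
  rw [h3]
  have h4 : (∫ ξ : E n, dyadicWeight (2 * α - 1) I (1 - ‖ξ‖ ^ 2) *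
      (Real.exp (-‖ξ‖ ^ 2) * ‖fourierInt φ ξ‖ ^ 2)) - dyadicMass (2 * α - 1) I * layerMass φ m ≤
      C * H * (∫ x, ‖φ x‖ ^ p) ^ (2 / p) / √Real.pi := by
    rw [le_div_iff₀ hpi]
    linarith
  linarith

end SchwartzBound

end BochnerRiesz

namespace BochnerRiesz

/-! ### Convergence of Fourier transforms under `L^p` approximation -/

noncomputable section Approximation

variable {n : ℕ}

theorem IsFourierTransform.neg {f g : E n → ℂ} (h : IsFourierTransform f g) :
    IsFourierTransform (fun x => -f x) (fun ξ => -g ξ) := by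
  intro φ
  obtain ⟨h1, h2, h3⟩ := h φ
  simp only [neg_mul]
  exact ⟨h1.neg, h2.neg, by rw [integral_neg, integral_neg, h3]⟩

/-- The part of a function on the set where it exceeds `1` is integrable, the rest is in `L²`. -/
theorem exists_integrable_add_memLp_two {p : ℝ} (hp : 1 ≤ p) (hp2 : p ≤ 2) {f : E n → ℂ}
    (hf : MemLp f (ENNReal.ofReal p) volume) :
    ∃ f₁ f₂ : E n → ℂ, (∀ x, f x = f₁ x + f₂ x) ∧ Integrable f₁ ∧ MemLp f₂ 2 volume ∧
      ∫ x, ‖f₁ x‖ ≤ ∫ x, ‖f x‖ ^ p ∧ ∫ x, ‖f₂ x‖ ^ 2 ≤ ∫ x, ‖f x‖ ^ p := by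
  have hp0 : 0 < p := by linarith
  have hfp : Integrable fun x => ‖f x‖ ^ p := by
    have := hf.integrable_norm_rpow (by simpa using hp0) ENNReal.ofReal_ne_top
    rwa [ENNReal.toReal_ofReal hp0.le] at this
  set T₁ : ℂ → ℂ := fun z => if 1 < ‖z‖ then z else 0 with hT₁
  set T₂ : ℂ → ℂ := fun z => if 1 < ‖z‖ then 0 else z with hT₂
  have hm : MeasurableSet {z : ℂ | 1 < ‖z‖} := measurableSet_lt measurable_const measurable_norm
  have hm₁ : AEStronglyMeasurable (fun x => T₁ (f x)) volume :=
    ((Measurable.ite hm measurable_id measurable_const).comp_aemeasurable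
      hf.1.aemeasurable).aestronglyMeasurable
  have hm₂ : AEStronglyMeasurable (fun x => T₂ (f x)) volume :=
    ((Measurable.ite hm measurable_const measurable_id).comp_aemeasurable
      hf.1.aemeasurable).aestronglyMeasurable
  have hle₁ : ∀ z : ℂ, ‖T₁ z‖ ≤ ‖z‖ ^ p := fun z => by
    simp only [hT₁]
    split_ifs with h
    · exact Real.self_le_rpow_of_one_le h.le hp
    · rw [norm_zero]
      positivity
  have hle₂ : ∀ z : ℂ, ‖T₂ z‖ ^ 2 ≤ ‖z‖ ^ p := fun z => by
    simp only [hT₂]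
    split_ifs with h
    · rw [norm_zero, zero_pow two_ne_zero]
      positivity
    · rw [← Real.rpow_two]
      rcases (norm_nonneg z).eq_or_lt with h0 | h0
      · rw [← h0, Real.zero_rpow two_ne_zero, Real.zero_rpow hp0.ne']
      · exact Real.rpow_le_rpow_of_exponent_ge h0 (not_lt.1 h) hp2
  have hi₁ : Integrable fun x => T₁ (f x) :=
    hfp.mono' hm₁ (Eventually.of_forall fun x => hle₁ _)
  have hi₂ : Integrable fun x => ‖T₂ (f x)‖ ^ 2 :=
    hfp.mono' (hm₂.norm.pow 2) (Eventually.of_forall fun x => by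
      rw [norm_pow, norm_norm]
      exact hle₂ _)
  refine ⟨fun x => T₁ (f x), fun x => T₂ (f x), fun x => ?_, hi₁,
    (memLp_two_iff_integrable_sq_norm hm₂).2 hi₂, integral_mono hi₁.norm hfp fun x => hle₁ _,
    integral_mono hi₂ hfp fun x => hle₂ _⟩
  simp only [hT₁, hT₂]
  split_ifs <;> simp

theorem integral_norm_rpow_eq_eLpNorm_rpow {p : ℝ} (hp : 0 < p) {f : E n → ℂ}
    (hf : MemLp f (ENNReal.ofReal p) volume) :
    ∫ x, ‖f x‖ ^ p = (eLpNorm f (ENNReal.ofReal p) volume).toReal ^ p := by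
  have hpos : (ENNReal.ofReal p) ≠ 0 := by simpa using hp
  rw [hf.eLpNorm_eq_integral_rpow_norm hpos ENNReal.ofReal_ne_top, ENNReal.toReal_ofReal hp.le]
  have h0 : 0 ≤ ∫ x, ‖f x‖ ^ p := integral_nonneg fun x => by positivity
  rw [ENNReal.toReal_ofReal (by positivity), ← Real.rpow_mul h0, inv_mul_cancel₀ hp.ne',
    Real.rpow_one]

/-- An `L^p` function is the sum of an `L¹` and an `L²` function, both controlled by `∫ |f|^p`; the
first has a bounded transform, the second one in `L²`. -/
theorem exists_isFourierTransform_norm_le (n : ℕ) {p : ℝ} (hp : 1 ≤ p) (hp2 : p ≤ 2) :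
    ∃ C : ℝ≥0, ∀ f : E n → ℂ, MemLp f (ENNReal.ofReal p) volume → ∃ g₁ g₂ : E n → ℂ,
      IsFourierTransform f (fun ξ => g₁ ξ + g₂ ξ) ∧ (∀ ξ, ‖g₁ ξ‖ ≤ ∫ x, ‖f x‖ ^ p) ∧
      AEStronglyMeasurable g₂ volume ∧
      eLpNorm g₂ 2 volume ≤ C * ENNReal.ofReal (√(∫ x, ‖f x‖ ^ p)) := by
  obtain ⟨C, hC⟩ := exists_isFourierTransform_of_memLp_two n
  refine ⟨C, fun f hf => ?_⟩
  obtain ⟨f₁, f₂, hadd, hi₁, hi₂, hle₁, hle₂⟩ := exists_integrable_add_memLp_two hp hp2 hf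
  obtain ⟨g₂, hg₂, hmem, hle⟩ := hC f₂ hi₂
  refine ⟨fourierInt f₁, g₂, ?_, fun ξ => (norm_fourierInt_le _ _).trans hle₁, hmem.1,
    hle.trans ?_⟩
  · rw [funext hadd]
    exact (isFourierTransform_of_integrable hi₁).add hg₂
  · refine mul_le_mul_right ?_ _
    rw [hi₂.eLpNorm_eq_integral_rpow_norm two_ne_zero ENNReal.ofNat_ne_top]
    refine ENNReal.ofReal_le_ofReal ?_
    rw [Real.sqrt_eq_rpow]
    simp only [ENNReal.toReal_ofNat, Real.rpow_two, one_div]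
    exact Real.rpow_le_rpow (integral_nonneg fun x => by positivity) hle₂ (by norm_num)

/-- Decompose the differences `φ_k - f`: the `L¹` parts have transforms tending to `0` uniformly,
and the `L²` parts tend to `0` almost everywhere along a subsequence. -/
theorem exists_subseq_tendsto_fourierInt {p : ℝ} (hp : 1 ≤ p) (hp2 : p ≤ 2) {f : E n → ℂ}
    (hf : MemLp f (ENNReal.ofReal p) volume) {φ : ℕ → 𝓢(E n, ℂ)}
    (hφ : Tendsto (fun k => eLpNorm (fun x => φ k x - f x) (ENNReal.ofReal p) volume) atTop
      (𝓝 0)) :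
    ∃ g : E n → ℂ, IsFourierTransform f g ∧ AEStronglyMeasurable g volume ∧
      ∃ ns : ℕ → ℕ, StrictMono ns ∧
        ∀ᵐ ξ, Tendsto (fun k => fourierInt (φ (ns k)) ξ) atTop (𝓝 (g ξ)) := by
  obtain ⟨C, hC⟩ := exists_isFourierTransform_norm_le n hp hp2
  have hp0 : 0 < p := by linarith
  obtain ⟨G₁, G₂, hg, -⟩ := hC f hf
  set g : E n → ℂ := fun ξ => G₁ ξ + G₂ ξ
  have hd : ∀ k, MemLp (fun x => φ k x - f x) (ENNReal.ofReal p) volume := fun k =>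
    ((φ k).memLp _).sub hf
  choose g₁ g₂ hft hle₁ hm₂ hle₂ using fun k => hC _ (hd k)
  have hP : Tendsto (fun k => ∫ x, ‖φ k x - f x‖ ^ p) atTop (𝓝 0) := by
    simp only [fun k => integral_norm_rpow_eq_eLpNorm_rpow hp0 (hd k)]
    have h1 := (ENNReal.tendsto_toReal ENNReal.zero_ne_top).comp hφ
    have h2 := h1.rpow_const (p := p) (Or.inr hp0.le)
    simpa [Real.zero_rpow hp0.ne'] using h2
  have h₂ : Tendsto (fun k => eLpNorm (g₂ k - 0) 2 volume) atTop (𝓝 0) := by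
    simp only [sub_zero]
    have h1 := ENNReal.Tendsto.const_mul (a := (C : ℝ≥0∞))
      (ENNReal.tendsto_ofReal (Real.continuous_sqrt.continuousAt.tendsto.comp hP))
      (Or.inr ENNReal.coe_ne_top)
    simp only [Real.sqrt_zero, ENNReal.ofReal_zero, mul_zero] at h1
    exact tendsto_of_tendsto_of_tendsto_of_le_of_le tendsto_const_nhds h1
      (fun k => zero_le) hle₂
  obtain ⟨ns, hns, hae⟩ := (tendstoInMeasure_of_tendsto_eLpNorm two_ne_zero hm₂
    aestronglyMeasurable_const h₂).exists_seq_tendsto_ae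
  -- Uniqueness of the distributional transform identifies the decomposed one with `φ̂_k - g` almost
  -- everywhere.
  have heq : ∀ k, (fun ξ => fourierInt (φ k) ξ + -g ξ) =ᵐ[volume] fun ξ => g₁ k ξ + g₂ k ξ := by
    intro k
    have h1 := (isFourierTransform_of_integrable (φ k).integrable).add hg.neg
    simp only [← sub_eq_add_neg] at h1 ⊢
    exact h1.ae_eq (hft k)
  have hlim : ∀ᵐ ξ, Tendsto (fun k => fourierInt (φ (ns k)) ξ) atTop (𝓝 (g ξ)) := by
    filter_upwards [hae, ae_all_iff.2 heq] with ξ hξ hall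
    have h1 : Tendsto (fun k => g₁ (ns k) ξ) atTop (𝓝 0) :=
      squeeze_zero_norm (fun k => hle₁ (ns k) ξ) (hP.comp hns.tendsto_atTop)
    have h2 : Tendsto (fun k => g₁ (ns k) ξ + g₂ (ns k) ξ + g ξ) atTop (𝓝 (0 + 0 + g ξ)) :=
      (h1.add hξ).add_const (g ξ)
    rw [zero_add, zero_add] at h2
    refine h2.congr fun k => ?_
    rw [← hall (ns k)]
    ring
  exact ⟨g, hg, aestronglyMeasurable_of_tendsto_ae atTop
    (fun k => (continuous_fourierInt (φ (ns k)).integrable).aestronglyMeasurable) hlim,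
    ns, hns, hlim⟩

end Approximation

end BochnerRiesz

namespace BochnerRiesz

/-! ### Passage to `L^p` functions whose transform vanishes on the sphere -/

noncomputable section Extension

variable {n : ℕ}

theorem integral_sphere_eq_eLpNorm_sq (φ : 𝓢(E n, ℂ)) :
    ∫ ω, ‖fourierInt φ (ω : E n)‖ ^ 2 ∂surfaceMeasure n =
      (eLpNorm (fun ω : Metric.sphere (0 : E n) 1 => fourierInt φ (ω : E n)) 2
        (surfaceMeasure n)).toReal ^ 2 := by
  have hc := continuous_fourierInt (n := n) φ.integrable
  have hm : MemLp (fun ω : Metric.sphere (0 : E n) 1 => fourierInt φ (ω : E n)) 2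
      (surfaceMeasure n) :=
    MemLp.of_bound (Continuous.aestronglyMeasurable (by fun_prop)) (∫ x, ‖φ x‖)
      (Eventually.of_forall fun ω => norm_fourierInt_le _ _)
  have h0 : 0 ≤ ∫ ω, ‖fourierInt φ (ω : E n)‖ ^ 2 ∂surfaceMeasure n :=
    integral_nonneg fun ω => by positivity
  rw [hm.eLpNorm_eq_integral_rpow_norm two_ne_zero ENNReal.ofNat_ne_top]
  simp only [ENNReal.toReal_ofNat, Real.rpow_two]
  rw [ENNReal.toReal_ofReal (by positivity), ← Real.rpow_two, ← Real.rpow_mul h0]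
  norm_num

/-- The weighted `L²` bound, uniform in the approximation of the weight, for functions whose
Fourier transform vanishes on the sphere. -/
theorem exists_lintegral_dyadicWeight_le {α p : ℝ} (hn : 0 < n) (hα : 1 / 2 < α)
    (hα' : α < 3 / 2) (hp : 1 ≤ p) (hp' : p ≤ (2 * (n : ℝ) + 2) / ((n : ℝ) + 1 + 4 * α)) :
    ∃ C : ℝ, 0 ≤ C ∧ ∀ f : E n → ℂ, MemLp f (ENNReal.ofReal p) volume →
      FourierVanishesOnSphere (ENNReal.ofReal p) f →
      ∃ g : E n → ℂ, IsFourierTransform f g ∧ AEStronglyMeasurable g volume ∧ ∀ I : ℕ,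
        ∫⁻ ξ, ENNReal.ofReal (dyadicWeight (2 * α - 1) I (1 - ‖ξ‖ ^ 2) *
          (Real.exp (-‖ξ‖ ^ 2) * ‖g ξ‖ ^ 2)) ≤
        ENNReal.ofReal (C * (eLpNorm f (ENNReal.ofReal p) volume).toReal ^ 2) := by
  obtain ⟨C, hC, hmain⟩ := exists_integral_dyadicWeight_le hn hα hα' hp hp'
  have hp0 : 0 < p := by linarith
  have hp2 : p ≤ 2 := by
    have hn0 : (0 : ℝ) ≤ n := n.cast_nonneg
    refine hp'.trans ?_
    rw [div_le_iff₀ (by linarith)]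
    linarith
  refine ⟨C, hC, fun f hf hvan => ?_⟩
  obtain ⟨φ, hφ, hS⟩ := hvan
  obtain ⟨g, hg, hgm, ns, hns, hae⟩ := exists_subseq_tendsto_fourierInt hp hp2 hf hφ
  refine ⟨g, hg, hgm, fun I => ?_⟩
  set N := (eLpNorm f (ENNReal.ofReal p) volume).toReal with hN
  set e : ℕ → ℝ := fun k =>
    (eLpNorm (fun x => φ k x - f x) (ENNReal.ofReal p) volume).toReal with he
  set s : ℕ → ℝ := fun k => (eLpNorm (fun ω : Metric.sphere (0 : E n) 1 =>
    fourierInt (φ k) (ω : E n)) 2 (surfaceMeasure n)).toReal with hs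
  have he0 : Tendsto e atTop (𝓝 0) := (ENNReal.tendsto_toReal ENNReal.zero_ne_top).comp hφ
  have hs0 : Tendsto s atTop (𝓝 0) := by
    simp only [sub_zero] at hS
    exact (ENNReal.tendsto_toReal ENNReal.zero_ne_top).comp hS
  have hpow : ∀ k, (∫ x, ‖φ k x‖ ^ p) ^ (2 / p) ≤ (e k + N) ^ 2 := by
    intro k
    rw [integral_norm_rpow_eq_eLpNorm_rpow hp0 ((φ k).memLp _),
      ← Real.rpow_mul ENNReal.toReal_nonneg, mul_div_cancel₀ _ hp0.ne', Real.rpow_two]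
    refine pow_le_pow_left₀ ENNReal.toReal_nonneg ?_ 2
    have hd : MemLp (fun x => φ k x - f x) (ENNReal.ofReal p) volume := ((φ k).memLp _).sub hf
    rw [he, hN]
    simp only
    rw [← ENNReal.toReal_add hd.2.ne hf.2.ne]
    refine ENNReal.toReal_mono (ENNReal.add_ne_top.2 ⟨hd.2.ne, hf.2.ne⟩) ?_
    have h1 := eLpNorm_add_le hd.1 hf.1 (p := ENNReal.ofReal p)
      (by simpa using ENNReal.ofReal_le_ofReal hp)
    refine le_trans (le_of_eq ?_) h1
    congr 1
    ext x
    simp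
  have hbound : ∀ k, ∫ ξ : E n, dyadicWeight (2 * α - 1) I (1 - ‖ξ‖ ^ 2) *
      (Real.exp (-‖ξ‖ ^ 2) * ‖fourierInt (φ k) ξ‖ ^ 2) ≤
      dyadicMass (2 * α - 1) I * (√Real.pi * (Real.exp (-1) * s k ^ 2)) + C * (e k + N) ^ 2 := by
    intro k
    refine (hmain I (φ k)).trans ?_
    rw [integral_sphere_eq_eLpNorm_sq]
    have := mul_le_mul_of_nonneg_left (hpow k) hC
    linarith
  have hlim : Tendsto (fun k => dyadicMass (2 * α - 1) I *
      (√Real.pi * (Real.exp (-1) * s k ^ 2)) + C * (e k + N) ^ 2) atTop (𝓝 (C * N ^ 2)) := by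
    have h1 := ((((hs0.pow 2).const_mul (Real.exp (-1))).const_mul √Real.pi).const_mul
      (dyadicMass (2 * α - 1) I)).add (((he0.add_const N).pow 2).const_mul C)
    simpa using h1
  -- Fatou's lemma in `k` with `I` fixed: the finite factor `dyadicMass` multiplies a sphere norm
  -- tending to `0`.
  calc _ = ∫⁻ ξ, liminf (fun k => ENNReal.ofReal (dyadicWeight (2 * α - 1) I (1 - ‖ξ‖ ^ 2) *
          (Real.exp (-‖ξ‖ ^ 2) * ‖fourierInt (φ (ns k)) ξ‖ ^ 2))) atTop := by
        refine lintegral_congr_ae ?_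
        filter_upwards [hae] with ξ hξ
        exact (ENNReal.tendsto_ofReal (((hξ.norm.pow 2).const_mul _).const_mul _)).liminf_eq.symm
    _ ≤ liminf (fun k => ∫⁻ ξ, ENNReal.ofReal (dyadicWeight (2 * α - 1) I (1 - ‖ξ‖ ^ 2) *
          (Real.exp (-‖ξ‖ ^ 2) * ‖fourierInt (φ (ns k)) ξ‖ ^ 2))) atTop :=
        lintegral_liminf_le' fun k =>
          (integrable_dyadicWeight_mul _ I (φ (ns k))).1.aemeasurable.ennreal_ofReal
    _ ≤ liminf (fun k => ENNReal.ofReal (dyadicMass (2 * α - 1) I *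
          (√Real.pi * (Real.exp (-1) * s (ns k) ^ 2)) + C * (e (ns k) + N) ^ 2)) atTop := by
        refine liminf_le_liminf (Eventually.of_forall fun k => ?_)
        rw [← ofReal_integral_eq_lintegral_ofReal (integrable_dyadicWeight_mul _ I (φ (ns k)))
          (Eventually.of_forall fun ξ => mul_nonneg (dyadicWeight_nonneg _ _ _) (by positivity))]
        exact ENNReal.ofReal_le_ofReal (hbound (ns k))
    _ = _ := (ENNReal.tendsto_ofReal (hlim.comp hns.tendsto_atTop)).liminf_eq

/-- At each interior point the weight eventually dominates `(1 - |ξ|²)^(-2α)`, and this dominates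
`(1 - |ξ|²)^(-2β)` since the base is at most `1`. The two factors `e` compensate the constant of the
weight bound and the Gaussian `e^{-|ξ|²}`. -/
theorem eventually_multiplier_sq_le {α β : ℝ} (hα : 1 / 2 ≤ α) (hβ : β ≤ α) (ξ : E n) :
    ∀ᶠ I in atTop, multiplier (-β) ξ ^ 2 ≤ Real.exp 2 * 2 ^ (2 * α) *
      (dyadicWeight (2 * α - 1) I (1 - ‖ξ‖ ^ 2) * Real.exp (-‖ξ‖ ^ 2)) := by
  by_cases hξ : ‖ξ‖ < 1
  swap
  · refine Eventually.of_forall fun I => ?_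
    rw [multiplier, if_neg hξ, zero_pow two_ne_zero]
    have := dyadicWeight_nonneg (2 * α - 1) I (1 - ‖ξ‖ ^ 2)
    positivity
  set σ := 1 - ‖ξ‖ ^ 2 with hσ
  have hξ2 : ‖ξ‖ ^ 2 < 1 := pow_lt_one₀ (norm_nonneg _) hξ two_ne_zero
  have hσ0 : 0 < σ := by linarith
  have hσ1 : σ ≤ 1 := by
    have := sq_nonneg ‖ξ‖
    linarith
  have h0 : Tendsto (fun I : ℕ => ((2 : ℝ) ^ I)⁻¹) atTop (𝓝 0) :=
    tendsto_inv_atTop_zero.comp (tendsto_pow_atTop_atTop_of_one_lt one_lt_two)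
  filter_upwards [h0.eventually_le_const hσ0] with I hI
  have h1 := dyadicWeight_ge (γ := 2 * α - 1) (by linarith) hσ1 hI
  rw [show 2 * α - 1 + 1 = 2 * α by ring] at h1
  have h2 : multiplier (-β) ξ ^ 2 ≤ σ ^ (-(2 * α)) := by
    rw [multiplier, if_pos hξ, ← hσ, ← Real.rpow_natCast, ← Real.rpow_mul hσ0.le]
    refine Real.rpow_le_rpow_of_exponent_ge hσ0 hσ1 ?_
    push_cast
    linarith
  have h3 : Real.exp (-1) ≤ Real.exp (-‖ξ‖ ^ 2) := Real.exp_le_exp.2 (by linarith)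
  have h4 : Real.exp (2 : ℝ) * (Real.exp (-1) * Real.exp (-1)) = 1 := by
    rw [← Real.exp_add, ← Real.exp_add]
    norm_num
  have h5 : (2 : ℝ) ^ (2 * α) * 2 ^ (-(2 * α)) = 1 := by
    rw [← Real.rpow_add two_pos]
    norm_num
  calc _ ≤ σ ^ (-(2 * α)) := h2
    _ = Real.exp 2 * 2 ^ (2 * α) *
        (Real.exp (-1) * 2 ^ (-(2 * α)) * σ ^ (-(2 * α)) * Real.exp (-1)) := by
      calc _ = (Real.exp (2 : ℝ) * (Real.exp (-1) * Real.exp (-1))) *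
            ((2 : ℝ) ^ (2 * α) * 2 ^ (-(2 * α))) * σ ^ (-(2 * α)) := by
            rw [h4, h5, one_mul, one_mul]
        _ = _ := by ring
    _ ≤ _ := by
      have := dyadicWeight_nonneg (2 * α - 1) I σ
      gcongr

theorem measurable_multiplier (z : ℝ) : Measurable (multiplier z : E n → ℝ) := by
  unfold multiplier
  exact Measurable.ite (measurableSet_lt measurable_norm measurable_const)
    ((measurable_const.sub (measurable_norm.pow_const 2)).pow_const z) measurable_const

/-- The weight bound is uniform in `I`, so Fatou's lemma in `I` puts the weighted transform in `L²`,
and Plancherel gives `u`. Allowing `β < α` makes the limiting order `1/2` accessible. -/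
theorem exists_isBochnerRiesz_of_lt {α β p : ℝ} (hn : 0 < n) (hβ : β ≤ α) (hα : 1 / 2 < α)
    (hα' : α < 3 / 2) (hp : 1 ≤ p) (hp' : p ≤ (2 * (n : ℝ) + 2) / ((n : ℝ) + 1 + 4 * α)) :
    ∃ C : ℝ≥0, ∀ f : E n → ℂ, MemLp f (ENNReal.ofReal p) volume →
      FourierVanishesOnSphere (ENNReal.ofReal p) f →
      ∃ u : E n → ℂ, IsBochnerRiesz (-β) f u ∧ MemLp u 2 volume ∧
        eLpNorm u 2 volume ≤ C * eLpNorm f (ENNReal.ofReal p) volume := by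
  obtain ⟨C, hC, hmain⟩ := exists_lintegral_dyadicWeight_le hn hα hα' hp hp'
  obtain ⟨D, hD⟩ := exists_isFourierTransform_inverse n
  set K : ℝ := Real.exp 2 * 2 ^ (2 * α) with hK
  have hK0 : 0 < K := by positivity
  refine ⟨D * (√(K * C)).toNNReal, fun f hf hvan => ?_⟩
  obtain ⟨g, hg, hgm, hle⟩ := hmain f hf hvan
  set N := (eLpNorm f (ENNReal.ofReal p) volume).toReal with hN
  set v : E n → ℂ := fun ξ => (multiplier (-β) ξ : ℂ) * g ξ with hv
  have hvm : AEStronglyMeasurable v volume :=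
    (Complex.measurable_ofReal.comp (measurable_multiplier (-β))).aestronglyMeasurable.mul hgm
  have hpt : ∀ ξ, ‖v ξ‖ₑ ^ (2 : ℝ) ≤ liminf (fun I : ℕ => ENNReal.ofReal (K *
      (dyadicWeight (2 * α - 1) I (1 - ‖ξ‖ ^ 2) * (Real.exp (-‖ξ‖ ^ 2) * ‖g ξ‖ ^ 2)))) atTop := by
    intro ξ
    refine le_liminf_of_le (by isBoundedDefault) ?_
    filter_upwards [eventually_multiplier_sq_le hα.le hβ ξ] with I hI
    rw [← ofReal_norm, ENNReal.ofReal_rpow_of_nonneg (norm_nonneg _) zero_le_two, Real.rpow_two]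
    refine ENNReal.ofReal_le_ofReal ?_
    rw [hv]
    simp only
    rw [norm_mul, mul_pow, Complex.norm_real, Real.norm_eq_abs, sq_abs]
    calc _ ≤ K * (dyadicWeight (2 * α - 1) I (1 - ‖ξ‖ ^ 2) * Real.exp (-‖ξ‖ ^ 2)) * ‖g ξ‖ ^ 2 :=
          mul_le_mul_of_nonneg_right hI (by positivity)
      _ = _ := by ring
  have hlint : ∫⁻ ξ, ‖v ξ‖ₑ ^ (2 : ℝ) ≤ ENNReal.ofReal (K * C * N ^ 2) := by
    calc _ ≤ _ := lintegral_mono hpt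
      _ ≤ liminf (fun I : ℕ => ∫⁻ ξ, ENNReal.ofReal (K *
          (dyadicWeight (2 * α - 1) I (1 - ‖ξ‖ ^ 2) * (Real.exp (-‖ξ‖ ^ 2) * ‖g ξ‖ ^ 2)))) atTop := by
        refine lintegral_liminf_le' fun I => AEMeasurable.ennreal_ofReal ?_
        have h1 : Measurable fun ξ : E n => dyadicWeight (2 * α - 1) I (1 - ‖ξ‖ ^ 2) :=
          ((continuous_dyadicWeight _ I).comp (by fun_prop)).measurable
        have h2 : AEMeasurable (fun ξ => ‖g ξ‖ ^ 2) volume := hgm.norm.aemeasurable.pow_const 2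
        exact (h1.aemeasurable.mul (Continuous.measurable (by fun_prop) |>.aemeasurable.mul h2)).const_mul K
      _ ≤ liminf (fun _ : ℕ => ENNReal.ofReal (K * C * N ^ 2)) atTop := by
        refine liminf_le_liminf (Eventually.of_forall fun I => ?_)
        simp only [ENNReal.ofReal_mul hK0.le, mul_assoc K]
        rw [lintegral_const_mul' _ _ ENNReal.ofReal_ne_top]
        exact mul_le_mul_right (hle I) _
      _ = _ := liminf_const _
  have hnorm : eLpNorm v 2 volume ≤
      ENNReal.ofReal √(K * C) * eLpNorm f (ENNReal.ofReal p) volume := by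
    rw [eLpNorm_eq_lintegral_rpow_enorm_toReal two_ne_zero ENNReal.ofNat_ne_top,
      ENNReal.toReal_ofNat]
    refine (ENNReal.rpow_le_rpow hlint (by norm_num)).trans (le_of_eq ?_)
    rw [ENNReal.ofReal_rpow_of_nonneg (by positivity) (by norm_num), ← Real.sqrt_eq_rpow,
      Real.sqrt_mul (by positivity), Real.sqrt_sq ENNReal.toReal_nonneg,
      ENNReal.ofReal_mul (Real.sqrt_nonneg _), ENNReal.ofReal_toReal hf.2.ne]
  have hvmem : MemLp v 2 volume :=
    ⟨hvm, hnorm.trans_lt (ENNReal.mul_lt_top ENNReal.ofReal_lt_top hf.2)⟩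
  obtain ⟨u, hu, humem, hule⟩ := hD v hvmem
  refine ⟨u, ⟨g, hg, hu⟩, humem, hule.trans ?_⟩
  rw [ENNReal.coe_mul, mul_assoc]
  exact mul_le_mul_right hnorm _

end Extension

end BochnerRiesz

/-! ### Conclusion, including the limiting order -/

theorem mainTheorem3 (n : ℕ) (hn : 2 ≤ n) (α p : ℝ)
    (hα : 1 / 2 ≤ α) (hα' : α < 3 / 2)
    (hp : 1 ≤ p) (hp' : p ≤ (2 * (n : ℝ) + 2) / ((n : ℝ) + 1 + 4 * α))
    (hne : (α, p) ≠ (1 / 2, (2 * (n : ℝ) + 2) / ((n : ℝ) + 3))) :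
    ∃ C : ℝ≥0, ∀ f : BochnerRiesz.E n → ℂ,
      MemLp f (ENNReal.ofReal p) volume →
      BochnerRiesz.FourierVanishesOnSphere (ENNReal.ofReal p) f →
      ∃ u : BochnerRiesz.E n → ℂ,
        BochnerRiesz.IsBochnerRiesz (-α) f u ∧
        MemLp u 2 volume ∧
        eLpNorm u 2 volume ≤ C * eLpNorm f (ENNReal.ofReal p) volume := by
  have hn0 : (0 : ℝ) ≤ n := n.cast_nonneg
  rcases hα.lt_or_eq with h | rfl
  · exact BochnerRiesz.exists_isBochnerRiesz_of_lt (by omega) le_rfl h hα' hp hp'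
  have hp0 : 0 < p := by linarith
  -- For `α = 1/2` one has `γ = 0`, which the method excludes; the removed endpoint makes the
  -- condition on `p` strict and leaves room to raise the order.
  have hlt : p < (2 * (n : ℝ) + 2) / ((n : ℝ) + 3) := by
    rw [show (n : ℝ) + 1 + 4 * (1 / 2) = n + 3 by ring] at hp'
    exact lt_of_le_of_ne hp' fun h => hne (by rw [h])
  rw [lt_div_iff₀ (by linarith), mul_comm, ← lt_div_iff₀ hp0] at hlt
  -- The second entry is the largest order for which `p` is still admissible; the cap `1` keeps the
  -- order below `3/2`.
  set a : ℝ := min 1 (((2 * (n : ℝ) + 2) / p - (n + 1)) / 4) with ha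
  have ha1 : 1 / 2 < a := lt_min (by norm_num) (by linarith)
  have ha2 : a ≤ 1 := min_le_left _ _
  have ha3 : a ≤ ((2 * (n : ℝ) + 2) / p - (n + 1)) / 4 := min_le_right _ _
  refine BochnerRiesz.exists_isBochnerRiesz_of_lt (by omega) ha1.le ha1 (by linarith) hp ?_
  rw [le_div_iff₀ (by linarith), mul_comm, ← le_div_iff₀ hp0]
  linarith
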